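/- All lattices are even: free $\mathbb{Z}$-modules of finite rank with a non-degenerate symmetric integral bilinear form such that $(x,x)\in 2\mathbb{Z}$ for all $x$. For such a lattice $L$ let $L^*=\{x\in L\otimes\mathbb{Q}\mid (x,v)\in\mathbb{Z}\ \forall v\in L\}$, let $A_L=L^*/L$ with the discriminant form $q_L(x+L)=(x,x)\bmod 2\mathbb{Z}$, let $O(A_L)$ be the group of automorphisms of $A_L$ preserving $q_L$, and let $\tau:O(L)\to O(A_L)$ be the canonical homomorphism. The genus of $L$ consists of the even lattices with the same signature as $L$ and with discriminant form isomorphic to $q_L$. Let $\tilde O^+(L)\subset O(L)$ be the group of isometries that act trivially on $A_L$ and have real spinor norm $1$, where a product of reflections in $v_1,\dots,v_m\in L\otimes\mathbb{R}$ has real spinor norm $\prod_i(-v_i^2/2)\in\mathbb{R}^*/(\mathbb{R}^*)^2$. Let $I_2(L)$ be the set of primitive totally isotropic sublattices of rank two of $L$. Let $U$ be the hyperbolic plane, $E_8$ the negative definite $E_8$-lattice, and, for $d\equiv 3\pmod 4$, let $B_d$ be the negative definite lattice with Gram matrix $\begin{pmatrix}-(d+1)/2&1\\1&-2\end{pmatrix}$.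 Theorem. Let $d\equiv 3\pmod 4$ be a square-free positive integer and let $N=U^{\oplus 2}\oplus E_8^{\oplus 2}\oplus B_d$. Let $(E_i)_{i\in I}$ be any complete system of representatives, without repetition, of the isometry classes of lattices in the genus of $E_8^{\oplus 2}\oplus B_d$. Then there is a bijection between the orbit set $I_2(N)/\tilde O^+(N)$ and the set of pairs $$\{(E,l)\mid E=E_i \text{ for some } i\in I,\ l\in O(A_E)/\mathrm{Im}\,(\tau:O(E)\to O(A_E))\},$$ under which the orbit of $S\in I_2(N)$ corresponds to a pair $(E,l)$ with $E\cong S^\perp/S$. -/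

import Mathlib

open scoped TensorProduct

noncomputable section

/-- An even lattice: a finitely generated free `ℤ`-module with a non-degenerate symmetric
`ℤ`-valued bilinear form such that `(x, x)` is always even. -/
structure EvenLattice : Type 1 where
  carrier : Type
  [addCommGroup : AddCommGroup carrier]
  [free : Module.Free ℤ carrier]
  [finite : Module.Finite ℤ carrier]
  form : LinearMap.BilinForm ℤ carrier
  symm : ∀ x y, form x y = form y x
  nondeg : ∀ x, (∀ y, form x y = 0) → x = 0
  even : ∀ x, Even (form x x)

namespace EvenLattice

instance : CoeSort EvenLattice Type := ⟨EvenLattice.carrier⟩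

attribute [instance] EvenLattice.addCommGroup EvenLattice.free EvenLattice.finite

/-! ### Basic constructions -/

/-- The orthogonal direct sum. -/
def sum (L M : EvenLattice) : EvenLattice where
  carrier := L × M
  free := by
    have h : Module.Free ℤ (L.carrier × M.carrier) := inferInstance
    convert h
  finite := by
    have h : Module.Finite ℤ (L.carrier × M.carrier) := inferInstance
    convert h
  form := LinearMap.mk₂ ℤ (fun x y => L.form x.1 y.1 + M.form x.2 y.2)
    (by intros; simp; ring) (by intros; simp; ring)
    (by intros; simp; ring) (by intros; simp; ring)
  symm x y := by simp [L.symm x.1, M.symm x.2]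
  nondeg x h := by
    refine Prod.ext (L.nondeg _ fun y => ?_) (M.nondeg _ fun y => ?_)
    · simpa using h (y, 0)
    · simpa using h (0, y)
  even x := by simpa using (L.even x.1).add (M.even x.2)

/-- The lattice `ℤⁿ` with Gram matrix `A`, for a symmetric `A` with even diagonal and non-zero
determinant (the first two conditions are expressed by writing `A = T + Tᵀ`). -/
def ofGram {n : ℕ} (A : Matrix (Fin n) (Fin n) ℤ)
    (hA : ∃ T : Matrix (Fin n) (Fin n) ℤ, A = T + T.transpose) (hdet : A.det ≠ 0) :
    EvenLattice where
  carrier := Fin n → ℤ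
  free := by
    have h : Module.Free ℤ (Fin n → ℤ) := inferInstance
    convert h
  finite := by
    have h : Module.Finite ℤ (Fin n → ℤ) := inferInstance
    convert h
  form := Matrix.toBilin' A
  symm x y := by
    obtain ⟨T, rfl⟩ := hA
    simp only [Matrix.toBilin'_apply', Matrix.add_mulVec, dotProduct_add]
    rw [Matrix.dotProduct_mulVec x T.transpose, Matrix.dotProduct_mulVec x T,
      Matrix.vecMul_transpose, ← Matrix.mulVec_transpose, dotProduct_comm _ y,
      dotProduct_comm _ y, add_comm]
  nondeg x h := by
    have h1 := (LinearMap.BilinForm.nondegenerate_toBilin'_iff_det_ne_zero).2 hdet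
    exact h1.1 x h
  even x := by
    obtain ⟨T, rfl⟩ := hA
    refine ⟨x ⬝ᵥ T.mulVec x, ?_⟩
    simp only [Matrix.toBilin'_apply', Matrix.add_mulVec, dotProduct_add]
    rw [Matrix.dotProduct_mulVec x T.transpose, Matrix.vecMul_transpose, dotProduct_comm _ x]

/-- The hyperbolic plane. -/
def U : EvenLattice :=
  ofGram !![0, 1; 1, 0] ⟨!![0, 1; 0, 0], by decide⟩ (by decide)

/-- The negative definite lattice `E₈`. -/
def E8 : EvenLattice :=
  ofGram (-CartanMatrix.E₈)
    ⟨Matrix.of fun i j => if i < j then -CartanMatrix.E₈ i j else if i = j then -1 else 0,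
      by decide⟩
    (by rw [Matrix.det_neg, CartanMatrix.E₈_det]; decide)

/-- The negative definite lattice `B_d`, for `d ≡ 3 (mod 4)`. -/
def B (d : ℕ) (hd : d % 4 = 3) : EvenLattice :=
  ofGram !![-(((d : ℤ) + 1) / 2), 1; 1, -2]
    ⟨!![-(((d : ℤ) + 1) / 4), 1; 0, -1], by
      ext i j
      fin_cases i <;> fin_cases j <;> simp
      omega⟩
    (by rw [Matrix.det_fin_two_of]; omega)

/-- The lattice `E₈² ⊕ B_d`. -/
def E8E8B (d : ℕ) (hd : d % 4 = 3) : EvenLattice := (E8.sum E8).sum (B d hd)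

/-- The lattice `N = U² ⊕ E₈² ⊕ B_d`. -/
def N (d : ℕ) (hd : d % 4 = 3) : EvenLattice := (U.sum U).sum (E8E8B d hd)

/-! ### Isometries, dual lattice, discriminant form, genus -/

/-- `L` and `M` are isometric. -/
def Isometric (L M : EvenLattice) : Prop :=
  ∃ e : L ≃ₗ[ℤ] M, ∀ x y, M.form (e x) (e y) = L.form x y

/-- The group `O(L)` of isometries of `L`. -/
def O (L : EvenLattice) : Subgroup (L ≃ₗ[ℤ] L) where
  carrier := {g | ∀ x y, L.form (g x) (g y) = L.form x y}
  mul_mem' := by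
    intro g h hg hh x y
    rw [LinearEquiv.mul_apply, LinearEquiv.mul_apply, hg, hh]
  one_mem' := fun _ _ => rfl
  inv_mem' := by
    intro g hg x y
    rw [← hg]
    simp

/-- The form of `L` extended to `L ⊗ ℚ`. -/
def ratForm (L : EvenLattice) : LinearMap.BilinForm ℚ (ℚ ⊗[ℤ] L) := L.form.baseChange ℚ

/-- The image of `L` in `L ⊗ ℚ`. -/
def inRat (L : EvenLattice) : AddSubgroup (ℚ ⊗[ℤ] L) where
  carrier := {x | ∃ v : L, 1 ⊗ₜ v = x}
  zero_mem' := ⟨0, TensorProduct.tmul_zero _ _⟩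
  add_mem' := by
    rintro _ _ ⟨v, rfl⟩ ⟨w, rfl⟩
    exact ⟨v + w, TensorProduct.tmul_add _ _ _⟩
  neg_mem' := by
    rintro _ ⟨v, rfl⟩
    exact ⟨-v, TensorProduct.tmul_neg _ _⟩

/-- The dual lattice `L* = {x ∈ L ⊗ ℚ | (x, v) ∈ ℤ for all v ∈ L}`. -/
def dual (L : EvenLattice) : AddSubgroup (ℚ ⊗[ℤ] L) where
  carrier := {x | ∀ v : L, ∃ n : ℤ, L.ratForm x (1 ⊗ₜ v) = n}
  zero_mem' := fun v => ⟨0, by simp⟩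
  add_mem' := by
    intro x y hx hy v
    obtain ⟨m, hm⟩ := hx v
    obtain ⟨n, hn⟩ := hy v
    exact ⟨m + n, by simp [hm, hn]⟩
  neg_mem' := by
    intro x hx v
    obtain ⟨m, hm⟩ := hx v
    exact ⟨-m, by simp [hm]⟩

/-- The discriminant group `A_L = L* / L`. -/
abbrev Disc (L : EvenLattice) : Type := L.dual ⧸ L.inRat.addSubgroupOf L.dual

lemma ratForm_symm (L : EvenLattice) (x y : ℚ ⊗[ℤ] L) : L.ratForm x y = L.ratForm y x := by
  have : L.ratForm = L.ratForm.flip := by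
    ext x y
    simp [ratForm, L.symm x y]
  conv_lhs => rw [this]
  rfl

lemma discForm_aux (L : EvenLattice) (x y : L.dual)
    (h : -x + y ∈ L.inRat.addSubgroupOf L.dual) :
    (QuotientAddGroup.mk (L.ratForm x x) : ℚ ⧸ AddSubgroup.zmultiples (2 : ℚ)) =
      QuotientAddGroup.mk (L.ratForm y y) := by
  obtain ⟨v, hv⟩ : -(x : ℚ ⊗[ℤ] L) + y ∈ L.inRat := h
  have hy : (y : ℚ ⊗[ℤ] L) = (x : ℚ ⊗[ℤ] L) + 1 ⊗ₜ[ℤ] v := by rw [hv]; abel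
  obtain ⟨k, hk⟩ := x.2 v
  obtain ⟨m, hm⟩ := L.even v
  have hvv : L.ratForm (1 ⊗ₜ v) (1 ⊗ₜ v) = m + m := by
    simp [ratForm, hm]
  rw [QuotientAddGroup.eq, AddSubgroup.mem_zmultiples_iff, hy]
  refine ⟨k + m, ?_⟩
  simp only [map_add, LinearMap.add_apply, hvv, hk, L.ratForm_symm (1 ⊗ₜ v) x]
  simp
  ring

/-- The discriminant quadratic form `q_L : A_L → ℚ / 2ℤ`, `q_L (x + L) = (x, x) mod 2ℤ`. -/
def discForm (L : EvenLattice) : L.Disc → ℚ ⧸ AddSubgroup.zmultiples (2 : ℚ) :=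
  Quotient.lift (s := QuotientAddGroup.leftRel _)
    (fun x : L.dual => QuotientAddGroup.mk (L.ratForm x x))
    fun x y h => L.discForm_aux x y (QuotientAddGroup.leftRel_apply.1 h)

/-- The group `O(A_L)` of automorphisms of `A_L` preserving `q_L`. -/
def ODisc (L : EvenLattice) : Subgroup (L.Disc ≃ₗ[ℤ] L.Disc) where
  carrier := {g | ∀ a, L.discForm (g a) = L.discForm a}
  mul_mem' := by
    intro g h hg hh a
    rw [LinearEquiv.mul_apply, hg, hh]
  one_mem' := fun _ => rfl
  inv_mem' := by
    intro g hg a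
    rw [← hg]
    simp

/-- The number of positive squares of `L ⊗ ℝ`. -/
def sigPos (L : EvenLattice) : ℕ :=
  _root_.sigPos (LinearMap.BilinMap.toQuadraticMap (L.form.baseChange ℝ))

/-- The number of negative squares of `L ⊗ ℝ`. -/
def sigNeg (L : EvenLattice) : ℕ :=
  _root_.sigNeg (LinearMap.BilinMap.toQuadraticMap (L.form.baseChange ℝ))

/-- `L` and `M` have the same genus, i.e. the same signature and isomorphic discriminant
quadratic forms. -/
def SameGenus (L M : EvenLattice) : Prop :=
  L.sigPos = M.sigPos ∧ L.sigNeg = M.sigNeg ∧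
    ∃ e : L.Disc ≃+ M.Disc, ∀ a, M.discForm (e a) = L.discForm a

/-- `E` is a complete system of representatives, without repetition, of the isometry classes of
even lattices in the genus of `L`. -/
def IsGenusSystem (L : EvenLattice) {ι : Type*} (E : ι → EvenLattice) : Prop :=
  (∀ i, SameGenus (E i) L) ∧ (∀ i j, Isometric (E i) (E j) → i = j) ∧
    ∀ M : EvenLattice, SameGenus M L → ∃ i, Isometric M (E i)

/-! ### The action of `O(L)` on the discriminant group -/

/-- The extension of an isometry to `L ⊗ ℚ`. -/
def ratMap (L : EvenLattice) (g : L.O) : (ℚ ⊗[ℤ] L) →ₗ[ℚ] (ℚ ⊗[ℤ] L) :=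
  (g.1 : L →ₗ[ℤ] L).baseChange ℚ

lemma ratMap_one (L : EvenLattice) : L.ratMap 1 = LinearMap.id :=
  LinearMap.baseChange_id

lemma ratMap_mul (L : EvenLattice) (g h : L.O) : L.ratMap (g * h) = L.ratMap g ∘ₗ L.ratMap h :=
  LinearMap.baseChange_comp (h.1 : L →ₗ[ℤ] L) (g.1 : L →ₗ[ℤ] L)

lemma ratForm_ratMap (L : EvenLattice) (g : L.O) (x y : ℚ ⊗[ℤ] L) :
    L.ratForm (L.ratMap g x) (L.ratMap g y) = L.ratForm x y := by
  have : L.ratForm.compl₁₂ (L.ratMap g) (L.ratMap g) = L.ratForm := by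
    ext x y
    simp [ratForm, ratMap, g.2 x y]
  exact LinearMap.congr_fun₂ this x y

lemma ratMap_mem_inRat (L : EvenLattice) (g : L.O) {x : ℚ ⊗[ℤ] L} (hx : x ∈ L.inRat) :
    L.ratMap g x ∈ L.inRat := by
  obtain ⟨v, rfl⟩ := hx
  exact ⟨g.1 v, by simp [ratMap]⟩

lemma ratMap_mem_dual (L : EvenLattice) (g : L.O) {x : ℚ ⊗[ℤ] L} (hx : x ∈ L.dual) :
    L.ratMap g x ∈ L.dual := by
  intro v
  obtain ⟨n, hn⟩ := hx ((g⁻¹).1 v)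
  refine ⟨n, ?_⟩
  rw [← hn, ← L.ratForm_ratMap g x]
  congr 1
  simp [ratMap]

/-- The action of an isometry on the dual lattice. -/
def dualMap (L : EvenLattice) (g : L.O) : L.dual →+ L.dual :=
  (((L.ratMap g).toAddMonoidHom).comp L.dual.subtype).codRestrict L.dual
    fun x => L.ratMap_mem_dual g x.2

/-- The map `x + L ↦ g x + L` on the discriminant group. -/
def discMap (L : EvenLattice) (g : L.O) : L.Disc →+ L.Disc :=
  QuotientAddGroup.map _ _ (L.dualMap g) fun _ hx => L.ratMap_mem_inRat g hx

lemma discMap_one (L : EvenLattice) (a : L.Disc) : L.discMap 1 a = a := by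
  obtain ⟨x, rfl⟩ := QuotientAddGroup.mk_surjective a
  refine congrArg QuotientAddGroup.mk (Subtype.ext ?_)
  exact LinearMap.congr_fun L.ratMap_one x

lemma discMap_mul (L : EvenLattice) (g h : L.O) (a : L.Disc) :
    L.discMap (g * h) a = L.discMap g (L.discMap h a) := by
  obtain ⟨x, rfl⟩ := QuotientAddGroup.mk_surjective a
  refine congrArg QuotientAddGroup.mk (Subtype.ext ?_)
  exact LinearMap.congr_fun (L.ratMap_mul g h) x

/-- The canonical homomorphism `τ : O(L) → O(A_L)`. -/
def τ (L : EvenLattice) : L.O →* L.ODisc where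
  toFun g :=
    ⟨AddEquiv.toIntLinearEquiv { L.discMap g with
        invFun := L.discMap g⁻¹
        left_inv := fun a => by
          change L.discMap g⁻¹ (L.discMap g a) = a
          rw [← discMap_mul, inv_mul_cancel, discMap_one]
        right_inv := fun a => by
          change L.discMap g (L.discMap g⁻¹ a) = a
          rw [← discMap_mul, mul_inv_cancel, discMap_one] }, by
      intro a
      obtain ⟨x, rfl⟩ := QuotientAddGroup.mk_surjective a
      exact congrArg QuotientAddGroup.mk (L.ratForm_ratMap g x x)⟩
  map_one' := Subtype.ext (LinearEquiv.ext L.discMap_one)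
  map_mul' g h := Subtype.ext (LinearEquiv.ext (L.discMap_mul g h))

/-! ### The real spinor norm and the stable orthogonal group -/

/-- The form of `L` extended to `L ⊗ ℝ`. -/
def realForm (L : EvenLattice) : LinearMap.BilinForm ℝ (ℝ ⊗[ℤ] L) := L.form.baseChange ℝ

/-- The reflection `x ↦ x - (2 (v, x) / (v, v)) v` of `L ⊗ ℝ`. -/
def reflection (L : EvenLattice) (v : ℝ ⊗[ℤ] L) : Module.End ℝ (ℝ ⊗[ℤ] L) :=
  LinearMap.id - (2 / L.realForm v v) • (L.realForm v).smulRight v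

/-- The extension of an isometry to `L ⊗ ℝ`. -/
def realMap (L : EvenLattice) (g : L.O) : Module.End ℝ (ℝ ⊗[ℤ] L) :=
  (g.1 : L →ₗ[ℤ] L).baseChange ℝ

/-- `g` has real spinor norm `1`: its extension to `L ⊗ ℝ` is a product of reflections in
anisotropic vectors `v₁, …, vₘ` with `(-v₁²/2) ⋯ (-vₘ²/2)` a square in `ℝ*`, i.e. positive. -/
def HasSpinorNormOne (L : EvenLattice) (g : L.O) : Prop :=
  ∃ l : List (ℝ ⊗[ℤ] L), (∀ v ∈ l, L.realForm v v ≠ 0) ∧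
    L.realMap g = (l.map L.reflection).prod ∧
    0 < (l.map fun v => -(L.realForm v v) / 2).prod

lemma reflection_mul_self (L : EvenLattice) {v : ℝ ⊗[ℤ] L} (hv : L.realForm v v ≠ 0) :
    L.reflection v * L.reflection v = 1 := by
  refine LinearMap.ext fun x => ?_
  simp only [reflection, Module.End.mul_apply, Module.End.one_apply, LinearMap.sub_apply,
    LinearMap.id_apply, LinearMap.smul_apply, LinearMap.smulRight_apply,
    map_sub, map_smul]
  have h : 2 / L.realForm v v * L.realForm v v = 2 := by field_simp
  match_scalars
  · ring
  · linear_combination (2 / L.realForm v v * L.realForm v x) * h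

/-- The isometries of real spinor norm `1`. -/
def OPlus (L : EvenLattice) : Subgroup L.O where
  carrier := {g | L.HasSpinorNormOne g}
  mul_mem' := by
    rintro g h ⟨l, hl, hg, hp⟩ ⟨l', hl', hh, hp'⟩
    refine ⟨l ++ l', ?_, ?_, ?_⟩
    · intro v hv
      rcases List.mem_append.1 hv with h | h
      exacts [hl v h, hl' v h]
    · rw [List.map_append, List.prod_append, ← hg, ← hh]
      exact LinearMap.baseChange_comp (h.1 : L →ₗ[ℤ] L) (g.1 : L →ₗ[ℤ] L)
    · rw [List.map_append, List.prod_append]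
      exact mul_pos hp hp'
  one_mem' := ⟨[], by simp, (LinearMap.baseChange_id : (LinearMap.id : L →ₗ[ℤ] L).baseChange ℝ = _),
    by simp⟩
  inv_mem' := by
    rintro g ⟨l, hl, hg, hp⟩
    refine ⟨l.reverse, by simpa using hl, ?_, ?_⟩
    · have h1 : ∀ l : List (ℝ ⊗[ℤ] L), (∀ v ∈ l, L.realForm v v ≠ 0) →
          (l.map L.reflection).prod * (l.reverse.map L.reflection).prod = 1 := by
        intro l
        induction l with
        | nil => simp
        | cons v l ih =>
          intro h
          simp only [List.map_cons, List.prod_cons, List.reverse_cons, List.map_append,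
            List.prod_append, List.map_nil, List.prod_nil, mul_one]
          rw [mul_assoc, ← mul_assoc (List.prod _),
            ih fun w hw => h w (List.mem_cons_of_mem _ hw), one_mul]
          exact L.reflection_mul_self (h v List.mem_cons_self)
      have h2 : L.realMap g⁻¹ * L.realMap g = 1 := by
        have := LinearMap.baseChange_comp (A := ℝ) (g.1 : L →ₗ[ℤ] L) ((g⁻¹).1 : L →ₗ[ℤ] L)
        refine this.symm.trans ?_
        have h3 : ((g⁻¹).1 : L →ₗ[ℤ] L) ∘ₗ (g.1 : L →ₗ[ℤ] L) = LinearMap.id := by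
          ext x
          change (g⁻¹ * g).1 x = x
          rw [inv_mul_cancel]; rfl
        rw [h3]; exact LinearMap.baseChange_id
      rw [hg] at h2
      exact left_inv_eq_right_inv h2 (h1 l hl)
    · rw [List.map_reverse, List.prod_reverse]
      exact hp

/-- The stable orthogonal group `Õ⁺(L)`: isometries acting trivially on `A_L`, of real spinor
norm `1`. -/
def stableOPlus (L : EvenLattice) : Subgroup L.O := L.τ.ker ⊓ L.OPlus

/-! ### Primitive isotropic sublattices of rank two -/

/-- `I₂(L)`: the primitive totally isotropic sublattices of rank two. -/
def I2 (L : EvenLattice) : Type :=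
  {S : Submodule ℤ L // Module.finrank ℤ S = 2 ∧ (∀ x ∈ S, ∀ y ∈ S, L.form x y = 0) ∧
    Module.Free ℤ (L ⧸ S)}

/-- Two elements of `I₂(L)` are equivalent if some `g ∈ Γ` maps one onto the other. -/
def I2.orbitRel (L : EvenLattice) (Γ : Subgroup L.O) : Setoid L.I2 where
  r S T := ∃ g ∈ Γ, S.1.map (g.1 : L →ₗ[ℤ] L) = T.1
  iseqv := by
    refine ⟨fun S => ⟨1, one_mem _, Submodule.map_id _⟩, ?_, ?_⟩
    · rintro S T ⟨g, hg, h⟩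
      refine ⟨g⁻¹, inv_mem hg, ?_⟩
      rw [← h, ← Submodule.map_comp]
      convert Submodule.map_id _
      ext x
      change (g⁻¹ * g).1 x = x
      rw [inv_mul_cancel]; rfl
    · rintro S T R ⟨g, hg, h⟩ ⟨k, hk, h'⟩
      refine ⟨k * g, mul_mem hk hg, ?_⟩
      rw [← h', ← h, ← Submodule.map_comp]
      rfl

/-- The orbit set `I₂(L) / Γ`. -/
abbrev I2.Orbits (L : EvenLattice) (Γ : Subgroup L.O) : Type := Quotient (I2.orbitRel L Γ)

/-- `S^⊥ / S`, with the form induced from `L`, is isometric to `E`. -/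
def I2.PerpQuotientIsometric {L : EvenLattice} (S : L.I2) (E : EvenLattice) : Prop :=
  ∃ e : (L.form.orthogonal S.1 ⧸ S.1.submoduleOf (L.form.orthogonal S.1)) ≃ₗ[ℤ] E,
    ∀ x y : L.form.orthogonal S.1,
      E.form (e (Submodule.Quotient.mk x)) (e (Submodule.Quotient.mk y)) = L.form x y

end EvenLattice

end

/-! ### Lagrangian subspaces and Witt cancellation -/

section Lagrangian

open Module

variable {K V V₁ V₂ : Type*} [Field K] [AddCommGroup V] [Module K V]
  [AddCommGroup V₁] [Module K V₁] [AddCommGroup V₂] [Module K V₂]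

/-! Write `K` for `E₈² ⊕ B_d`, so that `N = U² ⊕ K`. Since `d` is square-free, every vector of `N*`
with integral norm lies in `N` (`integrallyMaximal_addU`). Hence a primitive isotropic vector of `N`
pairs to `1` with some vector and splits off a hyperbolic plane. Doing this twice along `S ∈ I₂(N)`
gives an isometry `φ : U² ⊕ M ≅ N` carrying the standard isotropic plane to `S`, and then `M ≅
S^⊥/S` (`IntegrallyMaximal.exists_iso_addU`, `perpQuotientIsometric`). Comparing signatures and
discriminant forms puts `M` in the genus of `K`, so `M` may be replaced by some `E i`.

Fix `κ : U² ⊕ K ≅ N` and, for each `i`, an isomorphism `ψ i` of the discriminant forms of `E i` and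
`K`. Both `φ` and `κ` identify `A_N` with the discriminant group of the small summand, so `φ`
determines an element `label` of `O(A_E)`. Changing `φ` by an isometry of `E` leaves the plane alone
and multiplies the label on the right by an element of `Im τ` (`I2.map_extend`, `label_extend`). If
two labels agree, `φ' ∘ φ⁻¹` acts trivially on `A_N`; its real spinor norm can be corrected by `-1`
on a hyperbolic plane, which preserves `S` (`exists_stableOPlus_of_label_eq`). Conversely, a stable
isometry between two planes induces an isometry of the quotients `S^⊥/S`, compatible with the labels
(`index_eq`). This makes the map from orbits to pairs well defined and injective.

Surjectivity asks that every element of `O(A_E)` be a label. This is the theorem that lattices `E`,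
`K` of one genus become isometric after adding `U²`, by an isometry inducing any prescribed
isomorphism of discriminant forms (`exists_iso_addU_two`). Gluing `E` and `K(-1)` along the
isomorphism yields an even unimodular lattice `G` of signature zero, and `(K ⊕ K^∨) ⊕ E ≅ G ⊕ K`
with `K ⊕ K^∨` hyperbolic (`exists_iso_double_glue`). Both unimodular summands are sums of the same
number of hyperbolic planes (`Unimodular.exists_iso_addU`). The surplus planes are cancelled down to
two, because Eichler transvections and `SL₂(ℤ)` act transitively on hyperbolic pairs of `U³ ⊕ X`
through stable isometries (`exists_stable_hyperbolic`).

That an even unimodular lattice of signature zero is a sum of hyperbolic planes reduces to finding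
an isotropic vector. The Witt group of `ℚ` provides it: the class of a unimodular form has zero
residue at every prime, so descending through the primes puts it in `ℤ⟨1⟩`, and signature zero makes
it vanish (`mem_smoothPart_of_succ`, `mk_gramSpace_eq_zero`). -/

/-- The bilinear form has a totally isotropic subspace of at least half the dimension. -/
def HasLagrangian (B : LinearMap.BilinForm K V) : Prop :=
  ∃ W : Submodule K V, (∀ x ∈ W, ∀ y ∈ W, B x y = 0) ∧ finrank K V ≤ 2 * finrank K W

/-- The orthogonal sum of two bilinear forms. -/
def prodForm (B₁ : LinearMap.BilinForm K V₁) (B₂ : LinearMap.BilinForm K V₂) :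
    LinearMap.BilinForm K (V₁ × V₂) :=
  B₁.compl₁₂ (LinearMap.fst K V₁ V₂) (LinearMap.fst K V₁ V₂) +
    B₂.compl₁₂ (LinearMap.snd K V₁ V₂) (LinearMap.snd K V₁ V₂)

@[simp] lemma prodForm_apply (B₁ : LinearMap.BilinForm K V₁) (B₂ : LinearMap.BilinForm K V₂)
    (x y : V₁ × V₂) : prodForm B₁ B₂ x y = B₁ x.1 y.1 + B₂ x.2 y.2 := rfl

lemma HasLagrangian.of_equiv {B₁ : LinearMap.BilinForm K V₁} {B₂ : LinearMap.BilinForm K V₂}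
    (h : HasLagrangian B₁) (e : V₁ ≃ₗ[K] V₂) (c : K)
    (he : ∀ x y, B₂ (e x) (e y) = c * B₁ x y) : HasLagrangian B₂ := by
  obtain ⟨W, hW, hd⟩ := h
  refine ⟨W.map (e : V₁ →ₗ[K] V₂), ?_, ?_⟩
  · rintro _ ⟨x, hx, rfl⟩ _ ⟨y, hy, rfl⟩
    have := he x y
    rw [hW x hx y hy, mul_zero] at this
    exact this
  · rw [LinearEquiv.finrank_map_eq, ← e.finrank_eq]
    exact hd

lemma finrank_submodule_prod [FiniteDimensional K V₁] [FiniteDimensional K V₂]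
    (W : Submodule K V₁) (J : Submodule K V₂) :
    finrank K (W.prod J) = finrank K W + finrank K J := by
  rw [← finrank_prod]
  exact LinearEquiv.finrank_eq
    { toFun := fun x => (⟨x.1.1, x.2.1⟩, ⟨x.1.2, x.2.2⟩)
      invFun := fun x => ⟨(x.1.1, x.2.1), x.1.2, x.2.2⟩
      left_inv := fun _ => rfl
      right_inv := fun _ => rfl
      map_add' := fun _ _ => rfl
      map_smul' := fun _ _ => rfl }

lemma HasLagrangian.prod {B₁ : LinearMap.BilinForm K V₁} {B₂ : LinearMap.BilinForm K V₂}
    [FiniteDimensional K V₁] [FiniteDimensional K V₂]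
    (h₁ : HasLagrangian B₁) (h₂ : HasLagrangian B₂) : HasLagrangian (prodForm B₁ B₂) := by
  obtain ⟨W, hW, hd⟩ := h₁
  obtain ⟨J, hJ, hd'⟩ := h₂
  refine ⟨W.prod J, ?_, ?_⟩
  · rintro x ⟨hx, hx'⟩ y ⟨hy, hy'⟩
    rw [prodForm_apply, hW _ hx _ hy, hJ _ hx' _ hy', add_zero]
  · have := finrank_submodule_prod W J
    rw [finrank_prod]
    omega

/-- `W'` lies in the orthogonal complement of `W`, whose dimension is exactly complementary by
non-degeneracy. -/
lemma finrank_add_le_of_isotropic [FiniteDimensional K V] {B : LinearMap.BilinForm K V}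
    (hs : ∀ x y, B x y = B y x) (hn : ∀ x, (∀ y, B x y = 0) → x = 0)
    {W W' : Submodule K V} (hW : ∀ x ∈ W, ∀ y ∈ W', B x y = 0) :
    finrank K W + finrank K W' ≤ finrank K V := by
  have hB : B.Nondegenerate := ⟨hn, fun y hy => hn y fun x => by rw [hs, hy]⟩
  have h1 := LinearMap.BilinForm.finrank_orthogonal hB W
  have h2 : W' ≤ B.orthogonal W := fun y hy x hx => hW x hx y hy
  have h3 := Submodule.finrank_mono h2
  have h4 := Submodule.finrank_le W
  omega

/-- Witt cancellation of metabolic summands. -/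
lemma HasLagrangian.cancel [FiniteDimensional K V₁] [FiniteDimensional K V₂]
    {B₁ : LinearMap.BilinForm K V₁} {B₂ : LinearMap.BilinForm K V₂}
    (hs₁ : ∀ x y, B₁ x y = B₁ y x) (hn₁ : ∀ x, (∀ y, B₁ x y = 0) → x = 0)
    (hs₂ : ∀ x y, B₂ x y = B₂ y x) (hn₂ : ∀ x, (∀ y, B₂ x y = 0) → x = 0)
    (h : HasLagrangian (prodForm B₁ B₂)) (h₂ : HasLagrangian B₂) : HasLagrangian B₁ := by
  obtain ⟨W, hW, hd⟩ := h
  obtain ⟨J, hJ, hd'⟩ := h₂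
  -- Reduction of the Lagrangian `W` along `J`: the candidate is the image in `V₁` of the part of
  -- `W` lying in `V₁ × J`.
  set P : Submodule K (V₁ × V₂) := (⊤ : Submodule K V₁).prod J with hP
  set f : ↥(W ⊓ P) →ₗ[K] V₁ := (LinearMap.fst K V₁ V₂).domRestrict (W ⊓ P) with hf
  refine ⟨LinearMap.range f, ?_, ?_⟩
  · rintro _ ⟨⟨x, hx, hx'⟩, rfl⟩ _ ⟨⟨y, hy, hy'⟩, rfl⟩
    have := hW x hx y hy
    rw [prodForm_apply, hJ _ hx'.2 _ hy'.2, add_zero] at this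
    exact this
  · have e1 := f.finrank_range_add_finrank_ker
    have e2 := Submodule.finrank_sup_add_finrank_inf_eq W P
    have e3 : finrank K P = finrank K V₁ + finrank K J := by
      rw [hP, finrank_submodule_prod, finrank_top]
    have e4 : finrank K (LinearMap.ker f) = finrank K ((LinearMap.ker f).map (W ⊓ P).subtype) :=
      (LinearEquiv.finrank_eq (Submodule.equivMapOfInjective _ (Submodule.injective_subtype _) _))
    -- The vectors lost under projection have the form `(0, j)` with `j ∈ J` and lie in `W`, so they
    -- are orthogonal to both `W` and `P`; this bounds their number.
    have e5 : finrank K ↥(W ⊔ P) + finrank K ((LinearMap.ker f).map (W ⊓ P).subtype) ≤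
        finrank K (V₁ × V₂) := by
      refine finrank_add_le_of_isotropic (B := prodForm B₁ B₂)
        (fun x y => by simp [hs₁ x.1, hs₂ x.2]) ?_ ?_
      · intro x hx
        refine Prod.ext (hn₁ _ fun y => ?_) (hn₂ _ fun y => ?_)
        · simpa using hx (y, 0)
        · simpa using hx (0, y)
      · rintro x hx _ ⟨⟨y, hyW, hyP⟩, hy, rfl⟩
        have hy1 : y.1 = 0 := hy
        obtain ⟨w, hw, q, hq, rfl⟩ := Submodule.mem_sup.1 hx
        change prodForm B₁ B₂ (w + q) y = 0
        rw [map_add, LinearMap.add_apply, hW w hw y hyW, prodForm_apply, hy1, map_zero,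
          hJ _ hq.2 _ hyP.2]
        simp
    rw [finrank_prod] at hd e5
    omega

end Lagrangian

/-! ### The Witt group of a field -/

/-- A non-degenerate symmetric bilinear space of finite dimension. -/
structure QSpace (K : Type) [Field K] : Type 1 where
  V : Type
  [addCommGroup : AddCommGroup V]
  [module : Module K V]
  [finite : FiniteDimensional K V]
  B : LinearMap.BilinForm K V
  symm : ∀ x y, B x y = B y x
  nondeg : ∀ x, (∀ y, B x y = 0) → x = 0

namespace QSpace

open Module

variable {K : Type} [Field K]

attribute [instance] QSpace.addCommGroup QSpace.module QSpace.finite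

/-- The orthogonal sum. -/
def prod (X Y : QSpace K) : QSpace K where
  V := X.V × Y.V
  B := prodForm X.B Y.B
  symm x y := by simp [X.symm x.1, Y.symm x.2]
  nondeg x h := by
    refine Prod.ext (X.nondeg _ fun y => ?_) (Y.nondeg _ fun y => ?_)
    · simpa using h (y, 0)
    · simpa using h (0, y)

/-- The form multiplied by a non-zero scalar. -/
def scale (c : Kˣ) (X : QSpace K) : QSpace K where
  V := X.V
  B := (c : K) • X.B
  symm x y := by simp [X.symm x]
  nondeg x h := X.nondeg x fun y => by simpa using h y

/-- The zero space. -/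
def zero : QSpace K where
  V := PUnit
  B := 0
  symm _ _ := rfl
  nondeg _ _ := rfl

/-- Witt equivalence. -/
def Equivalent (X Y : QSpace K) : Prop := HasLagrangian (prodForm X.B (Y.scale (-1)).B)

/-- The graph of `f` is isotropic in `X ⊥ -Y` and has the dimension of `X`. -/
lemma equivalent_of_isometry {X Y : QSpace K} (f : X.V →ₗ[K] Y.V)
    (hf : ∀ x y, Y.B (f x) (f y) = X.B x y) (hd : finrank K Y.V ≤ finrank K X.V) :
    Equivalent X Y := by
  refine ⟨LinearMap.range (LinearMap.id.prod f), ?_, ?_⟩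
  · rintro _ ⟨x, rfl⟩ _ ⟨y, rfl⟩
    change X.B x y + -1 * Y.B (f x) (f y) = 0
    rw [hf]
    ring
  · rw [LinearMap.finrank_range_of_inj]
    · have : finrank K (X.V × (Y.scale (-1)).V) = finrank K X.V + finrank K Y.V := finrank_prod
      omega
    · intro x y h
      exact (Prod.ext_iff.1 h).1

lemma Equivalent.refl (X : QSpace K) : Equivalent X X :=
  equivalent_of_isometry LinearMap.id (fun _ _ => rfl) le_rfl

lemma Equivalent.symm {X Y : QSpace K} (h : Equivalent X Y) : Equivalent Y X :=
  HasLagrangian.of_equiv h (LinearEquiv.prodComm K X.V Y.V) (-1) fun x y => by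
    change Y.B x.2 y.2 + -1 * X.B x.1 y.1 = -1 * (X.B x.1 y.1 + -1 * Y.B x.2 y.2)
    ring

/-- Regroup `(X ⊥ -Y) ⊥ (Y ⊥ -Z)` as `(X ⊥ -Z) ⊥ (Y ⊥ -Y)` and cancel the metabolic second summand.
-/
lemma Equivalent.trans {X Y Z : QSpace K} (h : Equivalent X Y) (h' : Equivalent Y Z) :
    Equivalent X Z := by
  have h1 := HasLagrangian.prod h h'
  have h2 : HasLagrangian (((X.prod (Z.scale (-1))).prod (Y.prod (Y.scale (-1)))).B) := by
    refine h1.of_equiv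
      { toFun := fun v => ((v.1.1, v.2.2), (v.2.1, v.1.2))
        invFun := fun v => ((v.1.1, v.2.2), (v.2.1, v.1.2))
        left_inv := fun _ => rfl
        right_inv := fun _ => rfl
        map_add' := fun _ _ => rfl
        map_smul' := fun _ _ => rfl } 1 fun x y => ?_
    change (X.B x.1.1 y.1.1 + -1 * Z.B x.2.2 y.2.2) + (Y.B x.2.1 y.2.1 + -1 * Y.B x.1.2 y.1.2) =
      1 * ((X.B x.1.1 y.1.1 + -1 * Y.B x.1.2 y.1.2) + (Y.B x.2.1 y.2.1 + -1 * Z.B x.2.2 y.2.2))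
    ring
  exact h2.cancel (X.prod (Z.scale (-1))).symm (X.prod (Z.scale (-1))).nondeg
    (Y.prod (Y.scale (-1))).symm (Y.prod (Y.scale (-1))).nondeg (Equivalent.refl Y)

/-- Witt equivalence as a setoid. -/
def wittSetoid (K : Type) [Field K] : Setoid (QSpace K) :=
  ⟨Equivalent, Equivalent.refl, Equivalent.symm, Equivalent.trans⟩

lemma Equivalent.prod {X X' Y Y' : QSpace K} (h : Equivalent X Y) (h' : Equivalent X' Y') :
    Equivalent (X.prod X') (Y.prod Y') := by
  refine (HasLagrangian.prod h h').of_equiv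
    { toFun := fun v => ((v.1.1, v.2.1), (v.1.2, v.2.2))
      invFun := fun v => ((v.1.1, v.2.1), (v.1.2, v.2.2))
      left_inv := fun _ => rfl
      right_inv := fun _ => rfl
      map_add' := fun _ _ => rfl
      map_smul' := fun _ _ => rfl } 1 fun x y => ?_
  change (X.B x.1.1 y.1.1 + X'.B x.2.1 y.2.1) + -1 * (Y.B x.1.2 y.1.2 + Y'.B x.2.2 y.2.2) =
    1 * ((X.B x.1.1 y.1.1 + -1 * Y.B x.1.2 y.1.2) + (X'.B x.2.1 y.2.1 + -1 * Y'.B x.2.2 y.2.2))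
  ring

lemma Equivalent.scale {X Y : QSpace K} (c : Kˣ) (h : Equivalent X Y) :
    Equivalent (X.scale c) (Y.scale c) := by
  refine HasLagrangian.of_equiv h (LinearEquiv.refl K (X.V × Y.V)) c fun x y => ?_
  change c * X.B x.1 y.1 + -1 * (c * Y.B x.2 y.2) = c * (X.B x.1 y.1 + -1 * Y.B x.2 y.2)
  ring

lemma scale_prod (c : Kˣ) (X Y : QSpace K) :
    Equivalent ((X.prod Y).scale c) ((X.scale c).prod (Y.scale c)) :=
  equivalent_of_isometry (LinearMap.id : X.V × Y.V →ₗ[K] X.V × Y.V)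
    (fun x y => (mul_add (c : K) (X.B x.1 y.1) (Y.B x.2 y.2)).symm) le_rfl

end QSpace

/-- The Witt group of a field. -/
def WittGroup (K : Type) [Field K] : Type 1 := Quotient (QSpace.wittSetoid K)

namespace WittGroup

open Module QSpace

variable {K : Type} [Field K]

/-- The Witt class of a space. -/
def mk (X : QSpace K) : WittGroup K := Quotient.mk (QSpace.wittSetoid K) X

lemma mk_eq_mk {X Y : QSpace K} : mk X = mk Y ↔ Equivalent X Y :=
  ⟨fun h => Quotient.exact h, fun h => Quotient.sound (s := QSpace.wittSetoid K) h⟩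

lemma mk_eq_of_isometry {X Y : QSpace K} (f : X.V →ₗ[K] Y.V)
    (hf : ∀ x y, Y.B (f x) (f y) = X.B x y) (hd : finrank K Y.V ≤ finrank K X.V) :
    mk X = mk Y := mk_eq_mk.2 (equivalent_of_isometry f hf hd)

instance : Add (WittGroup K) :=
  ⟨Quotient.map₂ QSpace.prod fun _ _ h _ _ h' => Equivalent.prod h h'⟩

instance : Zero (WittGroup K) := ⟨mk QSpace.zero⟩

instance : Neg (WittGroup K) :=
  ⟨Quotient.map (QSpace.scale (-1)) fun _ _ h => Equivalent.scale _ h⟩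

lemma mk_prod (X Y : QSpace K) : mk (X.prod Y) = mk X + mk Y := rfl

lemma mk_neg (X : QSpace K) : mk (X.scale (-1)) = -mk X := rfl

lemma mk_zero : mk (QSpace.zero : QSpace K) = 0 := rfl

lemma mk_eq_zero {X : QSpace K} : mk X = 0 ↔ HasLagrangian X.B := by
  rw [← mk_zero, mk_eq_mk]
  constructor
  · intro h
    refine HasLagrangian.of_equiv h (LinearEquiv.prodUnique : (X.V × PUnit) ≃ₗ[K] X.V) 1 ?_
    intro x y
    change X.B x.1 y.1 = 1 * (X.B x.1 y.1 + -1 * 0)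
    ring
  · intro h
    refine HasLagrangian.of_equiv h (LinearEquiv.prodUnique : (X.V × PUnit) ≃ₗ[K] X.V).symm 1 ?_
    intro x y
    change X.B x y + -1 * 0 = 1 * X.B x y
    ring

instance : AddCommGroup (WittGroup K) where
  add_assoc := by
    rintro ⟨X⟩ ⟨Y⟩ ⟨Z⟩
    refine mk_eq_of_isometry (X := (X.prod Y).prod Z) (Y := X.prod (Y.prod Z))
      (LinearEquiv.prodAssoc K X.V Y.V Z.V).toLinearMap (fun x y => ?_)
      (LinearEquiv.prodAssoc K X.V Y.V Z.V).finrank_eq.ge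
    exact (add_assoc (X.B x.1.1 y.1.1) (Y.B x.1.2 y.1.2) (Z.B x.2 y.2)).symm
  zero_add := by
    rintro ⟨X⟩
    refine mk_eq_of_isometry (X := QSpace.zero.prod X) (Y := X) (LinearMap.snd K PUnit X.V)
      (fun x y => ?_) ?_
    · exact (zero_add (X.B x.2 y.2)).symm
    · have : finrank K (PUnit × X.V) = finrank K (PUnit : Type) + finrank K X.V := finrank_prod
      exact le_trans (Nat.le_add_left _ _) this.ge
  add_zero := by
    rintro ⟨X⟩
    refine mk_eq_of_isometry (X := X.prod QSpace.zero) (Y := X) (LinearMap.fst K X.V PUnit)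
      (fun x y => ?_) ?_
    · exact (add_zero (X.B x.1 y.1)).symm
    · have : finrank K (X.V × PUnit) = finrank K X.V + finrank K (PUnit : Type) := finrank_prod
      exact le_trans (Nat.le_add_right _ _) this.ge
  add_comm := by
    rintro ⟨X⟩ ⟨Y⟩
    refine mk_eq_of_isometry (X := X.prod Y) (Y := Y.prod X)
      (LinearEquiv.prodComm K X.V Y.V).toLinearMap (fun x y => ?_)
      (LinearEquiv.prodComm K X.V Y.V).finrank_eq.ge
    exact add_comm (Y.B x.2 y.2) (X.B x.1 y.1)
  neg_add_cancel := by
    rintro ⟨X⟩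
    refine mk_eq_zero (X := (X.scale (-1)).prod X) |>.2 ?_
    refine HasLagrangian.of_equiv (Equivalent.refl X) (LinearEquiv.prodComm K X.V X.V) 1 ?_
    intro x y
    change -1 * X.B x.2 y.2 + X.B x.1 y.1 = 1 * (X.B x.1 y.1 + -1 * X.B x.2 y.2)
    ring
  nsmul := nsmulRec
  zsmul := zsmulRec

/-- Scaling as an endomorphism of the Witt group. -/
def scaleHom (c : Kˣ) : WittGroup K →+ WittGroup K :=
  AddMonoidHom.mk' (Quotient.map (QSpace.scale c) fun _ _ h => Equivalent.scale c h) (by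
    rintro ⟨X⟩ ⟨Y⟩
    exact mk_eq_mk.2 (QSpace.scale_prod c X Y))

lemma scaleHom_mk (c : Kˣ) (X : QSpace K) : scaleHom c (mk X) = mk (X.scale c) := rfl

/-- The one-dimensional space `⟨a⟩`. -/
def _root_.QSpace.line (a : Kˣ) : QSpace K where
  V := K
  B := (a : K) • LinearMap.mul K K
  symm x y := by simp [mul_comm]
  nondeg x h := by simpa using h 1

/-- The Witt class of `⟨a⟩`. -/
def sym (a : Kˣ) : WittGroup K := mk (QSpace.line a)

lemma scaleHom_sym (c a : Kˣ) : scaleHom c (sym a) = sym (c * a) := by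
  rw [sym, scaleHom_mk]
  refine mk_eq_of_isometry (LinearMap.id : K →ₗ[K] K) (fun (x y : K) => ?_) le_rfl
  change (c : K) * a * (x * y) = c * (a * (x * y))
  ring

lemma sym_mul_sq (a b : Kˣ) : sym (a * b ^ 2) = sym a := by
  refine mk_eq_of_isometry ((b : K) • LinearMap.id : K →ₗ[K] K) (fun (x y : K) => ?_) le_rfl
  change (a : K) * (b * x * (b * y)) = a * b ^ 2 * (x * y)
  ring

lemma sym_neg (a : Kˣ) : sym (-a) = -sym a := by
  rw [sym, sym, ← mk_neg]
  refine mk_eq_of_isometry (LinearMap.id : K →ₗ[K] K) (fun (x y : K) => ?_) le_rfl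
  change -1 * ((a : K) * (x * y)) = -a * (x * y)
  ring

/-- In `⟨a⟩ ⊥ ⟨b⟩` the vector `(1, 1)` has norm `c`, and `(b, -a)` is orthogonal to it with norm
`abc`. The map takes coordinates in this basis. -/
lemma sym_add_sym (a b c : Kˣ) (h : (a : K) + b = c) : sym a + sym b = sym c + sym (a * b * c) := by
  refine mk_eq_of_isometry (X := (QSpace.line a).prod (QSpace.line b))
    (Y := (QSpace.line c).prod (QSpace.line (a * b * c)))
    (((c : K)⁻¹ • ((a : K) • LinearMap.fst K K K + (b : K) • LinearMap.snd K K K)).prod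
      ((c : K)⁻¹ • (LinearMap.fst K K K - LinearMap.snd K K K))) (fun (x y : K × K) => ?_) le_rfl
  have hc : (c : K) ≠ 0 := c.ne_zero
  change (c : K) * ((c : K)⁻¹ * (a * x.1 + b * x.2) * ((c : K)⁻¹ * (a * y.1 + b * y.2))) +
    a * b * c * ((c : K)⁻¹ * (x.1 - x.2) * ((c : K)⁻¹ * (y.1 - y.2))) =
    a * (x.1 * y.1) + b * (x.2 * y.2)
  field_simp
  rw [← h]
  ring

end WittGroup

/-! ### Diagonal forms over finite fields -/

section FiniteFieldForms

open Module Matrix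

lemma det_antidiagonal_blocks {K : Type*} [Field K] {m : ℕ} (P Q : Matrix (Fin m) (Fin m) K) :
    (fromBlocks 0 P Pᵀ Q).det = (-1) ^ m * P.det ^ 2 := by
  have h1 : fromBlocks 0 P Pᵀ Q = fromBlocks 0 1 1 0 * fromBlocks Pᵀ Q 0 P := by
    simp [fromBlocks_multiply]
  have h2 : (fromBlocks 1 1 0 1 : Matrix (Fin m ⊕ Fin m) (Fin m ⊕ Fin m) K) *
      fromBlocks 0 1 1 0 = fromBlocks 1 1 1 0 := by
    simp [fromBlocks_multiply]
  have h3 : (fromBlocks 0 1 1 0 : Matrix (Fin m ⊕ Fin m) (Fin m ⊕ Fin m) K).det = (-1) ^ m := by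
    have := congrArg Matrix.det h2
    rw [det_mul, det_fromBlocks_zero₂₁, det_fromBlocks_one₁₁] at this
    simpa [det_neg] using this
  rw [h1, det_mul, h3, det_fromBlocks_zero₂₁, det_transpose]
  ring

lemma toBilin'_diagonal_apply {R κ : Type*} [CommRing R] [Fintype κ] [DecidableEq κ] (c x y : κ → R) :
    Matrix.toBilin' (diagonal c) x y = ∑ k, c k * x k * y k := by
  rw [Matrix.toBilin'_apply', dotProduct]
  refine Finset.sum_congr rfl fun k _ => ?_
  rw [mulVec_diagonal]
  ring

/-- A metabolic diagonal form has even rank and its signed discriminant is a square. -/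
lemma exists_sq_of_hasLagrangian_diagonal {K κ : Type*} [Field K] [Fintype κ] [DecidableEq κ]
    (c : κ → K) (hc : ∀ k, c k ≠ 0) (h : HasLagrangian (Matrix.toBilin' (diagonal c))) :
    ∃ m : ℕ, Fintype.card κ = 2 * m ∧ ∃ s : K, s ≠ 0 ∧ ∏ k, c k = (-1) ^ m * s ^ 2 := by
  obtain ⟨W, hW, hd⟩ := h
  have hs : ∀ x y, Matrix.toBilin' (diagonal c) x y = Matrix.toBilin' (diagonal c) y x := by
    intro x y
    simp only [toBilin'_diagonal_apply]
    exact Finset.sum_congr rfl fun k _ => by ring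
  have hn : ∀ x, (∀ y, Matrix.toBilin' (diagonal c) x y = 0) → x = 0 := by
    intro x hx
    funext k
    have := hx (Pi.single k 1)
    rw [toBilin'_diagonal_apply, Finset.sum_eq_single k] at this
    · simpa [hc k] using this
    · intro j _ hj
      simp [hj]
    · simp
  have hle := finrank_add_le_of_isotropic hs hn hW
  rw [finrank_fintype_fun_eq_card] at hd hle
  set m := finrank K W with hm
  refine ⟨m, by omega, ?_⟩
  obtain ⟨W', hW'⟩ := W.exists_isCompl
  have hm' : finrank K W' = m := by
    have := Submodule.finrank_add_eq_of_isCompl hW'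
    rw [finrank_fintype_fun_eq_card] at this
    omega
  -- A basis adapted to `W` and a complement gives a Gram matrix with a zero block. Its determinant
  -- is `(-1)^m det(P)²` on one side and `det(T)² ∏ c k` on the other.
  let b : Basis (Fin m ⊕ Fin m) K (κ → K) :=
    ((finBasisOfFinrankEq K W rfl).prod (finBasisOfFinrankEq K W' hm')).map
      (Submodule.prodEquivOfIsCompl W W' hW')
  have hb1 : ∀ i, b (Sum.inl i) ∈ W := fun i => by simp [b]
  obtain ⟨e⟩ : Nonempty (Fin m ⊕ Fin m ≃ κ) := by
    refine ⟨Fintype.equivOfCardEq ?_⟩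
    simp
    omega
  let T : Matrix (Fin m ⊕ Fin m) (Fin m ⊕ Fin m) K := fun t s => b s (e t)
  let G : Matrix (Fin m ⊕ Fin m) (Fin m ⊕ Fin m) K :=
    fun s s' => Matrix.toBilin' (diagonal c) (b s) (b s')
  have hG : G = Tᵀ * diagonal (fun t => c (e t)) * T := by
    ext s s'
    rw [mul_apply]
    simp only [G, toBilin'_diagonal_apply, mul_diagonal]
    rw [← e.sum_comp]
    refine Finset.sum_congr rfl fun k _ => ?_
    change _ = b s (e k) * c (e k) * b s' (e k)
    ring
  have hT : T.det ≠ 0 := by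
    have h1 : LinearIndependent K T.col := by
      have : T.col = (LinearEquiv.funCongrLeft K K e) ∘ b := by
        ext s t
        rfl
      rw [this]
      exact b.linearIndependent.map' (LinearEquiv.funCongrLeft K K e).toLinearMap
        (LinearEquiv.funCongrLeft K K e).ker
    rw [Matrix.linearIndependent_cols_iff_isUnit, Matrix.isUnit_iff_isUnit_det] at h1
    exact h1.ne_zero
  let P : Matrix (Fin m) (Fin m) K := fun i j => G (Sum.inl i) (Sum.inr j)
  have hG' : G = fromBlocks 0 P Pᵀ (fun i j => G (Sum.inr i) (Sum.inr j)) := by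
    ext (i | i) (j | j)
    · exact hW _ (hb1 i) _ (hb1 j)
    · rfl
    · exact hs _ _
    · rfl
  have hprod : ∏ k, c k = ∏ t, c (e t) := (e.prod_comp c).symm
  have hdet : T.det ^ 2 * ∏ k, c k = (-1) ^ m * P.det ^ 2 := by
    rw [← det_antidiagonal_blocks P (fun i j => G (Sum.inr i) (Sum.inr j)), ← hG', hG, det_mul,
      det_mul, det_transpose, det_diagonal, hprod]
    ring
  have hP : P.det ≠ 0 := by
    intro h0
    rw [h0] at hdet
    have : ∏ k, c k ≠ 0 := Finset.prod_ne_zero_iff.2 fun k _ => hc k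
    exact mul_ne_zero (pow_ne_zero 2 hT) this (by rw [hdet]; ring)
  refine ⟨P.det / T.det, div_ne_zero hP hT, ?_⟩
  field_simp
  linear_combination hdet

/-- A function on a finite field satisfying the relations of the Witt group vanishes on metabolic
diagonal forms. -/
lemma sum_eq_zero_of_hasLagrangian {F G κ : Type*} [Field F] [Finite F] [AddCommGroup G]
    [Fintype κ] [DecidableEq κ] (φ : F → G)
    (hadd : ∀ u v, u ≠ 0 → v ≠ 0 → u + v ≠ 0 → φ u + φ v = φ (u + v) + φ (u * v * (u + v)))
    (hsq : ∀ u v, u ≠ 0 → v ≠ 0 → φ (u * v ^ 2) = φ u) (hneg : ∀ u, u ≠ 0 → φ (-u) = -φ u)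
    (c : κ → F) (hc : ∀ k, c k ≠ 0) (h : HasLagrangian (Matrix.toBilin' (diagonal c))) :
    ∑ k, φ (c k) = 0 := by
  have := Fintype.ofFinite F
  -- Over a finite field the form `ux² + vy²` represents `1`, so `⟨u⟩ + ⟨v⟩ = ⟨1⟩ + ⟨uv⟩`. In
  -- characteristic two every element is a square and this is immediate.
  have hpair : ∀ u v, u ≠ 0 → v ≠ 0 → φ u + φ v = φ 1 + φ (u * v) := by
    intro u v hu hv
    by_cases h2 : ringChar F = 2
    · obtain ⟨x, hx⟩ := FiniteField.isSquare_of_char_two h2 u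
      have hx0 : x ≠ 0 := by rintro rfl; simp at hx; exact hu hx
      have h1 : u = 1 * x ^ 2 := by rw [hx]; ring
      have h3 : u * v = v * x ^ 2 := by rw [hx]; ring
      rw [h3, hsq v x hv hx0, h1, hsq 1 x one_ne_zero hx0]
    · obtain ⟨x, y, hxy⟩ := FiniteField.exists_root_sum_quadratic
        (f := Polynomial.C u * Polynomial.X ^ 2) (g := Polynomial.C v * Polynomial.X ^ 2 - 1)
        (by simpa using Polynomial.degree_C_mul_X_pow 2 hu)
        (by
          rw [Polynomial.degree_sub_eq_left_of_degree_lt] <;>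
            rw [Polynomial.degree_C_mul_X_pow 2 hv]
          · rfl
          · simp)
        (FiniteField.odd_card_of_char_ne_two h2)
      have hxy : u * x ^ 2 + v * y ^ 2 = 1 := by
        simp at hxy
        linear_combination hxy
      by_cases hx : x = 0
      · subst hx
        have hy : y ≠ 0 := by rintro rfl; simp at hxy
        have h1 : v * y ^ 2 = 1 := by simpa using hxy
        have h3 : φ v = φ 1 := by rw [← h1, hsq v y hv hy]
        have h4 : φ (u * v) = φ u := by
          rw [← hsq (u * v) y (mul_ne_zero hu hv) hy, mul_assoc, h1, mul_one]
        rw [h3, h4, add_comm]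
      by_cases hy : y = 0
      · subst hy
        have h1 : u * x ^ 2 = 1 := by simpa using hxy
        have h3 : φ u = φ 1 := by rw [← h1, hsq u x hu hx]
        have h4 : φ (u * v) = φ v := by
          rw [← hsq (u * v) x (mul_ne_zero hu hv) hx, mul_right_comm, h1, one_mul]
        rw [h3, h4]
      · rw [← hsq u x hu hx, ← hsq v y hv hy, hadd _ _ (mul_ne_zero hu (pow_ne_zero 2 hx))
          (mul_ne_zero hv (pow_ne_zero 2 hy)) (by rw [hxy]; exact one_ne_zero), hxy,
          show u * x ^ 2 * (v * y ^ 2) * 1 = u * v * (x * y) ^ 2 by ring,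
          hsq _ _ (mul_ne_zero hu hv) (mul_ne_zero hx hy)]
  -- Iterating `hpair`: the value on a diagonal form depends only on its rank and discriminant. The
  -- extra `φ 1` makes the empty sum fit.
  have hsum : ∀ s : Finset κ, ∑ k ∈ s, φ (c k) + φ 1 = s.card • φ 1 + φ (∏ k ∈ s, c k) := by
    intro s
    induction s using Finset.induction_on with
    | empty => simp
    | insert k s hk ih =>
      rw [Finset.sum_insert hk, Finset.prod_insert hk, Finset.card_insert_of_notMem hk, add_assoc,
        ih, add_left_comm, hpair _ _ (hc k) (Finset.prod_ne_zero_iff.2 fun j _ => hc j), succ_nsmul,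
        add_assoc]
  -- `hpair` at `(-1, -1)` reads `-2 φ(1) = 2 φ(1)`.
  have h4 : φ 1 + φ 1 + φ 1 + φ 1 = 0 := by
    have := hpair (-1) (-1) (by simp) (by simp)
    rw [hneg 1 one_ne_zero, neg_mul_neg, one_mul] at this
    calc φ 1 + φ 1 + φ 1 + φ 1 = (φ 1 + φ 1) + (φ 1 + φ 1) := by abel
      _ = 0 := by nth_rewrite 1 [← this]; abel
  obtain ⟨m, hm, s, hs, hprod⟩ := exists_sq_of_hasLagrangian_diagonal c hc h
  have key := hsum Finset.univ
  rw [Finset.card_univ, hm, hprod, hsq _ _ (pow_ne_zero _ (by simp)) hs] at key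
  -- For even `m` the rank is divisible by four and the discriminant is a square. For odd `m` the
  -- surplus `2 φ(1)` is matched by `φ(-1) = -φ(1)` and the extra `φ 1` in `key`.
  rcases Nat.even_or_odd' m with ⟨t, rfl | rfl⟩
  · rw [pow_mul, neg_one_sq, one_pow] at key
    have h5 : (2 * (2 * t)) • φ 1 = t • (φ 1 + φ 1 + φ 1 + φ 1) := by
      module
    rw [h5, h4, nsmul_zero, zero_add] at key
    simpa using key
  · rw [pow_succ, pow_mul, neg_one_sq, one_pow, one_mul, hneg 1 one_ne_zero] at key
    have h5 : (2 * (2 * t + 1)) • φ 1 = t • (φ 1 + φ 1 + φ 1 + φ 1) + (φ 1 + φ 1) := by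
      module
    rw [h5, h4, nsmul_zero, zero_add, add_neg_cancel_right] at key
    simpa using key

end FiniteFieldForms

/-! ### Residues of metabolic forms -/

section Residue

open Module Matrix

lemma exists_ne_zero_smul_eq_intCast {τ : Type*} [Finite τ] (w : τ → ℚ) :
    ∃ N : ℤ, N ≠ 0 ∧ ∃ z : τ → ℤ, ∀ t, (z t : ℚ) = N * w t := by
  have := Fintype.ofFinite τ
  obtain ⟨b, hb⟩ := IsLocalization.exist_integer_multiples (nonZeroDivisors ℤ) Finset.univ w
  choose z hz using fun t => hb t (Finset.mem_univ t)
  refine ⟨b, nonZeroDivisors.coe_ne_zero b, z, fun t => ?_⟩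
  have := hz t
  simpa [Algebra.smul_def] using this

/-- A rational subspace has a reduction modulo `p` of at least the same dimension. -/
lemma exists_reduction {τ : Type*} [Fintype τ] (p : ℕ) [Fact p.Prime] (W : Submodule ℚ (τ → ℚ)) :
    ∃ M : Submodule (ZMod p) (τ → ZMod p), finrank ℚ W ≤ finrank (ZMod p) M ∧
      ∀ v ∈ M, ∃ z : τ → ℤ, (fun t => (z t : ℚ)) ∈ W ∧ ∀ t, (z t : ZMod p) = v t := by
  let castQ : (τ → ℤ) →ₗ[ℤ] (τ → ℚ) := (Int.castAddHom ℚ).toIntLinearMap.compLeft τ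
  let castF : (τ → ℤ) →ₗ[ℤ] (τ → ZMod p) := (Int.castAddHom (ZMod p)).toIntLinearMap.compLeft τ
  -- The integral points of `W` form a saturated sublattice: `p z ∈ L` forces `z ∈ L`. That is why a
  -- `ℤ`-basis of `L` stays independent modulo `p`.
  let L : Submodule ℤ (τ → ℤ) := (W.restrictScalars ℤ).comap castQ
  let b := finBasis ℤ L
  let v : Fin (finrank ℤ L) → (τ → ZMod p) := fun i => castF (b i)
  have hlift : ∀ c : Fin (finrank ℤ L) → ZMod p, ∃ d : Fin (finrank ℤ L) → ℤ,
      (∀ i, (d i : ZMod p) = c i) ∧ ∑ i, c i • v i = castF (∑ i, d i • b i : L) := by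
    intro c
    choose d hd using fun i => ZMod.intCast_surjective (c i)
    refine ⟨d, hd, ?_⟩
    rw [Submodule.coe_sum, map_sum]
    refine Finset.sum_congr rfl fun i _ => ?_
    ext t
    simp [v, castF, ← hd i]
  have hli : LinearIndependent (ZMod p) v := by
    rw [Fintype.linearIndependent_iff]
    intro c hc
    obtain ⟨d, hd, hd'⟩ := hlift c
    rw [hc] at hd'
    have h1 : ∀ t, (p : ℤ) ∣ (∑ i, d i • b i : L).1 t := by
      intro t
      rw [← ZMod.intCast_zmod_eq_zero_iff_dvd]
      exact (congrFun hd' t).symm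
    choose z hz using h1
    have hzL : z ∈ L := by
      have h2 : castQ ((∑ i, d i • b i : L) : τ → ℤ) ∈ W := (∑ i, d i • b i : L).2
      have h3 : castQ ((∑ i, d i • b i : L) : τ → ℤ) = (p : ℚ) • castQ z := by
        ext t
        simp only [castQ, LinearMap.compLeft_apply, Function.comp, Pi.smul_apply, smul_eq_mul]
        rw [hz t]
        simp
      rw [h3] at h2
      exact (Submodule.smul_mem_iff W (Nat.cast_ne_zero.2 (Fact.out : p.Prime).ne_zero)).1 h2
    have h4 : (∑ i, d i • b i : L) = (p : ℤ) • (⟨z, hzL⟩ : L) := by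
      ext t
      rw [hz t]
      rfl
    intro i
    have h5 := congrArg (fun x => b.repr x i) h4
    simp only [map_sum, map_smul, Basis.repr_self] at h5
    rw [Finsupp.finsetSum_apply, Finset.sum_eq_single i] at h5
    · rw [← hd i, ZMod.intCast_zmod_eq_zero_iff_dvd]
      refine ⟨b.repr ⟨z, hzL⟩ i, ?_⟩
      simpa using h5
    · intro j _ hj
      simp [hj]
    · simp
  refine ⟨Submodule.span (ZMod p) (Set.range v), ?_, ?_⟩
  · rw [finrank_span_eq_card hli, Fintype.card_fin]
    have hW : W ≤ Submodule.span ℚ (Set.range fun i => castQ (b i)) := by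
      intro w hw
      obtain ⟨N, hN, z, hz⟩ := exists_ne_zero_smul_eq_intCast w
      have hzw : castQ z = (N : ℚ) • w := by
        ext t
        exact hz t
      have hzL : z ∈ L := by
        change castQ z ∈ W
        rw [hzw]
        exact W.smul_mem _ hw
      rw [← Submodule.smul_mem_iff _ (Int.cast_ne_zero.2 hN : (N : ℚ) ≠ 0), ← hzw]
      have h6 : z = ∑ i, b.repr ⟨z, hzL⟩ i • (b i : τ → ℤ) := by
        have := congrArg Subtype.val (b.sum_repr ⟨z, hzL⟩)
        rw [Submodule.coe_sum] at this
        exact this.symm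
      rw [h6, map_sum]
      refine Submodule.sum_mem _ fun i _ => ?_
      rw [map_smul]
      exact Submodule.smul_of_tower_mem _ _ (Submodule.subset_span ⟨i, rfl⟩)
    refine (Submodule.finrank_mono hW).trans ?_
    exact (finrank_range_le_card _).trans_eq (Fintype.card_fin _)
  · intro x hx
    obtain ⟨c, rfl⟩ := (Submodule.mem_span_range_iff_exists_fun (ZMod p)).1 hx
    obtain ⟨d, -, hd⟩ := hlift c
    refine ⟨(∑ i, d i • b i : L).1, (∑ i, d i • b i : L).2, fun t => ?_⟩
    rw [hd]
    rfl

/-- If `A ⊥ p⟨c₁, …, c_k⟩` is metabolic over `ℚ`, with `A` unimodular at `p` and `p`-adic units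
`cᵢ`, then `⟨c₁, …, c_k⟩` is metabolic modulo `p`. -/
lemma hasLagrangian_residue {ι κ : Type*} [Fintype ι] [Fintype κ] [DecidableEq ι] [DecidableEq κ]
    (p : ℕ) [Fact p.Prime] (A : Matrix ι ι ℤ) (hA : A.IsSymm) (hdet : ¬ (p : ℤ) ∣ A.det)
    (c : κ → ℤ)
    (h : HasLagrangian (prodForm (Matrix.toBilin' (A.map (Int.cast : ℤ → ℚ)))
      (Matrix.toBilin' (diagonal fun k => ((p * c k : ℤ) : ℚ))))) :
    HasLagrangian (Matrix.toBilin' (diagonal fun k => (c k : ZMod p))) := by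
  classical
  obtain ⟨W', hW', hd'⟩ := h
  let e : (ι ⊕ κ → ℚ) ≃ₗ[ℚ] (ι → ℚ) × (κ → ℚ) := LinearEquiv.sumArrowLequivProdArrow ι κ ℚ ℚ
  obtain ⟨M, hM, hlift⟩ := exists_reduction p (W'.comap e.toLinearMap)
  have hdW : finrank ℚ (W'.comap e.toLinearMap) = finrank ℚ W' := by
    rw [← LinearEquiv.finrank_map_eq e, Submodule.map_comap_eq_of_surjective e.surjective]
  rw [hdW] at hM
  rw [finrank_prod, finrank_fintype_fun_eq_card, finrank_fintype_fun_eq_card] at hd'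
  -- Isotropy of the rational Lagrangian, written for integral vectors: the `A`-part plus `p` times
  -- the `c`-part vanishes.
  have hzero : ∀ z z' : ι ⊕ κ → ℤ, (fun t => (z t : ℚ)) ∈ W'.comap e.toLinearMap →
      (fun t => (z' t : ℚ)) ∈ W'.comap e.toLinearMap →
      (z ∘ Sum.inl) ⬝ᵥ A *ᵥ (z' ∘ Sum.inl) +
        p * ∑ k, c k * z (Sum.inr k) * z' (Sum.inr k) = 0 := by
    intro z z' hz hz'
    have h1 := hW' _ hz _ hz'
    rw [prodForm_apply, toBilin'_diagonal_apply, Matrix.toBilin'_apply'] at h1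
    have h2 : ((z ∘ Sum.inl) ⬝ᵥ A *ᵥ (z' ∘ Sum.inl) : ℤ) =
        ((e fun t => (z t : ℚ)).1 ⬝ᵥ (A.map (Int.cast : ℤ → ℚ)) *ᵥ (e fun t => (z' t : ℚ)).1) := by
      rw [← eq_intCast (Int.castRingHom ℚ), RingHom.map_dotProduct]
      congr 1
      ext i
      exact RingHom.map_mulVec (Int.castRingHom ℚ) A (z' ∘ Sum.inl) i
    have h3 : ((p * ∑ k, c k * z (Sum.inr k) * z' (Sum.inr k) : ℤ) : ℚ) =
        ∑ k, ((p * c k : ℤ) : ℚ) * (e fun t => (z t : ℚ)).2 k * (e fun t => (z' t : ℚ)).2 k := by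
      push_cast
      rw [Finset.mul_sum]
      exact Finset.sum_congr rfl fun k _ => by simp [e]; ring
    have h4 : (((z ∘ Sum.inl) ⬝ᵥ A *ᵥ (z' ∘ Sum.inl) +
        p * ∑ k, c k * z (Sum.inr k) * z' (Sum.inr k) : ℤ) : ℚ) = 0 := by
      rw [Int.cast_add, h2, h3]
      exact h1
    exact_mod_cast h4
  let f : M →ₗ[ZMod p] (ι → ZMod p) := (LinearMap.funLeft (ZMod p) (ZMod p) Sum.inl).domRestrict M
  let g : M →ₗ[ZMod p] (κ → ZMod p) := (LinearMap.funLeft (ZMod p) (ZMod p) Sum.inr).domRestrict M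
  have hrank := f.finrank_range_add_finrank_ker
  -- Modulo `p` only the `A`-part of `hzero` survives, so the projection of `M` to the
  -- `A`-coordinates is isotropic for a non-degenerate form. Hence `ker f` has at least half the
  -- dimension of the `c`-part.
  have hisoA : 2 * finrank (ZMod p) (LinearMap.range f) ≤ Fintype.card ι := by
    have hdet' : (A.map (Int.cast : ℤ → ZMod p)).det ≠ 0 := by
      have h1 : (A.map (Int.cast : ℤ → ZMod p)).det = (A.det : ZMod p) :=
        ((Int.castRingHom (ZMod p)).map_det A).symm
      rw [h1]
      rwa [Ne, ZMod.intCast_zmod_eq_zero_iff_dvd]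
    have hnd := (LinearMap.BilinForm.nondegenerate_toBilin'_iff_det_ne_zero).2 hdet'
    have hsymm : ∀ x y, Matrix.toBilin' (A.map (Int.cast : ℤ → ZMod p)) x y =
        Matrix.toBilin' (A.map (Int.cast : ℤ → ZMod p)) y x := by
      intro x y
      rw [Matrix.toBilin'_apply', Matrix.toBilin'_apply', dotProduct_mulVec, ← mulVec_transpose,
        dotProduct_comm, ← transpose_map, hA.eq]
    have := finrank_add_le_of_isotropic (W := LinearMap.range f) (W' := LinearMap.range f) hsymm
      hnd.1 ?_
    · rw [finrank_fintype_fun_eq_card] at this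
      omega
    · rintro _ ⟨x, rfl⟩ _ ⟨y, rfl⟩
      obtain ⟨z, hz, hzx⟩ := hlift _ x.2
      obtain ⟨z', hz', hzy⟩ := hlift _ y.2
      have h1 := congrArg (Int.cast : ℤ → ZMod p) (hzero z z' hz hz')
      rw [Matrix.toBilin'_apply']
      push_cast at h1
      rw [CharP.cast_eq_zero, zero_mul, add_zero] at h1
      rw [← h1, ← eq_intCast (Int.castRingHom (ZMod p)), RingHom.map_dotProduct]
      congr 1
      · ext i
        exact (hzx _).symm
      · ext i
        refine Eq.trans ?_ (RingHom.map_mulVec (Int.castRingHom (ZMod p)) A (z' ∘ Sum.inl) i).symm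
        have : (f y) = (Int.castRingHom (ZMod p)) ∘ z' ∘ Sum.inl := by
          ext j
          exact (hzy _).symm
        rw [this]
        rfl
  refine ⟨(LinearMap.ker f).map g, ?_, ?_⟩
  · rintro _ ⟨x, hx, rfl⟩ _ ⟨y, hy, rfl⟩
    obtain ⟨z, hz, hzx⟩ := hlift _ x.2
    obtain ⟨z', hz', hzy⟩ := hlift _ y.2
    -- On `ker f` the `A`-coordinates of both lifts are divisible by `p`, so the `A`-part is
    -- divisible by `p²`. Dividing `hzero` by `p` leaves the `c`-form modulo `p`.
    have hdvd : ∀ i, (p : ℤ) ∣ z (Sum.inl i) := by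
      intro i
      rw [← ZMod.intCast_zmod_eq_zero_iff_dvd, hzx]
      exact congrFun hx i
    have hdvd' : ∀ i, (p : ℤ) ∣ z' (Sum.inl i) := by
      intro i
      rw [← ZMod.intCast_zmod_eq_zero_iff_dvd, hzy]
      exact congrFun hy i
    choose t ht using hdvd
    choose t' ht' using hdvd'
    have h1 := hzero z z' hz hz'
    have e1 : z ∘ Sum.inl = (p : ℤ) • t := funext ht
    have e2 : z' ∘ Sum.inl = (p : ℤ) • t' := funext ht'
    rw [e1, e2, mulVec_smul, smul_dotProduct, dotProduct_smul, smul_eq_mul, smul_eq_mul,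
      ← mul_add] at h1
    have h2 := (mul_eq_zero.1 h1).resolve_left
      (Int.natCast_ne_zero.2 (Fact.out : p.Prime).ne_zero)
    have h3 := congrArg (Int.cast : ℤ → ZMod p) h2
    push_cast at h3
    rw [CharP.cast_eq_zero, zero_mul, zero_add] at h3
    rw [toBilin'_diagonal_apply, ← h3]
    refine Finset.sum_congr rfl fun k _ => ?_
    rw [hzx, hzy]
    rfl
  · have hinj : finrank (ZMod p) ((LinearMap.ker f).map g) = finrank (ZMod p) (LinearMap.ker f) := by
      rw [← LinearMap.range_domRestrict]
      refine LinearMap.finrank_range_of_inj ?_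
      rw [injective_iff_map_eq_zero]
      rintro ⟨x, hx⟩ hgx
      refine Subtype.ext (Subtype.ext (funext fun t => ?_))
      rcases t with i | k
      · exact congrFun hx i
      · exact congrFun hgx k
    rw [hinj, finrank_fintype_fun_eq_card]
    omega

end Residue

/-! ### The Witt group of the rational numbers -/

namespace WittGroup

open Module Matrix QSpace

/-- The Witt class of `⟨n⟩` over `ℚ`, for an integer `n`; it is `0` for `n = 0`. -/
noncomputable def isym (n : ℤ) : WittGroup ℚ :=
  if h : n = 0 then 0 else sym (Units.mk0 (n : ℚ) (Int.cast_ne_zero.2 h))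

lemma isym_of_ne_zero {n : ℤ} (h : n ≠ 0) :
    isym n = sym (Units.mk0 (n : ℚ) (Int.cast_ne_zero.2 h)) := dif_neg h

lemma isym_mul_sq (a : ℤ) {b : ℤ} (hb : b ≠ 0) : isym (a * b ^ 2) = isym a := by
  by_cases ha : a = 0
  · simp [ha]
  rw [isym_of_ne_zero ha, isym_of_ne_zero (mul_ne_zero ha (pow_ne_zero 2 hb))]
  refine Eq.trans (congrArg sym ?_) (sym_mul_sq _ (Units.mk0 (b : ℚ) (Int.cast_ne_zero.2 hb)))
  ext
  simp

lemma isym_neg (a : ℤ) : isym (-a) = -isym a := by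
  by_cases ha : a = 0
  · simp [ha, isym]
  rw [isym_of_ne_zero ha, isym_of_ne_zero (neg_ne_zero.2 ha), ← sym_neg]
  congr 1
  ext
  simp

lemma isym_add {a b : ℤ} (ha : a ≠ 0) (hb : b ≠ 0) (hab : a + b ≠ 0) :
    isym a + isym b = isym (a + b) + isym (a * b * (a + b)) := by
  rw [isym_of_ne_zero ha, isym_of_ne_zero hb, isym_of_ne_zero hab,
    isym_of_ne_zero (mul_ne_zero (mul_ne_zero ha hb) hab),
    sym_add_sym _ _ (Units.mk0 ((a + b : ℤ) : ℚ) (Int.cast_ne_zero.2 hab)) (by simp)]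
  congr 2
  ext
  simp

lemma scaleHom_isym {c : ℤ} (hc : c ≠ 0) (a : ℤ) :
    scaleHom (Units.mk0 (c : ℚ) (Int.cast_ne_zero.2 hc)) (isym a) = isym (c * a) := by
  by_cases ha : a = 0
  · simp [ha, isym]
  rw [isym_of_ne_zero ha, isym_of_ne_zero (mul_ne_zero hc ha), scaleHom_sym]
  congr 1
  ext
  simp

/-! ### Diagonal and Gram spaces with integral entries -/

/-- The diagonal space with integral entries. -/
def diagSpace {α : Type} [Fintype α] [DecidableEq α] (w : α → ℤ) (hw : ∀ i, w i ≠ 0) :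
    QSpace ℚ where
  V := α → ℚ
  B := Matrix.toBilin' (diagonal fun i => (w i : ℚ))
  symm x y := by
    simp only [toBilin'_diagonal_apply]
    exact Finset.sum_congr rfl fun k _ => by ring
  nondeg x hx := by
    funext k
    have := hx (Pi.single k 1)
    rw [toBilin'_diagonal_apply, Finset.sum_eq_single k] at this
    · simpa [hw k] using this
    · intro j _ hj
      simp [hj]
    · simp

lemma diagSpace_apply {α : Type} [Fintype α] [DecidableEq α] (w : α → ℤ) (hw : ∀ i, w i ≠ 0)
    (x y : α → ℚ) : (diagSpace w hw).B x y = ∑ i, w i * x i * y i :=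
  toBilin'_diagonal_apply _ _ _

lemma mk_eq_mk_diagSpace {α : Type} [Fintype α] [DecidableEq α] (w : α → ℤ) (hw : ∀ i, w i ≠ 0)
    (X : QSpace ℚ) (v : α → X.V) (hv : ∀ i j, i ≠ j → X.B (v i) (v j) = 0)
    (hv' : ∀ i, X.B (v i) (v i) = w i) (hd : finrank ℚ X.V ≤ Fintype.card α) :
    mk X = mk (diagSpace w hw) := by
  refine (mk_eq_of_isometry (X := diagSpace w hw) (Fintype.linearCombination ℚ v)
    (fun (x y : α → ℚ) => ?_) ?_).symm
  · rw [diagSpace_apply]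
    change X.B (∑ i, x i • v i) (∑ i, y i • v i) = _
    simp only [map_sum, LinearMap.sum_apply, map_smul, LinearMap.smul_apply, smul_eq_mul]
    refine Finset.sum_congr rfl fun i _ => ?_
    rw [Finset.sum_eq_single i]
    · rw [hv']; ring
    · intro j _ hj
      rw [hv j i hj, mul_zero]
    · simp
  · exact hd.trans_eq (finrank_fintype_fun_eq_card ℚ).symm

lemma mk_diagSpace_fin : ∀ {n : ℕ} (w : Fin n → ℤ) (hw : ∀ i, w i ≠ 0),
    mk (diagSpace w hw) = ∑ i, isym (w i)
  | 0, w, hw => by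
    rw [Finset.univ_eq_empty, Finset.sum_empty, mk_eq_zero]
    exact ⟨⊤, fun x _ y _ => diagSpace_apply w hw x y, by
      rw [finrank_top]; omega⟩
  | n + 1, w, hw => by
    rw [Fin.sum_univ_succ, ← mk_diagSpace_fin (fun i => w i.succ) fun i => hw i.succ,
      isym_of_ne_zero (hw 0), sym, ← mk_prod]
    refine mk_eq_of_isometry (X := diagSpace w hw)
      ((LinearMap.proj 0 : (Fin (n + 1) → ℚ) →ₗ[ℚ] ℚ).prod (LinearMap.funLeft ℚ ℚ Fin.succ))
      (fun (x y : Fin (n + 1) → ℚ) => ?_) ?_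
    · rw [diagSpace_apply, Fin.sum_univ_succ]
      change (w 0 : ℚ) * (x 0 * y 0) + _ = _
      congr 1
      · ring
      · exact diagSpace_apply (fun i : Fin n => w i.succ) (fun i => hw i.succ) _ _
    · change finrank ℚ (ℚ × (Fin n → ℚ)) ≤ finrank ℚ (Fin (n + 1) → ℚ)
      simp [add_comm]

lemma mk_diagSpace {α : Type} [Fintype α] [DecidableEq α] (w : α → ℤ) (hw : ∀ i, w i ≠ 0) :
    mk (diagSpace w hw) = ∑ i, isym (w i) := by
  rw [← (Fintype.equivFin α).symm.sum_comp, ← mk_diagSpace_fin _ fun i => hw _]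
  refine mk_eq_of_isometry (X := diagSpace w hw)
    (LinearMap.funLeft ℚ ℚ (Fintype.equivFin α).symm) (fun (x y : α → ℚ) => ?_) ?_
  · rw [diagSpace_apply, ← (Fintype.equivFin α).symm.sum_comp]
    exact diagSpace_apply (fun i => w ((Fintype.equivFin α).symm i)) (fun i => hw _) _ _
  · exact (LinearEquiv.finrank_eq
      (LinearEquiv.funCongrLeft ℚ ℚ (Fintype.equivFin α).symm)).ge

/-- The rational space with an integral symmetric Gram matrix. -/
def gramSpace {α : Type} [Fintype α] [DecidableEq α] (A : Matrix α α ℤ) (hA : A.IsSymm)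
    (hdet : A.det ≠ 0) : QSpace ℚ where
  V := α → ℚ
  B := Matrix.toBilin' (A.map (Int.cast : ℤ → ℚ))
  symm x y := by
    rw [Matrix.toBilin'_apply', Matrix.toBilin'_apply', dotProduct_mulVec, ← mulVec_transpose,
      dotProduct_comm, ← transpose_map, hA.eq]
  nondeg := by
    have h1 : (A.map (Int.cast : ℤ → ℚ)).det = (A.det : ℚ) :=
      ((Int.castRingHom ℚ).map_det A).symm
    refine ((LinearMap.BilinForm.nondegenerate_toBilin'_iff_det_ne_zero).2 ?_).1
    rw [h1]
    exact Int.cast_ne_zero.2 hdet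

/-! ### Filtration of the Witt group by primes, and residues -/

/-- Non-zero integers all of whose prime factors are `< p`. -/
def Smooth (p : ℕ) (n : ℤ) : Prop := n ≠ 0 ∧ ∀ q : ℕ, q.Prime → (q : ℤ) ∣ n → q < p

lemma Smooth.mul {p : ℕ} {m n : ℤ} (hm : Smooth p m) (hn : Smooth p n) : Smooth p (m * n) :=
  ⟨mul_ne_zero hm.1 hn.1, fun _ hq h =>
    ((Int.Prime.dvd_mul' hq h).elim (hm.2 _ hq) (hn.2 _ hq))⟩

lemma Smooth.neg {p : ℕ} {n : ℤ} (hn : Smooth p n) : Smooth p (-n) :=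
  ⟨neg_ne_zero.2 hn.1, fun q hq h => hn.2 q hq ((dvd_neg).1 h)⟩

lemma smooth_of_natAbs_lt {p : ℕ} {n : ℤ} (h0 : n ≠ 0) (h : n.natAbs < p) : Smooth p n :=
  ⟨h0, fun _ _ hd => lt_of_le_of_lt
    (Nat.le_of_dvd (Int.natAbs_pos.2 h0) (Int.natCast_dvd.1 hd)) h⟩

lemma Smooth.not_dvd {p : ℕ} (hp : p.Prime) {n : ℤ} (hn : Smooth p n) : ¬ (p : ℤ) ∣ n :=
  fun h => lt_irrefl _ (hn.2 p hp h)

/-- The subgroup generated by the classes `⟨n⟩` with `n` having only prime factors `< p`. -/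
def smoothPart (p : ℕ) : AddSubgroup (WittGroup ℚ) :=
  AddSubgroup.closure (isym '' {n | Smooth p n})

lemma isym_mem_smoothPart {p : ℕ} {n : ℤ} (h : Smooth p n) : isym n ∈ smoothPart p :=
  AddSubgroup.subset_closure ⟨n, h, rfl⟩

lemma scaleHom_mem_smoothPart {p : ℕ} {n : ℤ} (h : Smooth p n) {X : WittGroup ℚ}
    (hX : X ∈ smoothPart p) :
    scaleHom (Units.mk0 (n : ℚ) (Int.cast_ne_zero.2 h.1)) X ∈ smoothPart p := by
  have : smoothPart p ≤
      (smoothPart p).comap (scaleHom (Units.mk0 (n : ℚ) (Int.cast_ne_zero.2 h.1))) := by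
    rw [smoothPart, AddSubgroup.closure_le]
    rintro _ ⟨m, hm, rfl⟩
    change scaleHom _ (isym m) ∈ smoothPart p
    rw [scaleHom_isym h.1]
    exact isym_mem_smoothPart (h.mul hm)
  exact this hX

/-- Apply the Witt relation to `pa + p²s = pb`. After removing squares the other two terms are `⟨s⟩`
and `⟨asb⟩`, which involve only primes below `p`. -/
lemma isym_mul_of_add {p : ℕ} (hp : p.Prime) {a b s : ℤ} (ha : Smooth p a) (hb : Smooth p b)
    (hs : s = 0 ∨ Smooth p s) (h : b = a + p * s) :
    isym (p * b) - isym (p * a) ∈ smoothPart p := by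
  rcases hs with rfl | hs
  · simp [h, zero_mem]
  have hp0 : (p : ℤ) ≠ 0 := Int.natCast_ne_zero.2 hp.ne_zero
  have h1 := isym_add (a := p * a) (b := p * (p * s)) (mul_ne_zero hp0 ha.1)
    (mul_ne_zero hp0 (mul_ne_zero hp0 hs.1))
    (by rw [← mul_add, ← h]; exact mul_ne_zero hp0 hb.1)
  rw [← mul_add, ← h, show (p : ℤ) * (p * s) = s * p ^ 2 by ring, isym_mul_sq _ hp0,
    show (p : ℤ) * a * (s * p ^ 2) * (p * b) = a * s * b * (p ^ 2) ^ 2 by ring,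
    isym_mul_sq _ (pow_ne_zero 2 hp0)] at h1
  have h2 : isym (p * b) - isym (p * a) = isym s - isym (a * s * b) := by
    rw [sub_eq_sub_iff_add_eq_add, ← h1]
    abel
  rw [h2]
  exact sub_mem (isym_mem_smoothPart hs) (isym_mem_smoothPart ((ha.mul hs).mul hb))

/-- Dividing `n` by `p` directly would give a quotient with uncontrolled prime factors. Multiplying
in one prime factor `q` at a time keeps `q, r < p`, so the quotient of `qr` by `p` is below `p` and
`isym_mul_of_add` applies. -/
lemma exists_residue_nat {p : ℕ} (hp : p.Prime) (n : ℕ) : Smooth p n →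
    ∃ r : ℕ, 0 < r ∧ r < p ∧ (n : ZMod p) = r ∧ isym (p * n) - isym (p * r) ∈ smoothPart p := by
  induction n using induction_on_primes with
  | zero => exact fun h => absurd rfl h.1
  | one => exact fun _ => ⟨1, one_pos, hp.one_lt, rfl, by simp [zero_mem]⟩
  | prime_mul q n hq ih =>
    intro h
    have hqp : q < p := h.2 q hq ⟨n, by push_cast; ring⟩
    have hn : Smooth p n := ⟨fun h0 => h.1 (by rw [Nat.cast_mul, h0, mul_zero]),
      fun l hl hd => h.2 l hl (by rw [Nat.cast_mul]; exact hd.mul_left _)⟩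
    have hqs : Smooth p q := smooth_of_natAbs_lt (Int.natCast_ne_zero.2 hq.ne_zero) (by simpa)
    obtain ⟨r, hr0, hrp, hnr, hmem⟩ := ih hn
    have hrs : Smooth p r := smooth_of_natAbs_lt (Int.natCast_ne_zero.2 hr0.ne') (by simpa)
    have hmod : (q * r) % p ≠ 0 := fun h0 =>
      (hqs.mul hrs).not_dvd hp (by exact_mod_cast Nat.dvd_of_mod_eq_zero h0)
    have hlt : (q * r) % p < p := Nat.mod_lt _ hp.pos
    refine ⟨(q * r) % p, Nat.pos_of_ne_zero hmod, hlt, ?_, ?_⟩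
    · rw [ZMod.natCast_mod]
      push_cast
      rw [hnr]
    · have h1 := scaleHom_mem_smoothPart hqs hmem
      rw [map_sub, scaleHom_isym hqs.1, scaleHom_isym hqs.1] at h1
      have hdiv : q * r / p < p := by
        rw [Nat.div_lt_iff_lt_mul hp.pos]
        exact Nat.mul_lt_mul'' hqp hrp
      have h2 := isym_mul_of_add hp (a := ((q * r) % p : ℕ)) (b := (q * r : ℕ))
        (s := (q * r / p : ℕ))
        (smooth_of_natAbs_lt (Int.natCast_ne_zero.2 hmod) (by rw [Int.natAbs_natCast]; exact hlt))
        (by push_cast; exact hqs.mul hrs)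
        (by
          by_cases h0 : q * r / p = 0
          · left; rw [h0]; rfl
          · right; exact smooth_of_natAbs_lt (Int.natCast_ne_zero.2 h0) (by rw [Int.natAbs_natCast]; exact hdiv))
        (by exact_mod_cast (Nat.mod_add_div (q * r) p).symm)
      have h3 := add_mem h1 h2
      convert h3 using 1
      rw [show (p : ℤ) * ((q * n : ℕ) : ℤ) = q * (p * n) by push_cast; ring,
        show (p : ℤ) * ((q * r : ℕ) : ℤ) = q * (p * r) by push_cast; ring]
      abel

lemma exists_residue {p : ℕ} (hp : p.Prime) {n : ℤ} (h : Smooth p n) :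
    ∃ r : ℕ, 0 < r ∧ r < p ∧ (n : ZMod p) = r ∧ isym (p * n) - isym (p * r) ∈ smoothPart p := by
  obtain ⟨m, rfl | rfl⟩ := n.eq_nat_or_neg
  · simpa using exists_residue_nat hp m h
  · obtain ⟨r, hr0, hrp, hnr, hmem⟩ := exists_residue_nat hp m (by simpa using h.neg)
    have hr' : ((p - r : ℕ) : ℤ) = p - r := by push_cast [hrp.le]; ring
    refine ⟨p - r, by omega, by omega, ?_, ?_⟩
    · rw [Nat.cast_sub hrp.le]
      push_cast
      rw [hnr]
      simp
    -- For a negative integer the residue is `p - r`, reached from `-r` with quotient `1`.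
    · have h2 := isym_mul_of_add hp (a := -(r : ℤ)) (b := ((p - r : ℕ) : ℤ)) (s := 1)
        (smooth_of_natAbs_lt (by omega) (by simpa using hrp))
        (smooth_of_natAbs_lt (by omega) (by omega))
        (Or.inr (smooth_of_natAbs_lt one_ne_zero (by simpa using hp.one_lt)))
        (by rw [hr']; ring)
      have h3 := neg_mem (add_mem hmem h2)
      convert h3 using 1
      rw [mul_neg, mul_neg, isym_neg, isym_neg]
      abel

/-- Modulo the smooth part, `⟨p n⟩` depends only on the residue of `n`. -/
lemma isym_sub_isym_val_mem {p : ℕ} (hp : p.Prime) {n : ℤ} (h : Smooth p n) :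
    isym (p * n) - isym (p * (n : ZMod p).val) ∈ smoothPart p := by
  obtain ⟨r, hr0, hrp, hnr, hmem⟩ := exists_residue hp h
  rwa [hnr, ZMod.val_natCast_of_lt hrp]

/-- A sum of classes `⟨p c⟩` whose residue form is metabolic is congruent to a smooth class. -/
lemma sum_mem_smoothPart {p : ℕ} [hF : Fact p.Prime] {κ : Type} [Fintype κ] [DecidableEq κ] (c : κ → ℤ)
    (hc : ∀ k, Smooth p (c k))
    (h : HasLagrangian (Matrix.toBilin' (diagonal fun k => (c k : ZMod p)))) :
    ∑ k, isym (p * c k) ∈ smoothPart p := by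
  have hp : p.Prime := hF.out
  have hp0 : (p : ℤ) ≠ 0 := Int.natCast_ne_zero.2 hp.ne_zero
  let π := QuotientAddGroup.mk' (smoothPart p)
  have hπ : ∀ n, Smooth p n → π (isym (p * n)) = π (isym (p * (n : ZMod p).val)) := by
    intro n hn
    rw [← sub_eq_zero, ← map_sub]
    exact (QuotientAddGroup.eq_zero_iff _).2 (isym_sub_isym_val_mem hp hn)
  have hval : ∀ u : ZMod p, u ≠ 0 → Smooth p u.val := fun u hu =>
    smooth_of_natAbs_lt (Int.natCast_ne_zero.2 ((ZMod.val_ne_zero u).2 hu))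
      (by rw [Int.natAbs_natCast]; exact u.val_lt)
  -- Modulo the smooth part, `u ↦ ⟨pu⟩` is a function on `𝔽_p`; the goals check the Witt relations
  -- for it.
  have key := sum_eq_zero_of_hasLagrangian (fun u : ZMod p => π (isym (p * u.val))) ?_ ?_ ?_
    (fun k => (c k : ZMod p)) ?_ h
  · rw [← QuotientAddGroup.eq_zero_iff]
    change π _ = 0
    rw [map_sum, ← key]
    exact Finset.sum_congr rfl fun k _ => hπ _ (hc k)
  · intro u v hu hv huv
    -- The additive relation needs representatives whose sum is again smooth: the representative of
    -- `v` is shifted down by `p` when the sum would reach `p`. It is never zero because `u + v ≠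
    -- 0`.
    have hex : ∃ b : ℤ, Smooth p b ∧ (b : ZMod p) = v ∧ Smooth p (u.val + b) := by
      have h1 := u.val_lt
      have h2 := v.val_lt
      have h3 := (ZMod.val_ne_zero u).2 hu
      have h4 := (ZMod.val_ne_zero v).2 hv
      have h5 : u.val + v.val ≠ p := by
        intro h0
        apply huv
        rw [← ZMod.natCast_zmod_val u, ← ZMod.natCast_zmod_val v, ← Nat.cast_add, h0]
        simp
      by_cases hlt : u.val + v.val < p
      · exact ⟨v.val, hval v hv, by simp, smooth_of_natAbs_lt (by omega) (by omega)⟩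
      · exact ⟨v.val - p, smooth_of_natAbs_lt (by omega) (by omega), by simp,
          smooth_of_natAbs_lt (by omega) (by omega)⟩
    obtain ⟨b, hb, hbv, hab⟩ := hex
    have ha := hval u hu
    have h1 := isym_add (a := p * u.val) (b := p * b) (mul_ne_zero hp0 ha.1)
      (mul_ne_zero hp0 hb.1) (by rw [← mul_add]; exact mul_ne_zero hp0 hab.1)
    rw [← mul_add, show (p : ℤ) * u.val * (p * b) * (p * (u.val + b)) =
      p * (u.val * b * (u.val + b)) * p ^ 2 by ring, isym_mul_sq _ hp0] at h1
    have h2 := congrArg π h1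
    rw [map_add, map_add, hπ _ hb, hπ _ hab, hπ _ ((ha.mul hb).mul hab)] at h2
    push_cast at h2
    rwa [hbv, ZMod.natCast_zmod_val] at h2
  · intro u v hu hv
    have ha := hval u hu
    have hb := hval v hv
    have h1 := hπ _ ((ha.mul hb).mul hb)
    rw [show (p : ℤ) * (u.val * v.val * v.val) = p * u.val * v.val ^ 2 by ring,
      isym_mul_sq _ hb.1] at h1
    push_cast at h1
    rw [ZMod.natCast_zmod_val, ZMod.natCast_zmod_val, mul_assoc, ← sq] at h1
    exact h1.symm
  · intro u hu
    have h1 := hπ _ (hval u hu).neg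
    rw [mul_neg, isym_neg, map_neg] at h1
    push_cast at h1
    rw [ZMod.natCast_zmod_val] at h1
    exact h1.symm
  · intro k h0
    exact (hc k).not_dvd hp ((ZMod.intCast_zmod_eq_zero_iff_dvd _ _).1 h0)

/-- Write a generator as `⟨p^e n'⟩` with `p ∤ n'`. Even powers of `p` are squares, so only the
parity of `e` matters; signs are absorbed by `-⟨n⟩ = ⟨-n⟩`. -/
lemma exists_lists_of_mem_smoothPart_succ {p : ℕ} (hp : p.Prime) {X : WittGroup ℚ}
    (hX : X ∈ smoothPart (p + 1)) : ∃ l l' : List ℤ, (∀ n ∈ l, Smooth p n) ∧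
      (∀ n ∈ l', Smooth p n) ∧ X = (l.map isym).sum + (l'.map fun n => isym (p * n)).sum := by
  have hp0 : (p : ℤ) ≠ 0 := Int.natCast_ne_zero.2 hp.ne_zero
  have hneg : ∀ l : List ℤ, ∀ m : ℤ, ((l.map (-·)).map fun n => isym (m * n)).sum =
      -(l.map fun n => isym (m * n)).sum := by
    intro l m
    induction l with
    | nil => simp
    | cons a l ih =>
      simp only [List.map_cons, List.sum_cons, ih, mul_neg, isym_neg, neg_add]
  induction hX using AddSubgroup.closure_induction with
  | mem x hx =>
    obtain ⟨n, hn, rfl⟩ := hx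
    obtain ⟨n', hnn, hn'⟩ := (Int.finiteMultiplicity_iff.2
      ⟨by simpa using hp.ne_one, hn.1⟩ : FiniteMultiplicity (p : ℤ) n).exists_eq_pow_mul_and_not_dvd
    generalize multiplicity (p : ℤ) n = e at hnn
    subst hnn
    have hs : Smooth p n' := by
      refine ⟨fun h => hn.1 (by rw [h, mul_zero]), fun q hq hd => ?_⟩
      have h1 := hn.2 q hq (hd.mul_left _)
      have h2 : q ≠ p := by rintro rfl; exact hn' hd
      omega
    rcases Nat.even_or_odd' e with ⟨t, rfl | rfl⟩
    · refine ⟨[n'], [], by simpa using hs, by simp, ?_⟩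
      rw [show (p : ℤ) ^ (2 * t) * n' = n' * (p ^ t) ^ 2 by ring, isym_mul_sq _ (pow_ne_zero _ hp0)]
      simp
    · refine ⟨[], [n'], by simp, by simpa using hs, ?_⟩
      rw [show (p : ℤ) ^ (2 * t + 1) * n' = p * n' * (p ^ t) ^ 2 by ring,
        isym_mul_sq _ (pow_ne_zero _ hp0)]
      simp
  | zero => exact ⟨[], [], by simp, by simp, by simp⟩
  | add x y _ _ hx hy =>
    obtain ⟨l, l', h1, h2, rfl⟩ := hx
    obtain ⟨m, m', h3, h4, rfl⟩ := hy
    refine ⟨l ++ m, l' ++ m', ?_, ?_, ?_⟩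
    · intro n hn
      exact (List.mem_append.1 hn).elim (h1 n) (h3 n)
    · intro n hn
      exact (List.mem_append.1 hn).elim (h2 n) (h4 n)
    · simp only [List.map_append, List.sum_append]
      abel
  | neg x _ hx =>
    obtain ⟨l, l', h1, h2, rfl⟩ := hx
    refine ⟨l.map (-·), l'.map (-·), ?_, ?_, ?_⟩
    · intro n hn
      obtain ⟨m, hm, rfl⟩ := List.mem_map.1 hn
      exact (h1 m hm).neg
    · intro n hn
      obtain ⟨m, hm, rfl⟩ := List.mem_map.1 hn
      exact (h2 m hm).neg
    · have := hneg l 1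
      simp only [one_mul] at this
      rw [this, hneg, neg_add]

lemma list_sum_eq (l : List ℤ) (m : ℤ) :
    (l.map fun n => isym (m * n)).sum = ∑ i : Fin l.length, isym (m * l.get i) := by
  conv_lhs => rw [← List.ofFn_get l, List.map_ofFn, List.sum_ofFn]
  rfl

lemma toBilin'_fromBlocks_diagonal {α β : Type} [Fintype α] [DecidableEq α] [Fintype β]
    [DecidableEq β] (A : Matrix α α ℤ) (w : β → ℤ) (x y : (α → ℚ) × (β → ℚ)) :
    Matrix.toBilin' ((fromBlocks A 0 0 (diagonal w)).map (Int.cast : ℤ → ℚ))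
      ((LinearEquiv.sumArrowLequivProdArrow α β ℚ ℚ).symm x)
      ((LinearEquiv.sumArrowLequivProdArrow α β ℚ ℚ).symm y) =
    Matrix.toBilin' (A.map (Int.cast : ℤ → ℚ)) x.1 y.1 +
      Matrix.toBilin' (diagonal fun i => (w i : ℚ)) x.2 y.2 := by
  have h1 : ∀ (z : (α → ℚ) × (β → ℚ)) i,
      (LinearEquiv.sumArrowLequivProdArrow α β ℚ ℚ).symm z (Sum.inl i) = z.1 i := fun _ _ => rfl
  have h2 : ∀ (z : (α → ℚ) × (β → ℚ)) i,
      (LinearEquiv.sumArrowLequivProdArrow α β ℚ ℚ).symm z (Sum.inr i) = z.2 i := fun _ _ => rfl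
  rw [Matrix.toBilin'_apply', Matrix.toBilin'_apply', Matrix.toBilin'_apply', fromBlocks_map,
    fromBlocks_mulVec, dotProduct, Fintype.sum_sum_type]
  congr 1
  · refine Finset.sum_congr rfl fun i _ => ?_
    simp [Function.comp_def, h1]
  · refine Finset.sum_congr rfl fun i _ => ?_
    simp [Function.comp_def, diagonal_map, mulVec_diagonal, h2]

/-- The class of a space with a Gram matrix that is invertible at `p` has no residue at `p`. -/
lemma mem_smoothPart_of_succ {α : Type} [Fintype α] [DecidableEq α] (A : Matrix α α ℤ)
    (hA : A.IsSymm) (hdet : IsUnit A.det) {p : ℕ}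
    (h : mk (gramSpace A hA hdet.ne_zero) ∈ smoothPart (p + 1)) :
    mk (gramSpace A hA hdet.ne_zero) ∈ smoothPart p := by
  by_cases hp : p.Prime
  swap
  -- For composite `p`, or `p = 0, 1`, passing to `p + 1` admits no new prime.
  · have heq : smoothPart (p + 1) = smoothPart p := by
      refine congrArg (fun s => AddSubgroup.closure (isym '' s)) (Set.ext fun n => ?_)
      refine and_congr_right fun _ => forall_congr' fun q => forall_congr' fun hq =>
        forall_congr' fun _ => ?_
      have : q ≠ p := by rintro rfl; exact hp hq
      omega
    rwa [heq] at h
  have := Fact.mk hp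
  have hp0 : (p : ℤ) ≠ 0 := Int.natCast_ne_zero.2 hp.ne_zero
  obtain ⟨l, l', hl, hl', hX⟩ := exists_lists_of_mem_smoothPart_succ hp h
  have hl1 : (l.map isym).sum = ∑ i : Fin l.length, isym (l.get i) := by
    simpa only [one_mul] using list_sum_eq l 1
  rw [hl1, list_sum_eq] at hX
  have hs : ∀ i, Smooth p (l.get i) := fun i => hl _ (List.get_mem l i)
  have hs' : ∀ i, Smooth p (l'.get i) := fun i => hl' _ (List.get_mem l' i)
  let D := diagSpace (fun i => -l.get i) fun i => (hs i).neg.1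
  let D' := diagSpace (fun i => p * -l'.get i) fun i => mul_ne_zero hp0 (hs' i).neg.1
  have hD : mk D = -∑ i, isym (l.get i) := by
    rw [mk_diagSpace, ← Finset.sum_neg_distrib]
    exact Finset.sum_congr rfl fun i _ => isym_neg _
  have hD' : mk D' = -∑ i, isym (p * l'.get i) := by
    rw [mk_diagSpace, ← Finset.sum_neg_distrib]
    exact Finset.sum_congr rfl fun i _ => by rw [mul_neg, isym_neg]
  -- Moving the diagonal terms across gives a metabolic space `A ⊥ D ⊥ D'`. Here `A ⊥ D` has
  -- determinant prime to `p`, and `D'` is `p` times a form with entries prime to `p`, so the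
  -- residue of `D'` is metabolic.
  have hzero : mk (((gramSpace A hA hdet.ne_zero).prod D).prod D') = 0 := by
    rw [mk_prod, mk_prod, hD, hD', hX]
    abel
  rw [mk_eq_zero] at hzero
  let e : (((α → ℚ) × (Fin l.length → ℚ)) × (Fin l'.length → ℚ)) ≃ₗ[ℚ]
      ((α ⊕ Fin l.length → ℚ) × (Fin l'.length → ℚ)) :=
    (LinearEquiv.sumArrowLequivProdArrow α (Fin l.length) ℚ ℚ).symm.prodCongr
      (LinearEquiv.refl ℚ (Fin l'.length → ℚ))
  have hres := hasLagrangian_residue p (fromBlocks A 0 0 (diagonal fun i => -l.get i))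
    (hA.fromBlocks (by simp) (isSymm_diagonal _)) ?_ (fun i => -l'.get i)
    (hzero.of_equiv e 1 ?_)
  · have := sum_mem_smoothPart (p := p) (fun i => -l'.get i) (fun i => (hs' i).neg) hres
    rw [hX]
    refine add_mem (sum_mem fun i _ => isym_mem_smoothPart (hs i)) ?_
    rw [← neg_mem_iff, ← Finset.sum_neg_distrib]
    simpa only [mul_neg, isym_neg] using this
  · rw [det_fromBlocks_zero₂₁, det_diagonal]
    intro hd
    rcases Int.Prime.dvd_mul' hp hd with hd | hd
    · exact hp.ne_one (by simpa using Int.isUnit_iff_natAbs_eq.1 (isUnit_of_dvd_unit hd hdet))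
    · obtain ⟨i, -, hi⟩ := (Nat.prime_iff_prime_int.1 hp).exists_mem_finset_dvd hd
      exact (hs i).neg.not_dvd hp hi
  · intro x y
    rw [one_mul]
    exact congrArg (· + Matrix.toBilin' (diagonal fun i => ((p * -l'.get i : ℤ) : ℚ)) x.2 y.2)
      (toBilin'_fromBlocks_diagonal A (fun i => -l.get i) x.1 y.1)

/-! ### Signature and vanishing of the unimodular class -/

/-- A Lagrangian meets the positive and the negative coordinate subspaces trivially, so each has at
most half the dimension; together they fill it. -/
lemma card_pos_eq_card_neg {α : Type} [Fintype α] [DecidableEq α] (w : α → ℤ)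
    (hw : ∀ i, w i ≠ 0) (h : HasLagrangian (diagSpace w hw).B) :
    {i | 0 < w i}.ncard = {i | w i < 0}.ncard := by
  obtain ⟨W, hW, hd⟩ : ∃ W : Submodule ℚ (α → ℚ), (∀ x ∈ W, ∀ y ∈ W,
    (diagSpace w hw).B x y = 0) ∧ finrank ℚ (α → ℚ) ≤ 2 * finrank ℚ W := h
  have key : ∀ (c : ℚ) (s : Set α), (∀ i ∈ s, 0 < c * w i) →
      finrank ℚ W + s.ncard ≤ finrank ℚ (α → ℚ) := by
    intro c s hs
    rw [← Pi.dim_spanSubset (R := ℚ)]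
    have hinf : W ⊓ Pi.spanSubset ℚ s = ⊥ := by
      rw [eq_bot_iff]
      rintro x ⟨hx, hx'⟩
      have h1 := (diagSpace_apply w hw x x).symm.trans (hW x hx x hx)
      have hx' := Pi.mem_spanSubset_iff.1 hx'
      have h2 : ∑ i, c * w i * (x i * x i) = 0 := by
        rw [← mul_zero c, ← h1, Finset.mul_sum]
        exact Finset.sum_congr rfl fun i _ => by ring
      rw [Finset.sum_eq_zero_iff_of_nonneg] at h2
      · funext i
        by_cases hi : i ∈ s
        · simpa [(hs i hi).ne'] using h2 i (Finset.mem_univ i)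
        · exact hx' i hi
      · intro i _
        by_cases hi : i ∈ s
        · exact mul_nonneg (hs i hi).le (mul_self_nonneg _)
        · rw [hx' i hi]; simp
    have := Submodule.finrank_sup_add_finrank_inf_eq W (Pi.spanSubset ℚ s)
    rw [hinf, finrank_bot, add_zero] at this
    rw [← this]
    exact Submodule.finrank_le _
  have h1 := key 1 {i | 0 < w i} fun i hi => by rw [one_mul]; exact Int.cast_pos.2 hi
  have h2 := key (-1) {i | w i < 0} fun i hi => by
    rw [neg_one_mul, neg_pos]; exact Int.cast_lt_zero.2 hi
  have h3 : {i | 0 < w i}.ncard + {i | w i < 0}.ncard = finrank ℚ (α → ℚ) := by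
    rw [finrank_fintype_fun_eq_card, ← Nat.card_eq_fintype_card,
      ← Set.ncard_add_ncard_compl {i | 0 < w i}]
    congr 2
    ext i
    have := hw i
    simp only [Set.mem_ofPred_eq, Set.mem_compl_iff]
    omega
  omega

/-- A unimodular form of signature zero is metabolic over `ℚ`. -/
theorem mk_gramSpace_eq_zero {α β : Type} [Fintype α] [DecidableEq α] [Fintype β]
    [DecidableEq β] (A : Matrix α α ℤ) (hA : A.IsSymm) (hdet : IsUnit A.det) (a : β → ℤ)
    (ha : ∀ i, a i ≠ 0) (hsum : mk (gramSpace A hA hdet.ne_zero) = ∑ i, isym (a i))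
    (hsign : {i | 0 < a i}.ncard = {i | a i < 0}.ncard) :
    mk (gramSpace A hA hdet.ne_zero) = 0 := by
  set X := mk (gramSpace A hA hdet.ne_zero) with hX
  -- The bound exceeds every `|a i|`, so all entries are smooth at the start of the descent.
  have hstart : X ∈ smoothPart (2 + ∑ i, ((a i).natAbs + 1)) := by
    rw [hsum]
    refine sum_mem fun i _ => isym_mem_smoothPart (smooth_of_natAbs_lt (ha i) ?_)
    have : (a i).natAbs + 1 ≤ ∑ i, ((a i).natAbs + 1) := Finset.single_le_sum
      (f := fun i => (a i).natAbs + 1) (fun _ _ => Nat.zero_le _) (Finset.mem_univ i)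
    omega
  have hdesc : ∀ k, X ∈ smoothPart (2 + k) → X ∈ smoothPart 2 := by
    intro k
    induction k with
    | zero => exact id
    | succ k ih => exact fun h => ih (mem_smoothPart_of_succ A hA hdet h)
  have h2 := hdesc _ hstart
  -- There is no prime below `2`, so the remaining generators are `⟨1⟩` and `⟨-1⟩`.
  have hle : smoothPart 2 ≤ AddSubgroup.zmultiples (isym 1) := by
    rw [smoothPart, AddSubgroup.closure_le]
    rintro _ ⟨n, hn, rfl⟩
    have hn1 : n.natAbs = 1 := by
      by_contra h
      obtain ⟨q, hq, hd⟩ := Nat.exists_prime_and_dvd h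
      have := hn.2 q hq (Int.natCast_dvd.2 hd)
      have := hq.two_le
      omega
    rcases Int.natAbs_eq n with h | h <;> rw [hn1] at h <;> rw [h]
    · exact AddSubgroup.mem_zmultiples _
    · rw [Nat.cast_one, isym_neg]
      exact neg_mem (AddSubgroup.mem_zmultiples _)
  obtain ⟨k, hk⟩ := AddSubgroup.mem_zmultiples_iff.1 (hle h2)
  -- If `m` copies of `⟨s⟩` cancel a class of signature zero, counting positive and negative entries
  -- forces `m = 0`.
  have hzero : ∀ (m : ℕ) (s : ℤ), s ≠ 0 → X + m • isym s = 0 → m = 0 := by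
    intro m s hs h
    have hne : ∀ i : β ⊕ Fin m, Sum.elim a (fun _ => s) i ≠ 0 := by
      rintro (i | i)
      · exact ha i
      · exact hs
    have h1 : mk (diagSpace _ hne) = 0 := by
      rw [mk_diagSpace, Fintype.sum_sum_type]
      simpa [← hsum] using h
    have h3 := card_pos_eq_card_neg _ hne (mk_eq_zero.1 h1)
    have hsplit : ∀ P : ℤ → Prop, {i | P (Sum.elim a (fun _ : Fin m => s) i)}.ncard =
        {i | P (a i)}.ncard + {_i : Fin m | P s}.ncard := by
      intro P
      have : {i | P (Sum.elim a (fun _ : Fin m => s) i)} =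
          Sum.inl '' {i | P (a i)} ∪ Sum.inr '' {_i : Fin m | P s} := by
        ext (i | i) <;> simp
      rw [this, Set.ncard_union_eq, Set.ncard_image_of_injective _ Sum.inl_injective,
        Set.ncard_image_of_injective _ Sum.inr_injective]
      rw [Set.disjoint_left]
      rintro _ ⟨i, -, rfl⟩ ⟨j, -, hj⟩
      cases hj
    rw [hsplit (0 < ·), hsplit (· < 0), hsign] at h3
    rcases lt_or_gt_of_ne hs with h4 | h4
    · simpa [h4, h4.le, not_lt.2 h4.le, Set.ncard_univ] using h3
    · simpa [h4, h4.le, not_lt.2 h4.le, Set.ncard_univ] using h3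
  obtain ⟨m, rfl | rfl⟩ := k.eq_nat_or_neg
  · have := hzero m (-1) (by simp) (by rw [← hk, isym_neg]; simp)
    rw [← hk, this]
    simp
  · have := hzero m 1 (by simp) (by rw [← hk]; simp)
    rw [← hk, this]
    simp

end WittGroup

noncomputable section

/-! ### Rational representatives of functionals and the discriminant group -/

namespace EvenLattice

open Module WittGroup

/-- Integral functionals on a lattice. -/
abbrev Dual (L : EvenLattice) : Type := L →ₗ[ℤ] ℤ

/-- The functional is of the form `(z, ·)`. -/
def Repr (L : EvenLattice) (f : L.Dual) : Prop := ∃ z : L, ∀ v, f v = L.form z v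

lemma ratForm_tmul (L : EvenLattice) (a b : ℚ) (x y : L) :
    L.ratForm (a ⊗ₜ x) (b ⊗ₜ y) = a * b * L.form x y := by
  simp [ratForm]
  ring

lemma exists_smul_eq_tmul (L : EvenLattice) (x : ℚ ⊗[ℤ] L) :
    ∃ n : ℤ, n ≠ 0 ∧ ∃ v : L, (n : ℚ) • x = 1 ⊗ₜ v := by
  induction x with
  | zero => exact ⟨1, one_ne_zero, 0, by simp⟩
  | tmul a v =>
    refine ⟨a.den, by exact_mod_cast a.den_ne_zero, a.num • v, ?_⟩
    have h : ((a.den : ℤ) : ℚ) • a = a.num • (1 : ℚ) := by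
      rw [smul_eq_mul, zsmul_eq_mul, mul_one, Int.cast_natCast, mul_comm]
      exact Rat.mul_den_eq_num a
    rw [TensorProduct.tmul_smul, TensorProduct.smul_tmul', TensorProduct.smul_tmul', h]
  | add x y hx hy =>
    obtain ⟨n, hn, v, hv⟩ := hx
    obtain ⟨m, hm, w, hw⟩ := hy
    refine ⟨n * m, mul_ne_zero hn hm, m • v + n • w, ?_⟩
    rw [TensorProduct.tmul_add, TensorProduct.tmul_smul, TensorProduct.tmul_smul, ← hv, ← hw,
      ← Int.cast_smul_eq_zsmul ℚ, ← Int.cast_smul_eq_zsmul ℚ, smul_smul, smul_smul, smul_add,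
      Int.cast_mul, mul_comm (m : ℚ) n]

lemma ratForm_nondeg' (L : EvenLattice) {x : ℚ ⊗[ℤ] L} (h : ∀ v, L.ratForm x (1 ⊗ₜ v) = 0) :
    x = 0 := by
  obtain ⟨n, hn, v, hv⟩ := L.exists_smul_eq_tmul x
  have hv0 : v = 0 := by
    refine L.nondeg v fun y => ?_
    have h1 := L.ratForm_tmul 1 1 v y
    rw [← hv, map_smul, LinearMap.smul_apply, h y] at h1
    simpa using h1.symm
  rw [hv0, TensorProduct.tmul_zero] at hv
  exact (smul_eq_zero.1 hv).resolve_left (Int.cast_ne_zero.2 hn)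

lemma ratForm_nondeg (L : EvenLattice) (x : ℚ ⊗[ℤ] L) (h : ∀ y, L.ratForm x y = 0) : x = 0 :=
  L.ratForm_nondeg' fun _ => h _

/-- The rational quadratic space `L ⊗ ℚ`. -/
def ratSpace (L : EvenLattice) : QSpace ℚ where
  V := ℚ ⊗[ℤ] L
  B := L.ratForm
  symm := L.ratForm_symm
  nondeg := L.ratForm_nondeg

lemma finrank_rat (L : EvenLattice) : finrank ℚ (ℚ ⊗[ℤ] L) = finrank ℤ L :=
  finrank_baseChange

lemma ratForm_nondegenerate (L : EvenLattice) : L.ratForm.Nondegenerate :=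
  ⟨L.ratForm_nondeg, fun y hy => L.ratForm_nondeg y fun x => by rw [L.ratForm_symm, hy]⟩

lemma exists_rep (L : EvenLattice) (f : L.Dual) :
    ∃ x : ℚ ⊗[ℤ] L, ∀ v, L.ratForm x (1 ⊗ₜ v) = f v := by
  refine ⟨(LinearMap.BilinForm.toDual L.ratForm L.ratForm_nondegenerate).symm
    (LinearMap.liftBaseChange ℚ ((Int.castAddHom ℚ).toIntLinearMap ∘ₗ f)), fun v => ?_⟩
  rw [LinearMap.BilinForm.apply_toDual_symm_apply]
  simp

lemma rep_unique (L : EvenLattice) {x y : ℚ ⊗[ℤ] L}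
    (h : ∀ v, L.ratForm x (1 ⊗ₜ v) = L.ratForm y (1 ⊗ₜ v)) : x = y :=
  sub_eq_zero.1 (L.ratForm_nondeg' fun v => by rw [map_sub, LinearMap.sub_apply, h, sub_self])

/-- The rational vector representing an integral functional. -/
def rep (L : EvenLattice) : L.Dual →+ ℚ ⊗[ℤ] L :=
  AddMonoidHom.mk' (fun f => (L.exists_rep f).choose) fun f g => L.rep_unique fun v => by
    rw [map_add, LinearMap.add_apply, (L.exists_rep _).choose_spec, (L.exists_rep _).choose_spec,
      (L.exists_rep _).choose_spec]
    simp

lemma ratForm_rep (L : EvenLattice) (f : L.Dual) (v : L) : L.ratForm (L.rep f) (1 ⊗ₜ v) = f v :=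
  (L.exists_rep f).choose_spec v

lemma rep_form (L : EvenLattice) (x : L) : L.rep (L.form x) = 1 ⊗ₜ x :=
  L.rep_unique fun v => by rw [ratForm_rep, ratForm_tmul]; simp

lemma rep_injective (L : EvenLattice) : Function.Injective L.rep := by
  intro f g h
  ext v
  have := L.ratForm_rep f v
  rw [h, ratForm_rep] at this
  exact_mod_cast this.symm

lemma rep_mem_dual (L : EvenLattice) (f : L.Dual) : L.rep f ∈ L.dual :=
  fun v => ⟨f v, L.ratForm_rep f v⟩

lemma exists_rep_eq (L : EvenLattice) {x : ℚ ⊗[ℤ] L} (hx : x ∈ L.dual) : ∃ f, L.rep f = x := by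
  choose f hf using hx
  refine ⟨(AddMonoidHom.mk' f fun v w => ?_).toIntLinearMap, L.rep_unique fun v => ?_⟩
  · have h : ((f (v + w) : ℤ) : ℚ) = (f v + f w : ℤ) := by
      rw [← hf, TensorProduct.tmul_add, map_add, hf, hf]
      simp
    exact_mod_cast h
  · rw [ratForm_rep, hf]
    rfl

/-- A rational vector pairing integrally with all of `L*` lies in `L`. -/
lemma exists_eq_tmul_of_forall_rep (L : EvenLattice) {x : ℚ ⊗[ℤ] L}
    (h : ∀ f, ∃ n : ℤ, L.ratForm x (L.rep f) = n) : ∃ v : L, x = 1 ⊗ₜ v := by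
  let b := finBasis ℤ L
  choose n hn using fun i => h (b.coord i)
  refine ⟨∑ i, n i • b i, ?_⟩
  -- The vectors `L.rep (b.coord i)` form the basis dual to `b`, so pairings with them are the
  -- coordinates of `x`.
  have hx : x = ∑ i, (L.ratForm x (L.rep (b.coord i))) • ((1 : ℚ) ⊗ₜ[ℤ] b i) := by
    have key : ∀ y : ℚ ⊗[ℤ] L, y = ∑ i, (L.ratForm y (L.rep (b.coord i))) • ((1 : ℚ) ⊗ₜ[ℤ] b i) := by
      intro y
      induction y with
      | zero => simp
      | add y z hy hz =>
        conv_lhs => rw [hy, hz]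
        rw [← Finset.sum_add_distrib]
        exact Finset.sum_congr rfl fun i _ => by rw [map_add, LinearMap.add_apply, add_smul]
      | tmul a v =>
        have h1 : ∀ i, L.ratForm (a ⊗ₜ v) (L.rep (b.coord i)) = a * b.repr v i := by
          intro i
          rw [show a ⊗ₜ[ℤ] v = a • ((1 : ℚ) ⊗ₜ[ℤ] v) by rw [TensorProduct.smul_tmul', smul_eq_mul,
            mul_one], map_smul, LinearMap.smul_apply, ratForm_symm, ratForm_rep]
          rfl
        simp only [h1]
        conv_lhs => rw [← b.sum_repr v, TensorProduct.tmul_sum]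
        refine Finset.sum_congr rfl fun i _ => ?_
        rw [TensorProduct.tmul_smul, ← Int.cast_smul_eq_zsmul ℚ, TensorProduct.smul_tmul',
          TensorProduct.smul_tmul', smul_eq_mul, smul_eq_mul, mul_one, mul_comm]
    exact key x
  rw [hx, TensorProduct.tmul_sum]
  refine Finset.sum_congr rfl fun i _ => ?_
  rw [hn, TensorProduct.tmul_smul, Int.cast_smul_eq_zsmul]

/-- The class of a functional in the discriminant group. -/
def cl (L : EvenLattice) : L.Dual →+ L.Disc :=
  (QuotientAddGroup.mk' _).comp (L.rep.codRestrict L.dual L.rep_mem_dual)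

lemma cl_apply (L : EvenLattice) (f : L.Dual) :
    L.cl f = QuotientAddGroup.mk (⟨L.rep f, L.rep_mem_dual f⟩ : L.dual) := rfl

lemma cl_surjective (L : EvenLattice) : Function.Surjective L.cl := by
  intro a
  obtain ⟨⟨x, hx⟩, rfl⟩ := QuotientAddGroup.mk_surjective a
  obtain ⟨f, rfl⟩ := L.exists_rep_eq hx
  exact ⟨f, rfl⟩

/-- The dictionary `A_L = Hom(L, ℤ) / L`: questions about the discriminant group become questions of
representability of integral functionals, with no rational vectors involved. -/
lemma cl_eq_zero (L : EvenLattice) {f : L.Dual} : L.cl f = 0 ↔ L.Repr f := by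
  rw [cl_apply, QuotientAddGroup.eq_zero_iff]
  constructor
  · rintro ⟨v, hv⟩
    refine ⟨v, fun w => ?_⟩
    have := L.rep_injective (hv.symm.trans (L.rep_form v).symm)
    rw [this]
  · rintro ⟨v, hv⟩
    refine ⟨v, ?_⟩
    have : f = L.form v := LinearMap.ext hv
    rw [this]
    exact (L.rep_form v).symm

lemma cl_eq_cl (L : EvenLattice) {f g : L.Dual} : L.cl f = L.cl g ↔ L.Repr (f - g) := by
  rw [← cl_eq_zero, map_sub, sub_eq_zero]

lemma discForm_cl (L : EvenLattice) (f : L.Dual) :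
    L.discForm (L.cl f) = QuotientAddGroup.mk (L.ratForm (L.rep f) (L.rep f)) := rfl

/-! ### Orthogonal bases and signatures -/

/-- Rational diagonalisation with denominators cleared. The family spans only a sublattice of finite
index, which is enough for the signature and the rational Witt class. -/
lemma exists_orthogonal (L : EvenLattice) : ∃ u : Fin (finrank ℤ L) → L,
    (∀ i j, i ≠ j → L.form (u i) (u j) = 0) ∧ ∀ i, L.form (u i) (u i) ≠ 0 := by
  obtain ⟨v, hv⟩ := LinearMap.BilinForm.exists_orthogonal_basis (B := L.ratForm)
    ⟨fun x y => L.ratForm_symm x y⟩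
  choose n hn u hu using fun i => L.exists_smul_eq_tmul (v i)
  have hform : ∀ i j, (L.form (u i) (u j) : ℚ) = n i * n j * L.ratForm (v i) (v j) := by
    intro i j
    have := L.ratForm_tmul 1 1 (u i) (u j)
    rw [← hu, ← hu, map_smul, map_smul, LinearMap.smul_apply] at this
    simp only [smul_eq_mul, one_mul] at this
    rw [← this]
    ring
  have horth : ∀ i j, i ≠ j → L.ratForm (v i) (v j) = 0 := fun i j hij => hv hij
  let e : Fin (finrank ℤ L) ≃ Fin (finrank ℚ (ℚ ⊗[ℤ] L)) := finCongr L.finrank_rat.symm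
  refine ⟨u ∘ e, fun i j hij => ?_, fun i h0 => ?_⟩
  · have := hform (e i) (e j)
    rw [horth _ _ (e.injective.ne hij), mul_zero] at this
    exact_mod_cast this
  · have := hform (e i) (e i)
    simp only [Function.comp] at h0
    rw [h0, Int.cast_zero] at this
    have h1 : L.ratForm (v (e i)) (v (e i)) = 0 := by
      have hne : (n (e i) : ℚ) ≠ 0 := Int.cast_ne_zero.2 (hn _)
      simpa [hne] using this.symm
    refine v.ne_zero (e i) (L.ratForm_nondeg _ fun y => ?_)
    rw [← v.sum_repr y, map_sum]
    refine Finset.sum_eq_zero fun j _ => ?_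
    rw [map_smul]
    by_cases hj : e i = j
    · rw [← hj, h1, smul_zero]
    · rw [horth _ _ hj, smul_zero]

lemma mk_ratSpace (L : EvenLattice) {α : Type} [Fintype α] [DecidableEq α] (u : α → L)
    (hu : ∀ i j, i ≠ j → L.form (u i) (u j) = 0) (hu' : ∀ i, L.form (u i) (u i) ≠ 0)
    (hd : finrank ℤ L = Fintype.card α) :
    WittGroup.mk L.ratSpace = ∑ i, isym (L.form (u i) (u i)) := by
  rw [← mk_diagSpace _ hu']
  refine mk_eq_mk_diagSpace _ _ L.ratSpace (fun i => (1 : ℚ) ⊗ₜ[ℤ] u i) (fun i j hij => ?_) (fun i => ?_)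
    (L.finrank_rat.trans hd).le
  · refine (L.ratForm_tmul _ _ _ _).trans ?_
    rw [hu i j hij]
    simp
  · refine (L.ratForm_tmul _ _ _ _).trans ?_
    simp

lemma realForm_tmul (L : EvenLattice) (a b : ℝ) (x y : L) :
    L.realForm (a ⊗ₜ x) (b ⊗ₜ y) = a * b * L.form x y := by
  simp [realForm]
  ring

/-- The real basis given by an orthogonal family of lattice vectors. -/
lemma exists_real_basis (L : EvenLattice) {α : Type} [Fintype α] (u : α → L)
    (hu : ∀ i j, i ≠ j → L.form (u i) (u j) = 0) (hu' : ∀ i, L.form (u i) (u i) ≠ 0)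
    (hd : finrank ℤ L = Fintype.card α) :
    ∃ b : Basis α ℝ (ℝ ⊗[ℤ] L), ∀ i, b i = 1 ⊗ₜ u i := by
  have hli : LinearIndependent ℝ fun i => (1 : ℝ) ⊗ₜ[ℤ] u i := by
    rw [Fintype.linearIndependent_iff]
    intro c hc i
    have h1 := congrArg (fun x => L.realForm x (1 ⊗ₜ u i)) hc
    simp only [map_sum, LinearMap.sum_apply, map_smul, LinearMap.smul_apply, map_zero,
      LinearMap.zero_apply, realForm_tmul] at h1
    rw [Finset.sum_eq_single i] at h1
    · simpa [hu' i] using h1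
    · intro j _ hj
      simp [hu j i hj]
    · simp
  refine ⟨basisOfLinearIndependentOfCardEqFinrank' _ hli ?_, fun i => by
    rw [coe_basisOfLinearIndependentOfCardEqFinrank']⟩
  rw [finrank_baseChange, hd]

lemma equivalent_weightedSumSquares (L : EvenLattice) {α : Type} [Fintype α] (u : α → L)
    (hu : ∀ i j, i ≠ j → L.form (u i) (u j) = 0) (hu' : ∀ i, L.form (u i) (u i) ≠ 0)
    (hd : finrank ℤ L = Fintype.card α) :
    QuadraticMap.Equivalent (LinearMap.BilinMap.toQuadraticMap (L.form.baseChange ℝ))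
      (QuadraticMap.weightedSumSquares ℝ fun i => (L.form (u i) (u i) : ℝ)) := by
  obtain ⟨b, hb⟩ := L.exists_real_basis u hu hu' hd
  refine QuadraticMap.Equivalent.symm ⟨{ b.equivFun.symm with map_app' := fun x => ?_ }⟩
  change L.realForm (b.equivFun.symm x) (b.equivFun.symm x) = _
  rw [b.equivFun_symm_apply, QuadraticMap.weightedSumSquares_apply]
  simp only [map_sum, LinearMap.sum_apply, map_smul, LinearMap.smul_apply, hb, realForm_tmul]
  refine Finset.sum_congr rfl fun i _ => ?_
  rw [Finset.sum_eq_single i]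
  · simp
    ring
  · intro j _ hj
    simp [hu j i hj]
  · simp

lemma sigPos_eq_ncard (L : EvenLattice) {α : Type} [Fintype α] (u : α → L)
    (hu : ∀ i j, i ≠ j → L.form (u i) (u j) = 0) (hu' : ∀ i, L.form (u i) (u i) ≠ 0)
    (hd : finrank ℤ L = Fintype.card α) :
    L.sigPos = {i | 0 < L.form (u i) (u i)}.ncard := by
  refine (QuadraticForm.sigPos_of_equiv_weightedSumSquares
    (L.equivalent_weightedSumSquares u hu hu' hd)).trans ?_
  simp

lemma sigNeg_eq_ncard (L : EvenLattice) {α : Type} [Fintype α] (u : α → L)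
    (hu : ∀ i j, i ≠ j → L.form (u i) (u j) = 0) (hu' : ∀ i, L.form (u i) (u i) ≠ 0)
    (hd : finrank ℤ L = Fintype.card α) :
    L.sigNeg = {i | L.form (u i) (u i) < 0}.ncard := by
  refine (QuadraticForm.sigNeg_of_equiv_weightedSumSquares
    (L.equivalent_weightedSumSquares u hu hu' hd)).trans ?_
  simp

lemma sigPos_add_sigNeg (L : EvenLattice) : L.sigPos + L.sigNeg = finrank ℤ L := by
  obtain ⟨u, hu, hu'⟩ := L.exists_orthogonal
  rw [L.sigPos_eq_ncard u hu hu' (by simp), L.sigNeg_eq_ncard u hu hu' (by simp)]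
  have h := Set.ncard_add_ncard_compl {i | 0 < L.form (u i) (u i)}
  rw [Nat.card_eq_fintype_card, Fintype.card_fin] at h
  refine Eq.trans ?_ h
  congr 2
  ext i
  have := hu' i
  simp only [Set.mem_ofPred_eq, Set.mem_compl_iff]
  omega

end EvenLattice

end

noncomputable section

/-! ### Isometries and splitting of hyperbolic planes -/

namespace EvenLattice

open Module WittGroup

/-- An isometry between lattices. -/
structure Iso (L M : EvenLattice) where
  e : L ≃ₗ[ℤ] M
  map : ∀ x y, M.form (e x) (e y) = L.form x y

namespace Iso

variable {L M P : EvenLattice}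

/-- The identity isometry. -/
def refl (L : EvenLattice) : Iso L L := ⟨LinearEquiv.refl ℤ L, fun _ _ => rfl⟩

/-- The inverse isometry. -/
def symm (φ : Iso L M) : Iso M L :=
  ⟨φ.e.symm, fun x y => by rw [← φ.map, φ.e.apply_symm_apply, φ.e.apply_symm_apply]⟩

/-- Composition of isometries. -/
def trans (φ : Iso L M) (χ : Iso M P) : Iso L P :=
  ⟨φ.e.trans χ.e, fun x y => by
    rw [LinearEquiv.trans_apply, LinearEquiv.trans_apply, χ.map, φ.map]⟩

@[simp] lemma trans_e (φ : Iso L M) (χ : Iso M P) (x : L) : (φ.trans χ).e x = χ.e (φ.e x) := rfl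

@[simp] lemma symm_e_e (φ : Iso L M) (x : L) : φ.symm.e (φ.e x) = x := φ.e.symm_apply_apply x

@[simp] lemma e_symm_e (φ : Iso L M) (x : M) : φ.e (φ.symm.e x) = x := φ.e.apply_symm_apply x

lemma map_symm (φ : Iso L M) (x : L) (y : M) : L.form x (φ.symm.e y) = M.form (φ.e x) y := by
  rw [← φ.map, φ.e_symm_e]

end Iso

lemma form_eq_of_norm {L M : EvenLattice} (e : L →ₗ[ℤ] M)
    (h : ∀ x, M.form (e x) (e x) = L.form x x) (x y : L) : M.form (e x) (e y) = L.form x y := by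
  have h1 := h (x + y)
  simp only [map_add, LinearMap.add_apply, h, M.symm (e y) (e x), L.symm y x] at h1
  linarith

/-- A surjective linear map preserving the form is an isometry. -/
def Iso.ofSurjective {L M : EvenLattice} (e : L →ₗ[ℤ] M)
    (h : ∀ x y, M.form (e x) (e y) = L.form x y) (hs : Function.Surjective e) : Iso L M :=
  ⟨LinearEquiv.ofBijective e ⟨by
    rw [injective_iff_map_eq_zero]
    intro x hx
    exact L.nondeg x fun y => by rw [← h, hx, map_zero, LinearMap.zero_apply], hs⟩, h⟩

/-- The inclusion of the second summand. -/
def inr (L M : EvenLattice) : M →ₗ[ℤ] L.sum M := LinearMap.inr ℤ L M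

/-- The projection onto the second summand. -/
def snd (L M : EvenLattice) : L.sum M →ₗ[ℤ] M := LinearMap.snd ℤ L M

/-- The inclusion of the first summand. -/
def inl (L M : EvenLattice) : L →ₗ[ℤ] L.sum M := LinearMap.inl ℤ L M

/-- The projection onto the first summand. -/
def fst (L M : EvenLattice) : L.sum M →ₗ[ℤ] L := LinearMap.fst ℤ L M

lemma inl_fst_add_inr_snd (L M : EvenLattice) (x : L.sum M) :
    inl L M (fst L M x) + inr L M (snd L M x) = x :=
  Prod.ext (add_zero (fst L M x)) (zero_add (snd L M x))

/-- The orthogonal sum of isometries. -/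
def Iso.sumCongr {L L' M M' : EvenLattice} (φ : Iso L L') (χ : Iso M M') :
    Iso (L.sum M) (L'.sum M') :=
  ⟨LinearEquiv.prodCongr φ.e χ.e, fun x y => by
    change L'.form (φ.e _) (φ.e _) + M'.form (χ.e _) (χ.e _) = _
    rw [φ.map, χ.map]
    rfl⟩

/-- Associativity of orthogonal sums. -/
def sumAssoc (L M P : EvenLattice) : Iso ((L.sum M).sum P) (L.sum (M.sum P)) :=
  ⟨LinearEquiv.prodAssoc ℤ L M P, fun x y => by
    change L.form _ _ + (M.form _ _ + P.form _ _) = (L.form _ _ + M.form _ _) + P.form _ _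
    exact (add_assoc _ _ _).symm⟩

lemma U_form (x y : Fin 2 → ℤ) : U.form x y = x 0 * y 1 + x 1 * y 0 := by
  change Matrix.toBilin' _ x y = _
  rw [Matrix.toBilin'_apply']
  simp [dotProduct, Matrix.mulVec, Fin.sum_univ_two]

/-- All integral functionals are of the form `(z, ·)`. -/
def Unimodular (L : EvenLattice) : Prop := ∀ f : L.Dual, L.Repr f

lemma unimodular_U : Unimodular U := by
  intro f
  refine ⟨(![f (![0, 1] : Fin 2 → ℤ), f (![1, 0] : Fin 2 → ℤ)] : Fin 2 → ℤ), fun v => ?_⟩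
  refine Eq.trans ?_ (U_form _ _).symm
  have hv : v = (v 0 • (![1, 0] : Fin 2 → ℤ) + v 1 • (![0, 1] : Fin 2 → ℤ) : Fin 2 → ℤ) := by
    refine funext fun i => ?_
    fin_cases i <;> simp
  conv_lhs => rw [hv]
  refine (f.map_add _ _).trans ?_
  refine (congrArg₂ (· + ·) (f.map_smul _ _) (f.map_smul _ _)).trans ?_
  change v 0 * f (![1, 0] : Fin 2 → ℤ) + v 1 * f (![0, 1] : Fin 2 → ℤ) =
    f (![0, 1] : Fin 2 → ℤ) * v 1 + f (![1, 0] : Fin 2 → ℤ) * v 0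
  ring

lemma Repr.add {L : EvenLattice} {f g : L.Dual} (hf : L.Repr f) (hg : L.Repr g) :
    L.Repr (f + g) := by
  obtain ⟨z, hz⟩ := hf
  obtain ⟨w, hw⟩ := hg
  exact ⟨z + w, fun v => by rw [map_add, LinearMap.add_apply, LinearMap.add_apply, hz, hw]⟩

lemma Repr.comp_iso {L M : EvenLattice} {f : M.Dual} (hf : M.Repr f) (φ : Iso L M) :
    L.Repr (f ∘ₗ φ.e.toLinearMap) := by
  obtain ⟨z, hz⟩ := hf
  refine ⟨φ.symm.e z, fun v => ?_⟩
  rw [L.symm, φ.map_symm, M.symm, ← hz]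
  rfl

/-- A functional on `P ⊕ M` with `P` unimodular is representable if its restriction to `M` is. -/
lemma Repr.of_inr {P M : EvenLattice} (hP : P.Unimodular) {f : (P.sum M).Dual}
    (hf : M.Repr (f ∘ₗ inr P M)) : (P.sum M).Repr f := by
  obtain ⟨z, hz⟩ := hf
  obtain ⟨w, hw⟩ := hP (f ∘ₗ inl P M)
  refine ⟨((w, z) : P × M), fun v => ?_⟩
  rw [← inl_fst_add_inr_snd P M v, map_add]
  refine (congrArg₂ (· + ·) (hw (fst P M v)) (hz (snd P M v))).trans ?_
  rw [inl_fst_add_inr_snd]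
  rfl

lemma Repr.inr {P M : EvenLattice} {f : (P.sum M).Dual} (hf : (P.sum M).Repr f) :
    M.Repr (f ∘ₗ inr P M) := by
  obtain ⟨z, hz⟩ := hf
  refine ⟨snd P M z, fun v => (hz _).trans ?_⟩
  change P.form (fst P M z) 0 + M.form (snd P M z) v = _
  rw [map_zero, zero_add]

lemma Unimodular.sum {P M : EvenLattice} (hP : P.Unimodular) (hM : M.Unimodular) :
    (P.sum M).Unimodular := fun _ => Repr.of_inr hP (hM _)

lemma Unimodular.of_iso {L M : EvenLattice} (hL : L.Unimodular) (φ : Iso L M) :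
    M.Unimodular := by
  intro f
  have := (hL (f ∘ₗ φ.e.toLinearMap)).comp_iso φ.symm
  convert this using 1
  ext v
  simp

lemma Unimodular.of_sum {P M : EvenLattice} (h : (P.sum M).Unimodular) : M.Unimodular := by
  intro f
  have h1 := (h (f ∘ₗ snd P M)).inr
  exact h1

/-- The orthogonal complement of a hyperbolic pair. -/
def perp (L : EvenLattice) (e f : L) (he : L.form e e = 0) (hf : L.form f f = 0)
    (hef : L.form e f = 1) : EvenLattice where
  carrier := ↥(LinearMap.ker (L.form e) ⊓ LinearMap.ker (L.form f))
  form := L.form.domRestrict₁₂ _ _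
  symm x y := L.symm _ _
  nondeg := by
    rintro ⟨x, hx, hx'⟩ h
    have hx : L.form e x = 0 := hx
    have hx' : L.form f x = 0 := hx'
    refine Subtype.ext (L.nondeg x fun z => ?_)
    -- Any `z` is moved into the complement by subtracting its hyperbolic component, to which `x` is
    -- orthogonal.
    have h1 := h ⟨z - (L.form f z) • e - (L.form e z) • f, by
      constructor
      · change L.form e _ = 0
        simp [he, hef]
      · change L.form f _ = 0
        simp [hf, L.symm f e, hef]⟩
    change L.form x (z - (L.form f z) • e - (L.form e z) • f) = 0 at h1
    simpa [L.symm x e, L.symm x f, hx, hx'] using h1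
  even x := L.even _

/-- A hyperbolic pair splits off a hyperbolic plane. -/
lemma exists_split (L : EvenLattice) {e f : L} (he : L.form e e = 0) (hf : L.form f f = 0)
    (hef : L.form e f = 1) : ∃ (M : EvenLattice) (φ : Iso (U.sum M) L),
      φ.e (((![1, 0] : Fin 2 → ℤ), (0 : M)) : U × M) = e ∧
      φ.e (((![0, 1] : Fin 2 → ℤ), (0 : M)) : U × M) = f := by
  let M := L.perp e f he hf hef
  let ι : M →ₗ[ℤ] L := Submodule.subtype _
  have hι : ∀ m : M, L.form e (ι m) = 0 ∧ L.form f (ι m) = 0 := fun m => m.2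
  let φ₀ : (Fin 2 → ℤ) × M →ₗ[ℤ] L :=
    LinearMap.coprod ((LinearMap.proj 0).smulRight e + (LinearMap.proj 1).smulRight f) ι
  have hφ₀ : ∀ u m, φ₀ (u, m) = u 0 • e + u 1 • f + ι m := fun u m => rfl
  let φ : U.sum M →ₗ[ℤ] L := φ₀
  have hmap : ∀ x y, L.form (φ x) (φ y) = (U.sum M).form x y := by
    rintro ⟨u, m⟩ ⟨v, n⟩
    refine Eq.trans ?_ (congrArg (· + L.form (ι m) (ι n)) (U_form u v).symm)
    change L.form (u 0 • e + u 1 • f + ι m) (v 0 • e + v 1 • f + ι n) =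
      u 0 * v 1 + u 1 * v 0 + L.form (ι m) (ι n)
    simp only [map_add, map_smul, LinearMap.add_apply, LinearMap.smul_apply, smul_eq_mul, he, hf,
      hef, L.symm f e, L.symm (ι m) e, L.symm (ι m) f, (hι m).1, (hι m).2, (hι n).1, (hι n).2]
    ring
  refine ⟨M, Iso.ofSurjective φ hmap fun x => ?_, ?_, ?_⟩
  · refine ⟨(((![L.form f x, L.form e x] : Fin 2 → ℤ),
      (⟨x - (L.form f x) • e - (L.form e x) • f, ?_, ?_⟩ : M)) : U × M), ?_⟩
    · change L.form e _ = 0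
      simp [he, hef]
    · change L.form f _ = 0
      simp [hf, L.symm f e, hef]
    · refine (hφ₀ _ _).trans ?_
      change (L.form f x) • e + (L.form e x) • f + (x - (L.form f x) • e - (L.form e x) • f) = x
      abel
  · refine (hφ₀ _ _).trans ?_
    change (1 : ℤ) • e + (0 : ℤ) • f + ι 0 = e
    rw [map_zero, one_smul, zero_smul, add_zero, add_zero]
  · refine (hφ₀ _ _).trans ?_
    change (0 : ℤ) • e + (1 : ℤ) • f + ι 0 = f
    rw [map_zero, one_smul, zero_smul, add_zero, zero_add]

/-- Subtracting `k e` lowers the norm of `y` by `2k`, and evenness lets `k` be half that norm. -/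
lemma exists_hyperbolic_partner (L : EvenLattice) {e y : L} (he : L.form e e = 0)
    (hy : L.form e y = 1) : ∃ k : ℤ, L.form (y - k • e) (y - k • e) = 0 ∧
      L.form e (y - k • e) = 1 := by
  obtain ⟨k, hk⟩ := L.even y
  refine ⟨k, ?_, ?_⟩
  · simp [he, hy, L.symm y e, hk]
  · simp [he, hy]

/-! ### Orthogonal families and signature of sums -/

/-- An orthogonal family of anisotropic vectors of full rank. -/
structure OrthFamily (L : EvenLattice) (α : Type) [Fintype α] where
  u : α → L
  orth : ∀ i j, i ≠ j → L.form (u i) (u j) = 0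
  ne_zero : ∀ i, L.form (u i) (u i) ≠ 0
  card : finrank ℤ L = Fintype.card α

lemma exists_orthFamily (L : EvenLattice) : Nonempty (L.OrthFamily (Fin (finrank ℤ L))) := by
  obtain ⟨u, hu, hu'⟩ := L.exists_orthogonal
  exact ⟨⟨u, hu, hu', by simp⟩⟩

/-- The union of orthogonal families. -/
def OrthFamily.sum {L M : EvenLattice} {α β : Type} [Fintype α] [Fintype β] (u : L.OrthFamily α)
    (v : M.OrthFamily β) : (L.sum M).OrthFamily (α ⊕ β) where
  u := Sum.elim (fun i => inl L M (u.u i)) (fun j => inr L M (v.u j))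
  orth := by
    rintro (i | i) (j | j) hij
    · change L.form (u.u i) (u.u j) + M.form 0 0 = 0
      rw [u.orth i j (by rintro rfl; exact hij rfl), map_zero, add_zero]
    · change L.form (u.u i) 0 + M.form 0 (v.u j) = 0
      simp
    · change L.form 0 (u.u j) + M.form (v.u i) 0 = 0
      simp
    · change L.form 0 0 + M.form (v.u i) (v.u j) = 0
      rw [v.orth i j (by rintro rfl; exact hij rfl), map_zero, add_zero]
  ne_zero := by
    rintro (i | i)
    · change L.form (u.u i) (u.u i) + M.form 0 0 ≠ 0
      simpa using u.ne_zero i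
    · change L.form 0 0 + M.form (v.u i) (v.u i) ≠ 0
      simpa using v.ne_zero i
  card := by
    rw [Fintype.card_sum, ← u.card, ← v.card]
    exact finrank_prod (R := ℤ) (M := L) (M' := M)

lemma OrthFamily.sum_inl {L M : EvenLattice} {α β : Type} [Fintype α] [Fintype β]
    (u : L.OrthFamily α) (v : M.OrthFamily β) (i : α) :
    (L.sum M).form ((u.sum v).u (Sum.inl i)) ((u.sum v).u (Sum.inl i)) =
      L.form (u.u i) (u.u i) := by
  change L.form (u.u i) (u.u i) + M.form 0 0 = _
  simp

lemma OrthFamily.sum_inr {L M : EvenLattice} {α β : Type} [Fintype α] [Fintype β]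
    (u : L.OrthFamily α) (v : M.OrthFamily β) (i : β) :
    (L.sum M).form ((u.sum v).u (Sum.inr i)) ((u.sum v).u (Sum.inr i)) =
      M.form (v.u i) (v.u i) := by
  change L.form 0 0 + M.form (v.u i) (v.u i) = _
  simp

/-- The image of an orthogonal family under an isometry. -/
def OrthFamily.map {L M : EvenLattice} {α : Type} [Fintype α] (u : L.OrthFamily α) (φ : Iso L M) :
    M.OrthFamily α where
  u i := φ.e (u.u i)
  orth i j hij := by rw [φ.map, u.orth i j hij]
  ne_zero i := by rw [φ.map]; exact u.ne_zero i
  card := by rw [← φ.e.finrank_eq, u.card]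

lemma ncard_sum_setOf {α β : Type} [Finite α] [Finite β] (P : α ⊕ β → Prop) :
    {i | P i}.ncard = {i | P (Sum.inl i)}.ncard + {j | P (Sum.inr j)}.ncard := by
  have : {i | P i} = Sum.inl '' {i | P (Sum.inl i)} ∪ Sum.inr '' {j | P (Sum.inr j)} := by
    ext (i | i) <;> simp
  rw [this, Set.ncard_union_eq, Set.ncard_image_of_injective _ Sum.inl_injective,
    Set.ncard_image_of_injective _ Sum.inr_injective]
  rw [Set.disjoint_left]
  rintro _ ⟨i, -, rfl⟩ ⟨j, -, hj⟩
  cases hj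

lemma sigPos_sum (L M : EvenLattice) : (L.sum M).sigPos = L.sigPos + M.sigPos := by
  obtain ⟨u⟩ := L.exists_orthFamily
  obtain ⟨v⟩ := M.exists_orthFamily
  rw [(L.sum M).sigPos_eq_ncard _ (u.sum v).orth (u.sum v).ne_zero (u.sum v).card,
    L.sigPos_eq_ncard _ u.orth u.ne_zero u.card, M.sigPos_eq_ncard _ v.orth v.ne_zero v.card,
    ncard_sum_setOf]
  simp only [OrthFamily.sum_inl, OrthFamily.sum_inr]

lemma sigNeg_sum (L M : EvenLattice) : (L.sum M).sigNeg = L.sigNeg + M.sigNeg := by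
  obtain ⟨u⟩ := L.exists_orthFamily
  obtain ⟨v⟩ := M.exists_orthFamily
  rw [(L.sum M).sigNeg_eq_ncard _ (u.sum v).orth (u.sum v).ne_zero (u.sum v).card,
    L.sigNeg_eq_ncard _ u.orth u.ne_zero u.card, M.sigNeg_eq_ncard _ v.orth v.ne_zero v.card,
    ncard_sum_setOf]
  simp only [OrthFamily.sum_inl, OrthFamily.sum_inr]

lemma Iso.sigPos_eq {L M : EvenLattice} (φ : Iso L M) : L.sigPos = M.sigPos := by
  obtain ⟨u⟩ := L.exists_orthFamily
  rw [L.sigPos_eq_ncard _ u.orth u.ne_zero u.card,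
    M.sigPos_eq_ncard _ (u.map φ).orth (u.map φ).ne_zero (u.map φ).card]
  simp only [OrthFamily.map, φ.map]

lemma Iso.sigNeg_eq {L M : EvenLattice} (φ : Iso L M) : L.sigNeg = M.sigNeg := by
  obtain ⟨u⟩ := L.exists_orthFamily
  rw [L.sigNeg_eq_ncard _ u.orth u.ne_zero u.card,
    M.sigNeg_eq_ncard _ (u.map φ).orth (u.map φ).ne_zero (u.map φ).card]
  simp only [OrthFamily.map, φ.map]

/-! ### Unimodular lattices of signature zero -/

/-- The rational Witt class of a unimodular even lattice of signature zero vanishes. -/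
lemma Unimodular.mk_ratSpace_eq_zero {L : EvenLattice} (hL : L.Unimodular)
    (hs : L.sigPos = L.sigNeg) : WittGroup.mk L.ratSpace = 0 := by
  classical
  let b := finBasis ℤ L
  let A : Matrix (Fin (finrank ℤ L)) (Fin (finrank ℤ L)) ℤ :=
    Matrix.of fun i j => L.form (b i) (b j)
  have hA : A.IsSymm := by
    ext i j
    exact L.symm _ _
  -- Vectors representing the coordinate functionals are the rows of an integral left inverse of the
  -- Gram matrix.
  have hdet : IsUnit A.det := by
    choose z hz using fun j => hL (b.coord j)
    refine Matrix.isUnit_det_of_left_inverse (B := Matrix.of fun j k => b.repr (z j) k) ?_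
    ext j i
    rw [Matrix.mul_apply]
    have h1 := hz j (b i)
    have h2 : ∑ k, b.repr (z j) k * L.form (b k) (b i) = L.form (z j) (b i) := by
      conv_rhs => rw [← b.sum_repr (z j), map_sum, LinearMap.sum_apply]
      exact Finset.sum_congr rfl fun k _ => by
        rw [map_smul, LinearMap.smul_apply, smul_eq_mul]
    refine h2.trans (h1.symm.trans ?_)
    rw [Basis.coord_apply, b.repr_self, Matrix.one_apply, Finsupp.single_apply]
    simp only [eq_comm]
  have hgram : WittGroup.mk (gramSpace A hA hdet.ne_zero) = WittGroup.mk L.ratSpace := by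
    refine mk_eq_of_isometry (X := gramSpace A hA hdet.ne_zero) (Y := L.ratSpace)
      (Fintype.linearCombination ℚ fun i => (1 : ℚ) ⊗ₜ[ℤ] b i)
      (fun (x y : Fin (finrank ℤ L) → ℚ) => ?_) ?_
    · change L.ratForm (∑ i, x i • ((1 : ℚ) ⊗ₜ[ℤ] b i)) (∑ i, y i • ((1 : ℚ) ⊗ₜ[ℤ] b i)) =
        Matrix.toBilin' (A.map (Int.cast : ℤ → ℚ)) x y
      rw [Matrix.toBilin'_apply]
      simp only [map_sum, LinearMap.sum_apply, map_smul, LinearMap.smul_apply, smul_eq_mul,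
        ratForm_tmul]
      simp only [Finset.mul_sum]
      rw [Finset.sum_comm]
      refine Finset.sum_congr rfl fun i _ => Finset.sum_congr rfl fun j _ => ?_
      simp [A]
      ring
    · change finrank ℚ (ℚ ⊗[ℤ] L) ≤ finrank ℚ (Fin (finrank ℤ L) → ℚ)
      rw [finrank_rat, finrank_fintype_fun_eq_card, Fintype.card_fin]
  obtain ⟨u⟩ := L.exists_orthFamily
  rw [← hgram]
  refine mk_gramSpace_eq_zero A hA hdet (fun i => L.form (u.u i) (u.u i)) u.ne_zero ?_ ?_
  · rw [hgram, L.mk_ratSpace u.u u.orth u.ne_zero u.card]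
  · rw [← L.sigPos_eq_ncard u.u u.orth u.ne_zero u.card,
      ← L.sigNeg_eq_ncard u.u u.orth u.ne_zero u.card, hs]

/-- The vanishing Witt class gives a rational isotropic vector; clear denominators to get `v`. If
`(v, L) = mℤ`, unimodularity represents `(v, ·)/m` by a vector `e` with `v = m e`, and `e` pairs to
`1` with some vector. -/
lemma Unimodular.exists_hyperbolic {L : EvenLattice} (hL : L.Unimodular)
    (hs : L.sigPos = L.sigNeg) (h0 : finrank ℤ L ≠ 0) :
    ∃ e f : L, L.form e e = 0 ∧ L.form f f = 0 ∧ L.form e f = 1 := by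
  obtain ⟨W, hW, hd⟩ : ∃ W : Submodule ℚ (ℚ ⊗[ℤ] L), (∀ x ∈ W, ∀ y ∈ W, L.ratForm x y = 0) ∧
      finrank ℚ (ℚ ⊗[ℤ] L) ≤ 2 * finrank ℚ W := mk_eq_zero.1 (hL.mk_ratSpace_eq_zero hs)
  rw [finrank_rat] at hd
  have hWne : W ≠ ⊥ := by
    intro h
    rw [h, finrank_bot] at hd
    omega
  obtain ⟨x, hx, hx0⟩ := W.ne_bot_iff.1 hWne
  obtain ⟨n, hn, v, hv⟩ := L.exists_smul_eq_tmul x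
  have hvv : L.form v v = 0 := by
    have h1 := L.ratForm_tmul 1 1 v v
    rw [← hv, map_smul, map_smul, LinearMap.smul_apply] at h1
    have h2 : L.ratForm x x = 0 := hW x hx x hx
    rw [h2] at h1
    have h3 : (L.form v v : ℚ) = 0 := by simpa using h1.symm
    exact_mod_cast h3
  have hv0 : v ≠ 0 := by
    rintro rfl
    rw [TensorProduct.tmul_zero] at hv
    exact hx0 ((smul_eq_zero.1 hv).resolve_left (Int.cast_ne_zero.2 hn))
  obtain ⟨m, hm⟩ := (IsPrincipalIdealRing.principal (LinearMap.range (L.form v))).principal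
  have hm0 : m ≠ 0 := by
    rintro rfl
    refine hv0 (L.nondeg v fun y => ?_)
    have : L.form v y ∈ LinearMap.range (L.form v) := ⟨y, rfl⟩
    rw [hm] at this
    simpa using this
  have hdvd : ∀ y, ∃ c, L.form v y = c * m := by
    intro y
    have : L.form v y ∈ LinearMap.range (L.form v) := ⟨y, rfl⟩
    rw [hm, Submodule.mem_span_singleton] at this
    obtain ⟨c, hc⟩ := this
    exact ⟨c, hc.symm⟩
  choose c hc using hdvd
  obtain ⟨e, he⟩ := hL ((AddMonoidHom.mk' c fun y z => by
    refine mul_right_cancel₀ hm0 ?_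
    rw [← hc, add_mul, ← hc, ← hc, map_add]).toIntLinearMap)
  have he : ∀ y, c y = L.form e y := he
  have hve : v = m • e := by
    refine sub_eq_zero.1 (L.nondeg _ fun y => ?_)
    rw [map_sub, LinearMap.sub_apply, map_smul, LinearMap.smul_apply, hc, he]
    simp [mul_comm]
  obtain ⟨y, hy⟩ : m ∈ LinearMap.range (L.form v) := by
    rw [hm]
    exact Submodule.mem_span_singleton_self m
  have hey : L.form e y = 1 := by
    rw [hc, he] at hy
    exact mul_right_cancel₀ hm0 (hy.trans (one_mul m).symm)
  have hee : L.form e e = 0 := by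
    rw [hve] at hvv
    simpa [hm0] using hvv
  obtain ⟨k, hk, hk'⟩ := L.exists_hyperbolic_partner hee hey
  exact ⟨e, _, hee, hk, hk'⟩

/-- `n` hyperbolic planes added to a lattice. -/
def addU : ℕ → EvenLattice → EvenLattice
  | 0, K => K
  | n + 1, K => U.sum (addU n K)

/-- The inclusion of a lattice into the lattice with `n` hyperbolic planes added. -/
def inAddU : (n : ℕ) → (K : EvenLattice) → K →ₗ[ℤ] addU n K
  | 0, _ => LinearMap.id
  | n + 1, K => inr U (addU n K) ∘ₗ inAddU n K

lemma U_sigPos_eq_sigNeg : U.sigPos = U.sigNeg ∧ finrank ℤ U = 2 := by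
  have hr : finrank ℤ U = 2 := (finrank_fintype_fun_eq_card ℤ).trans (by simp)
  refine ⟨?_, hr⟩
  let u : Fin 2 → U := ![(![1, 1] : Fin 2 → ℤ), (![1, -1] : Fin 2 → ℤ)]
  have h0 : U.form (u 0) (u 0) = 2 := (U_form _ _).trans rfl
  have h1 : U.form (u 1) (u 1) = -2 := (U_form _ _).trans rfl
  have h01 : U.form (u 0) (u 1) = 0 := (U_form _ _).trans rfl
  have horth : ∀ i j, i ≠ j → U.form (u i) (u j) = 0 := by
    intro i j hij
    fin_cases i <;> fin_cases j
    · exact absurd rfl hij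
    · exact h01
    · exact (U.symm _ _).trans h01
    · exact absurd rfl hij
  have hne : ∀ i, U.form (u i) (u i) ≠ 0 := by
    intro i
    fin_cases i
    · exact h0.trans_ne (by norm_num)
    · exact h1.trans_ne (by norm_num)
  rw [U.sigPos_eq_ncard u horth hne hr, U.sigNeg_eq_ncard u horth hne hr]
  have hc : ∀ i : Fin 2, i = 0 ∨ i = 1 := by decide
  have e1 : {i | 0 < U.form (u i) (u i)} = {0} := by
    refine Set.eq_singleton_iff_unique_mem.2 ⟨(by norm_num : (0 : ℤ) < 2).trans_eq h0.symm, fun i hi => ?_⟩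
    refine (hc i).resolve_right ?_
    rintro rfl
    have hi : 0 < U.form (u 1) (u 1) := hi
    omega
  have e2 : {i | U.form (u i) (u i) < 0} = {1} := by
    refine Set.eq_singleton_iff_unique_mem.2 ⟨h1.trans_lt (by norm_num), fun i hi => ?_⟩
    refine (hc i).resolve_left ?_
    rintro rfl
    have hi : U.form (u 0) (u 0) < 0 := hi
    omega
  rw [e1, e2, Set.ncard_singleton, Set.ncard_singleton]

lemma finrank_sum (L M : EvenLattice) : finrank ℤ (L.sum M) = finrank ℤ L + finrank ℤ M :=
  finrank_prod (R := ℤ) (M := L) (M' := M)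

lemma finrank_addU (n : ℕ) (K : EvenLattice) : finrank ℤ (addU n K) = 2 * n + finrank ℤ K := by
  induction n with
  | zero => exact (zero_add _).symm
  | succ n ih =>
    change finrank ℤ (U.sum (addU n K)) = _
    rw [finrank_sum, ih, U_sigPos_eq_sigNeg.2]
    ring

/-- A unimodular even lattice of signature zero is a sum of hyperbolic planes. -/
theorem Unimodular.exists_iso_addU : ∀ (r : ℕ) {H : EvenLattice}, H.Unimodular →
    H.sigPos = H.sigNeg → finrank ℤ H = r → ∃ m : ℕ, 2 * m = r ∧
      ∀ K, ∃ φ : Iso (H.sum K) (addU m K), ∀ k, φ.e (inr H K k) = inAddU m K k := by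
  intro r
  induction r using Nat.strong_induction_on with
  | _ r ih =>
    intro H hH hs hr
    by_cases h0 : finrank ℤ H = 0
    · refine ⟨0, by omega, fun K => ?_⟩
      have hsub : Subsingleton H := by
        rwa [finrank_eq_zero_iff_of_free] at h0
      refine ⟨Iso.ofSurjective (M := K) (snd H K) (fun x y => ?_) fun k => ⟨inr H K k, rfl⟩,
        fun k => rfl⟩
      change _ = H.form (fst H K x) _ + K.form (snd H K x) (snd H K y)
      rw [Subsingleton.elim (fst H K x) 0, map_zero, LinearMap.zero_apply, zero_add]
    -- Peel off one plane; the complement is again unimodular of signature zero. Carrying an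
    -- arbitrary summand `K` through the induction records that its inclusion is the standard one.
    · obtain ⟨e, f, he, hf, hef⟩ := hH.exists_hyperbolic hs h0
      obtain ⟨M, φ, -, -⟩ := H.exists_split he hf hef
      have hM : M.Unimodular := (hH.of_iso φ.symm).of_sum
      have h1 := φ.sigPos_eq
      have h2 := φ.sigNeg_eq
      have h3 := φ.e.finrank_eq
      rw [sigPos_sum] at h1
      rw [sigNeg_sum] at h2
      rw [finrank_sum] at h3
      have h4 := U_sigPos_eq_sigNeg
      obtain ⟨m, hm, hK⟩ := ih (finrank ℤ M) (by omega) hM (by omega) rfl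
      refine ⟨m + 1, by omega, fun K => ?_⟩
      obtain ⟨χ, hχ⟩ := hK K
      refine ⟨((φ.symm.sumCongr (Iso.refl K)).trans (sumAssoc U M K)).trans
        ((Iso.refl U).sumCongr χ), fun k => ?_⟩
      have h5 : (φ.symm.sumCongr (Iso.refl K)).e (inr H K k) = inr (U.sum M) K k :=
        Prod.ext (map_zero φ.symm.e) rfl
      refine (congrArg (((sumAssoc U M K).trans ((Iso.refl U).sumCongr χ)).e) h5).trans ?_
      exact Prod.ext rfl (hχ k)

end EvenLattice

end

noncomputable section

/-! ### Gluing two lattices along an isomorphism of discriminant forms -/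

namespace EvenLattice

open Module

/-- The unimodular lattice `K ⊕ Hom(K, ℤ)` with the evaluation pairing. -/
def double (K : EvenLattice) : EvenLattice where
  carrier := K × K.Dual
  free := by
    have h : Module.Free ℤ (K × K.Dual) := inferInstance
    convert h
  finite := by
    have h : Module.Finite ℤ (K × K.Dual) := inferInstance
    convert h
  form := LinearMap.mk₂ ℤ (fun x y => x.2 y.1 + y.2 x.1)
    (by intros; simp; ring) (by intros; simp; ring)
    (by intros; simp; ring) (by intros; simp; ring)
  symm x y := add_comm _ _
  nondeg x h := by
    refine Prod.ext (K.nondeg _ fun y => ?_) (LinearMap.ext fun y => ?_)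
    · rw [K.symm]
      simpa using h (0, K.form y)
    · simpa using h (y, 0)
  even x := ⟨_, rfl⟩

/-- By reflexivity of `K`, the restriction of a functional to `K.Dual` is evaluation at a vector of
`K`; its restriction to `K` is the other component. -/
lemma unimodular_double (K : EvenLattice) : K.double.Unimodular := by
  intro F
  let F' : K × K.Dual →ₗ[ℤ] ℤ := F
  obtain ⟨t, ht⟩ := (evalEquiv ℤ K).surjective (F' ∘ₗ LinearMap.inr ℤ K K.Dual)
  refine ⟨((t, F' ∘ₗ LinearMap.inl ℤ K K.Dual) : K × K.Dual), fun v => ?_⟩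
  have h1 : F' v = F' ((show K × K.Dual from v).1, 0) + F' (0, (show K × K.Dual from v).2) := by
    rw [← map_add]
    exact congrArg F' (Prod.ext (add_zero _).symm (zero_add _).symm)
  exact h1.trans (congrArg (F' ((show K × K.Dual from v).1, 0) + ·)
    (LinearMap.congr_fun ht (show K × K.Dual from v).2).symm)

/-- The map `(x, f) ↦ (x, -f)` negates the form and so exchanges positive and negative squares. -/
lemma sigPos_double (K : EvenLattice) : K.double.sigPos = K.double.sigNeg := by
  obtain ⟨u⟩ := K.double.exists_orthFamily
  let σ : K × K.Dual →ₗ[ℤ] K × K.Dual := LinearMap.prodMap LinearMap.id (-LinearMap.id)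
  have hσ : ∀ x y : K.double, K.double.form (σ x) (σ y) = -K.double.form x y := by
    intro x y
    change (-_) + (-_) = -(_ + _)
    exact (neg_add _ _).symm
  rw [K.double.sigNeg_eq_ncard (fun i => σ (u.u i))
    (fun i j hij => by rw [hσ, u.orth i j hij, neg_zero])
    (fun i => by rw [hσ]; exact neg_ne_zero.2 (u.ne_zero i)) u.card,
    K.double.sigPos_eq_ncard u.u u.orth u.ne_zero u.card]
  simp only [hσ, neg_lt_zero]

lemma finrank_dual (K : EvenLattice) : finrank ℤ K.Dual = finrank ℤ K := by
  rw [finrank_linearMap, finrank_self, mul_one]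

lemma finrank_double (K : EvenLattice) : finrank ℤ K.double = 2 * finrank ℤ K := by
  refine (finrank_prod (R := ℤ) (M := K) (M' := K.Dual)).trans ?_
  rw [finrank_dual]
  ring

section Glue

variable {E K : EvenLattice} (ψ : E.Disc →+ K.Disc)

/-- The pairs of functionals whose classes correspond. -/
def glueSub : Submodule ℤ (E.Dual × K.Dual) :=
  LinearMap.ker (ψ.comp (E.cl.comp (AddMonoidHom.fst _ _)) -
    K.cl.comp (AddMonoidHom.snd _ _)).toIntLinearMap

variable {ψ}

lemma mem_glueSub {p : E.Dual × K.Dual} : p ∈ glueSub ψ ↔ ψ (E.cl p.1) = K.cl p.2 := by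
  rw [glueSub, LinearMap.mem_ker]
  exact sub_eq_zero

/-- The difference of the rational forms on pairs of functionals. -/
def glueVal (E K : EvenLattice) (p q : E.Dual × K.Dual) : ℚ :=
  E.ratForm (E.rep p.1) (E.rep q.1) - K.ratForm (K.rep p.2) (K.rep q.2)

lemma glueVal_add_left (p p' q : E.Dual × K.Dual) :
    glueVal E K (p + p') q = glueVal E K p q + glueVal E K p' q := by
  simp only [glueVal, Prod.fst_add, Prod.snd_add, map_add, LinearMap.add_apply]
  ring

lemma glueVal_comm (p q : E.Dual × K.Dual) : glueVal E K p q = glueVal E K q p := by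
  rw [glueVal, glueVal, E.ratForm_symm, K.ratForm_symm]

lemma glueVal_smul_left (n : ℤ) (p q : E.Dual × K.Dual) :
    glueVal E K (n • p) q = n * glueVal E K p q := by
  simp only [glueVal, Prod.smul_fst, Prod.smul_snd, map_zsmul, LinearMap.smul_apply,
    zsmul_eq_mul]
  ring

lemma glueVal_inl (x : E) (q : E.Dual × K.Dual) : glueVal E K (E.form x, 0) q = q.1 x := by
  simp only [glueVal, rep_form, map_zero, LinearMap.zero_apply, sub_zero]
  rw [ratForm_symm, ratForm_rep]

lemma glueVal_inr (y : K) (q : E.Dual × K.Dual) : glueVal E K (0, K.form y) q = -q.2 y := by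
  simp only [glueVal, rep_form, map_zero, LinearMap.zero_apply, zero_sub]
  rw [ratForm_symm, ratForm_rep]

lemma exists_glueVal_self (hψ : ∀ a, K.discForm (ψ a) = E.discForm a) {p : E.Dual × K.Dual}
    (hp : p ∈ glueSub ψ) : ∃ n : ℤ, glueVal E K p p = 2 * n := by
  have h := hψ (E.cl p.1)
  rw [mem_glueSub.1 hp, discForm_cl, discForm_cl, QuotientAddGroup.eq,
    AddSubgroup.mem_zmultiples_iff] at h
  obtain ⟨n, hn⟩ := h
  refine ⟨n, ?_⟩
  rw [zsmul_eq_mul] at hn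
  rw [glueVal]
  linarith

/-- Polarisation: norms of glued pairs lie in `2ℤ`, hence their mutual pairings lie in `ℤ`. Only
preservation of the quadratic form is needed. -/
lemma exists_glueVal (hψ : ∀ a, K.discForm (ψ a) = E.discForm a) {p q : E.Dual × K.Dual}
    (hp : p ∈ glueSub ψ) (hq : q ∈ glueSub ψ) : ∃ n : ℤ, (n : ℚ) = glueVal E K p q := by
  obtain ⟨a, ha⟩ := exists_glueVal_self hψ hp
  obtain ⟨b, hb⟩ := exists_glueVal_self hψ hq
  obtain ⟨c, hc⟩ := exists_glueVal_self hψ (add_mem hp hq)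
  refine ⟨c - a - b, ?_⟩
  rw [glueVal_add_left, glueVal_comm p, glueVal_comm q (p + q), glueVal_add_left, glueVal_add_left,
    glueVal_comm q p] at hc
  push_cast
  linarith

variable (hψ : ∀ a, K.discForm (ψ a) = E.discForm a)

/-- The integral form on the glued lattice. -/
def glueInt (p q : glueSub ψ) : ℤ := (exists_glueVal hψ p.2 q.2).choose

lemma glueInt_cast (p q : glueSub ψ) : (glueInt hψ p q : ℚ) = glueVal E K p q :=
  (exists_glueVal hψ p.2 q.2).choose_spec

lemma glueInt_comm (p q : glueSub ψ) : glueInt hψ p q = glueInt hψ q p := by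
  rw [← Int.cast_inj (α := ℚ), glueInt_cast, glueInt_cast, glueVal_comm]

lemma glueInt_add_left (p p' q : glueSub ψ) :
    glueInt hψ (p + p') q = glueInt hψ p q + glueInt hψ p' q := by
  rw [← Int.cast_inj (α := ℚ), Int.cast_add, glueInt_cast, glueInt_cast, glueInt_cast]
  exact glueVal_add_left _ _ _

lemma glueInt_smul_left (n : ℤ) (p q : glueSub ψ) :
    glueInt hψ (n • p) q = n • glueInt hψ p q := by
  rw [← Int.cast_inj (α := ℚ), smul_eq_mul, Int.cast_mul, glueInt_cast, glueInt_cast]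
  exact glueVal_smul_left _ _ _

/-- The inclusion of `E` into the glued lattice. -/
def glueInl (ψ : E.Disc →+ K.Disc) : E →ₗ[ℤ] glueSub ψ :=
  ((LinearMap.inl ℤ E.Dual K.Dual) ∘ₗ E.form).codRestrict _ fun x => mem_glueSub.2 (by
    have h : E.cl (E.form x) = 0 := E.cl_eq_zero.2 ⟨x, fun _ => rfl⟩
    change ψ (E.cl (E.form x)) = K.cl 0
    rw [h, map_zero, map_zero])

/-- The inclusion of `K` into the glued lattice. -/
def glueInr (ψ : E.Disc →+ K.Disc) : K →ₗ[ℤ] glueSub ψ :=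
  ((LinearMap.inr ℤ E.Dual K.Dual) ∘ₗ K.form).codRestrict _ fun x => mem_glueSub.2 (by
    have h : K.cl (K.form x) = 0 := K.cl_eq_zero.2 ⟨x, fun _ => rfl⟩
    change ψ (E.cl 0) = K.cl (K.form x)
    rw [h, map_zero, map_zero])

lemma glueInt_inl (x : E) (q : glueSub ψ) : glueInt hψ (glueInl ψ x) q = q.1.1 x := by
  rw [← Int.cast_inj (α := ℚ), glueInt_cast]
  exact glueVal_inl _ _

lemma glueInt_inr (y : K) (q : glueSub ψ) : glueInt hψ (glueInr ψ y) q = -q.1.2 y := by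
  rw [← Int.cast_inj (α := ℚ), glueInt_cast, Int.cast_neg]
  exact glueVal_inr _ _

/-- The glued lattice: pairs of functionals whose classes correspond, with the difference of the
rational forms. -/
def glue : EvenLattice where
  carrier := glueSub ψ
  form := LinearMap.mk₂ ℤ (glueInt hψ) (glueInt_add_left hψ) (glueInt_smul_left hψ)
    (fun p q r => by
      rw [glueInt_comm, glueInt_add_left, glueInt_comm hψ q, glueInt_comm hψ r])
    (fun n p q => by rw [glueInt_comm, glueInt_smul_left, glueInt_comm hψ q])
  symm := glueInt_comm hψ
  nondeg p hp := by
    refine Subtype.ext (Prod.ext (LinearMap.ext fun x => ?_) (LinearMap.ext fun y => ?_))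
    · refine (glueInt_inl hψ x p).symm.trans ?_
      rw [glueInt_comm]
      exact hp _
    · refine neg_injective ((glueInt_inr hψ y p).symm.trans ?_)
      rw [glueInt_comm]
      exact (hp _).trans neg_zero.symm
  even p := by
    obtain ⟨n, hn⟩ := exists_glueVal_self hψ p.2
    refine ⟨n, ?_⟩
    change glueInt hψ p p = n + n
    rw [← Int.cast_inj (α := ℚ), glueInt_cast, hn]
    push_cast
    ring

/-- A functional is represented by the rational vector `(f, g)` read off from its restrictions to
`E` and `K`. Surjectivity of `ψ` supplies enough test vectors to show that this pair belongs to the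
glued lattice. -/
lemma unimodular_glue (hs : Function.Surjective ψ) : (glue hψ).Unimodular := by
  intro F₀
  let F : glueSub ψ →ₗ[ℤ] ℤ := F₀
  let f : E.Dual := F ∘ₗ glueInl ψ
  let g : K.Dual := -(F ∘ₗ glueInr ψ)
  -- A non-zero multiple of `h` lies in `E ⊕ K`, where the identity is evident. The sign in `g`
  -- reflects the negated form on `K`.
  have key : ∀ h : glueSub ψ, (F h : ℚ) = glueVal E K (f, g) h := by
    intro h
    obtain ⟨n, hn, x, hx⟩ := E.exists_smul_eq_tmul (E.rep h.1.1)
    obtain ⟨m, hm, y, hy⟩ := K.exists_smul_eq_tmul (K.rep h.1.2)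
    have hx' : n • h.1.1 = E.form x := E.rep_injective (by
      rw [map_zsmul, rep_form, ← hx, Int.cast_smul_eq_zsmul])
    have hy' : m • h.1.2 = K.form y := K.rep_injective (by
      rw [map_zsmul, rep_form, ← hy, Int.cast_smul_eq_zsmul])
    have hh : (n * m) • h = glueInl ψ (m • x) + glueInr ψ (n • y) := by
      refine Subtype.ext (Prod.ext ?_ ?_)
      · change (n * m) • h.1.1 = E.form (m • x) + 0
        rw [map_smul, ← hx', add_zero, smul_smul, mul_comm]
      · change (n * m) • h.1.2 = 0 + K.form (n • y)
        rw [map_smul, ← hy', zero_add, smul_smul]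
    have h1 := congrArg F hh
    rw [map_smul, map_add] at h1
    have h2 : F (glueInl ψ (m • x)) = f (m • x) := rfl
    have h3 : F (glueInr ψ (n • y)) = -g (n • y) := (neg_neg _).symm
    rw [h2, h3, smul_eq_mul] at h1
    have h4 : ((n * m : ℤ) : ℚ) * F h = ((n * m : ℤ) : ℚ) * glueVal E K (f, g) h := by
      rw [glueVal_comm, ← glueVal_smul_left, ← Int.cast_mul, h1]
      have h5 : (n * m) • (h : E.Dual × K.Dual) = (E.form (m • x), 0) + (0, K.form (n • y)) :=
        congrArg Subtype.val hh
      rw [h5, glueVal_add_left, glueVal_inl, glueVal_inr]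
      push_cast
      ring
    exact mul_left_cancel₀ (Int.cast_ne_zero.2 (mul_ne_zero hn hm)) h4
  obtain ⟨g₀, hg₀⟩ := K.cl_surjective (ψ (E.cl f))
  have hfg : (f, g) ∈ glueSub ψ := by
    rw [mem_glueSub]
    change ψ (E.cl f) = K.cl g
    rw [← hg₀, cl_eq_cl]
    -- Every `g₁` is the second component of some glued pair, so `g₀ - g` pairs integrally with the
    -- whole dual of `K` and is therefore representable.
    obtain ⟨v, hv⟩ := K.exists_eq_tmul_of_forall_rep (x := K.rep (g₀ - g)) fun g₁ => by
      obtain ⟨a, ha⟩ := hs (K.cl g₁)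
      obtain ⟨f₁, rfl⟩ := E.cl_surjective a
      let h₁ : glueSub ψ := ⟨(f₁, g₁), mem_glueSub.2 ha⟩
      let h₀ : glueSub ψ := ⟨(f, g₀), mem_glueSub.2 hg₀.symm⟩
      refine ⟨F h₁ - glueInt hψ h₀ h₁, ?_⟩
      rw [Int.cast_sub, key, glueInt_cast]
      simp only [glueVal, map_sub, LinearMap.sub_apply]
      simp only [h₁, h₀]
      ring
    refine ⟨v, fun w => ?_⟩
    rw [← K.rep_form] at hv
    rw [K.rep_injective hv]
  refine ⟨(⟨(f, g), hfg⟩ : glueSub ψ), fun v => ?_⟩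
  have h1 := key v
  have h2 := glueInt_cast hψ ⟨(f, g), hfg⟩ v
  rw [← h1, Int.cast_inj] at h2
  exact h2.symm

lemma finrank_glue : finrank ℤ (glue hψ) = finrank ℤ E + finrank ℤ K := by
  refine le_antisymm ?_ ?_
  · refine (Submodule.finrank_le (glueSub ψ)).trans ?_
    rw [finrank_prod, finrank_dual, finrank_dual]
  · have hinj : Function.Injective (LinearMap.coprod (glueInl ψ) (glueInr ψ)) := by
      rw [injective_iff_map_eq_zero]
      rintro ⟨x, y⟩ h
      have h1 : E.form x + 0 = 0 := congrArg (fun p : glueSub ψ => p.1.1) h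
      have h2 : 0 + K.form y = 0 := congrArg (fun p : glueSub ψ => p.1.2) h
      rw [add_zero] at h1
      rw [zero_add] at h2
      refine Prod.ext (E.nondeg x fun z => by rw [h1]; rfl) (K.nondeg y fun z => by rw [h2]; rfl)
    have := LinearMap.finrank_le_finrank_of_injective hinj
    rwa [finrank_prod] at this

/-- The orthogonal family of the glued lattice given by families of the two lattices. -/
def OrthFamily.glue {α β : Type} [Fintype α] [Fintype β] (u : E.OrthFamily α)
    (v : K.OrthFamily β) : (glue hψ).OrthFamily (α ⊕ β) where
  u := Sum.elim (fun i => glueInl ψ (u.u i)) (fun j => glueInr ψ (v.u j))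
  orth := by
    rintro (i | i) (j | j) hij
    · exact (glueInt_inl hψ _ _).trans (u.orth j i (by rintro rfl; exact hij rfl))
    · exact glueInt_inl hψ _ _
    · refine (glueInt_inr hψ _ _).trans neg_zero
    · refine (glueInt_inr hψ _ _).trans (neg_eq_zero.2 (v.orth j i ?_))
      rintro rfl
      exact hij rfl
  ne_zero := by
    rintro (i | i)
    · exact (glueInt_inl hψ _ _).trans_ne (u.ne_zero i)
    · exact (glueInt_inr hψ _ _).trans_ne (neg_ne_zero.2 (v.ne_zero i))
  card := by rw [finrank_glue, Fintype.card_sum, ← u.card, ← v.card]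

lemma OrthFamily.glue_inl {α β : Type} [Fintype α] [Fintype β] (u : E.OrthFamily α)
    (v : K.OrthFamily β) (i : α) : (EvenLattice.glue hψ).form ((u.glue hψ v).u (Sum.inl i))
      ((u.glue hψ v).u (Sum.inl i)) = E.form (u.u i) (u.u i) :=
  glueInt_inl hψ _ _

lemma OrthFamily.glue_inr {α β : Type} [Fintype α] [Fintype β] (u : E.OrthFamily α)
    (v : K.OrthFamily β) (i : β) : (EvenLattice.glue hψ).form ((u.glue hψ v).u (Sum.inr i))
      ((u.glue hψ v).u (Sum.inr i)) = -K.form (v.u i) (v.u i) :=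
  glueInt_inr hψ _ _

lemma sigPos_glue : (glue hψ).sigPos = E.sigPos + K.sigNeg := by
  obtain ⟨u⟩ := E.exists_orthFamily
  obtain ⟨v⟩ := K.exists_orthFamily
  rw [(glue hψ).sigPos_eq_ncard _ (u.glue hψ v).orth (u.glue hψ v).ne_zero (u.glue hψ v).card,
    E.sigPos_eq_ncard _ u.orth u.ne_zero u.card, K.sigNeg_eq_ncard _ v.orth v.ne_zero v.card,
    ncard_sum_setOf]
  simp only [OrthFamily.glue_inl, OrthFamily.glue_inr, neg_pos]

lemma sigNeg_glue : (glue hψ).sigNeg = E.sigNeg + K.sigPos := by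
  obtain ⟨u⟩ := E.exists_orthFamily
  obtain ⟨v⟩ := K.exists_orthFamily
  rw [(glue hψ).sigNeg_eq_ncard _ (u.glue hψ v).orth (u.glue hψ v).ne_zero (u.glue hψ v).card,
    E.sigNeg_eq_ncard _ u.orth u.ne_zero u.card, K.sigPos_eq_ncard _ v.orth v.ne_zero v.card,
    ncard_sum_setOf]
  simp only [OrthFamily.glue_inl, OrthFamily.glue_inr, neg_lt_zero]

end Glue

/-! ### Isometries inducing a map of discriminant groups -/

/-- For lattices `L`, `M` that are sums of unimodular lattices and of `E`, `K`, embedded by `i`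
and `j`: the isometry `φ` induces `ψ` on discriminant groups. -/
def Induces {E K L M : EvenLattice} (ψ : E.Disc →+ K.Disc) (i : E →ₗ[ℤ] L) (j : K →ₗ[ℤ] M)
    (φ : Iso L M) : Prop :=
  ∀ (f : L.Dual) (g : M.Dual), ψ (E.cl (f ∘ₗ i)) = K.cl (g ∘ₗ j) →
    L.Repr (g ∘ₗ φ.e.toLinearMap - f)

/-- The isometry acts trivially on the discriminant group. -/
def Stable {L : EvenLattice} (σ : Iso L L) : Prop :=
  ∀ f : L.Dual, L.Repr (f ∘ₗ σ.e.toLinearMap - f)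

/-- `T` need not be symmetric: half the norm is an integral quadratic map, and such a map on a free
module lifts to a bilinear form. It is used to make a section isotropic without leaving the
integers. -/
lemma exists_half_form (L : EvenLattice) : ∃ T : LinearMap.BilinForm ℤ L,
    ∀ x, 2 * T x x = L.form x x := by
  choose q hq using L.even
  let Q : QuadraticMap ℤ L ℤ :=
    { toFun := q
      toFun_smul := fun a x => by
        have h1 := hq (a • x)
        have h2 := hq x
        simp only [map_smul, LinearMap.smul_apply, smul_eq_mul] at h1 ⊢
        have : 2 * q (a • x) = 2 * (a * a * q x) := by
          rw [h2] at h1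
          linarith
        linarith
      exists_companion' := ⟨L.form, fun x y => by
        have h1 := hq (x + y)
        simp only [map_add, LinearMap.add_apply, hq x, hq y, L.symm y x] at h1
        linarith⟩ }
  obtain ⟨T, hT⟩ := LinearMap.BilinMap.toQuadraticMap_surjective Q
  refine ⟨T, fun x => ?_⟩
  have : T x x = q x := congrArg (fun Q => Q x) hT
  rw [this, hq]
  ring

/-- Isomorphic discriminant forms: `double K ⊕ E` and `glue ⊕ K` are isometric, by an isometry
inducing the given isomorphism. -/
theorem exists_iso_double_glue {E K : EvenLattice} (ψ : E.Disc →+ K.Disc)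
    (hψ : ∀ a, K.discForm (ψ a) = E.discForm a) (hbij : Function.Bijective ψ) :
    ∃ θ : Iso (K.double.sum E) ((glue hψ).sum K), Induces ψ (inr _ E) (inr _ K) θ := by
  let H := glue hψ
  let π : glueSub ψ →ₗ[ℤ] K.Dual := -(LinearMap.snd ℤ E.Dual K.Dual ∘ₗ (glueSub ψ).subtype)
  have hπ : Function.Surjective π := by
    intro g
    obtain ⟨a, ha⟩ := hbij.2 (K.cl (-g))
    obtain ⟨f, rfl⟩ := E.cl_surjective a
    exact ⟨⟨(f, -g), mem_glueSub.2 ha⟩, neg_neg g⟩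
  -- In `glue ⊕ K` the diagonal copy `(-k, -k)` of `K` is isotropic, since `K` enters the glued
  -- lattice with negated form. The vectors `(-s f, 0)` are dual to this copy.
  obtain ⟨s, hs⟩ := projective_lifting_property π LinearMap.id hπ
  have hs : ∀ f, (s f).1.2 = -f := fun f => neg_eq_iff_eq_neg.1 (LinearMap.congr_fun hs f)
  obtain ⟨T, hT⟩ := H.exists_half_form
  let B : LinearMap.BilinForm ℤ (glueSub ψ) := H.form
  let T' : LinearMap.BilinForm ℤ (glueSub ψ) := T
  have hT' : ∀ x, 2 * T' x x = B x x := hT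
  -- Corrections along the isotropic copy of `K`: `ρ` makes the image of `E` orthogonal to that of
  -- `K.Dual`, and `τ'`, built from the half form, makes the image of `K.Dual` isotropic.
  let ρ : glueSub ψ →ₗ[ℤ] K := (evalEquiv ℤ K).symm.toLinearMap ∘ₗ (LinearMap.lcomp ℤ ℤ s) ∘ₗ B
  let τ' : K.Dual →ₗ[ℤ] K :=
    (evalEquiv ℤ K).symm.toLinearMap ∘ₗ (-((LinearMap.lcomp ℤ ℤ s) ∘ₗ T' ∘ₗ s))
  have hρ : ∀ h f, f (ρ h) = B h (s f) := fun h f =>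
    LinearMap.congr_fun ((evalEquiv ℤ K).apply_symm_apply (B h ∘ₗ s)) f
  have hτ : ∀ f f' : K.Dual, f' (τ' f) = -T' (s f) (s f') := fun f f' =>
    LinearMap.congr_fun ((evalEquiv ℤ K).apply_symm_apply (-(T' (s f) ∘ₗ s))) f'
  have hBl : ∀ x q, B (glueInl ψ x) q = q.1.1 x := glueInt_inl hψ
  have hBr : ∀ y q, B (glueInr ψ y) q = -q.1.2 y := glueInt_inr hψ
  have hBs : ∀ p q, B p q = B q p := glueInt_comm hψ
  let μ : (K × K.Dual) × E →ₗ[ℤ] K :=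
    ρ ∘ₗ glueInl ψ ∘ₗ LinearMap.snd ℤ _ _ +
      (LinearMap.coprod LinearMap.id τ') ∘ₗ LinearMap.fst ℤ _ _
  have hμ : ∀ x, μ x = ρ (glueInl ψ x.2) + (x.1.1 + τ' x.1.2) := fun x => rfl
  let θ : (K × K.Dual) × E →ₗ[ℤ] glueSub ψ × K :=
    LinearMap.prod (glueInl ψ ∘ₗ LinearMap.snd ℤ _ _ -
      s ∘ₗ LinearMap.snd ℤ _ _ ∘ₗ LinearMap.fst ℤ _ _ - glueInr ψ ∘ₗ μ) (-μ)
  have hθ : ∀ x, θ x = (glueInl ψ x.2 - s x.1.2 - glueInr ψ (μ x), -μ x) := fun x => rfl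
  let θ' : K.double.sum E →ₗ[ℤ] H.sum K := θ
  have hnorm : ∀ x : (K × K.Dual) × E, B (θ x).1 (θ x).1 + K.form (θ x).2 (θ x).2 =
      2 * x.1.2 x.1.1 + E.form x.2 x.2 := by
    intro x
    have e1 : (glueInl ψ x.2 : glueSub ψ).1.1 = E.form x.2 := rfl
    have e2 : (glueInl ψ x.2 : glueSub ψ).1.2 = 0 := rfl
    have e3 : (glueInr ψ (μ x) : glueSub ψ).1.2 = K.form (μ x) := rfl
    have e5 : (glueInr ψ (μ x) : glueSub ψ).1.1 = 0 := rfl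
    have e4 : x.1.2 (μ x) = B (glueInl ψ x.2) (s x.1.2) + (x.1.2 x.1.1 - T' (s x.1.2) (s x.1.2)) := by
      rw [hμ, map_add, map_add, hρ, hτ]
      ring
    have e6 := hT' (s x.1.2)
    rw [hθ]
    simp only [map_sub, map_neg, LinearMap.sub_apply, LinearMap.neg_apply, hBr,
      hBs (s x.1.2) (glueInr ψ (μ x)), hBs (s x.1.2) (glueInl ψ x.2),
      hBs (glueInl ψ x.2) (glueInr ψ (μ x)), e2, e3, hs, LinearMap.zero_apply]
    rw [hBl x.2 (glueInl ψ x.2), e1]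
    linarith
  have hmap : ∀ x y, (H.sum K).form (θ' x) (θ' y) = (K.double.sum E).form x y := by
    refine form_eq_of_norm θ' fun (x : (K × K.Dual) × E) => (hnorm x).trans ?_
    change _ = (x.1.2 x.1.1 + x.1.2 x.1.1) + E.form x.2 x.2
    rw [two_mul]
  have hsurj : Function.Surjective θ' := by
    intro z
    let h : glueSub ψ := (show glueSub ψ × K from z).1
    let k : K := (show glueSub ψ × K from z).2
    let f : K.Dual := (h - glueInr ψ k).1.2
    let p : glueSub ψ := h - glueInr ψ k + s f
    have hp2 : p.1.2 = 0 := by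
      change f + (s f).1.2 = 0
      rw [hs, add_neg_cancel]
    -- Injectivity of `ψ` enters here: a glued pair with zero second component comes from `E`.
    have hp1 : E.cl p.1.1 = 0 := by
      refine hbij.1 ?_
      rw [mem_glueSub.1 p.2, hp2, map_zero, map_zero]
    obtain ⟨e, he⟩ := E.cl_eq_zero.1 hp1
    have hpe : glueInl ψ e = p := Subtype.ext (Prod.ext (LinearMap.ext fun v => (he v).symm) hp2.symm)
    refine ⟨(((-k - ρ (glueInl ψ e) - τ' f, f), e) : (K × K.Dual) × E), ?_⟩
    have hu : μ ((-k - ρ (glueInl ψ e) - τ' f, f), e) = -k := by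
      rw [hμ]
      change ρ (glueInl ψ e) + (-k - ρ (glueInl ψ e) - τ' f + τ' f) = -k
      abel
    refine (hθ _).trans (Prod.ext ?_ ?_)
    · change glueInl ψ e - s f - glueInr ψ (μ _) = h
      rw [hu, hpe, map_neg]
      simp only [p]
      abel
    · change -μ _ = k
      rw [hu, neg_neg]
  refine ⟨Iso.ofSurjective θ' hmap hsurj, fun f g hfg => Repr.of_inr K.unimodular_double ?_⟩
  obtain ⟨z, hz⟩ := unimodular_glue hψ hbij.2 (g ∘ₗ inl _ K)
  let z' : glueSub ψ := z
  have hz : ∀ h : glueSub ψ, g ((h, 0) : glueSub ψ × K) = B z' h := hz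
  let g₂ : K.Dual := g ∘ₗ inr _ K
  let f₂ : E.Dual := f ∘ₗ inr _ E
  have hg : ∀ (h : glueSub ψ) (k : K), g ((h, k) : glueSub ψ × K) = B z' h + g₂ k := by
    intro h k
    rw [← hz]
    refine Eq.trans (congrArg g ?_) (g.map_add _ _)
    exact Prod.ext (add_zero _).symm (zero_add _).symm
  have hres : ∀ e : E, g (θ' (inr _ E e)) = z'.1.1 e + (s (z'.1.2 - g₂)).1.1 e := by
    intro e
    have hm : μ ((0, 0), e) = ρ (glueInl ψ e) := by
      rw [hμ, map_zero]
      simp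
    have h1 : θ' (inr _ E e) =
        ((glueInl ψ e - glueInr ψ (ρ (glueInl ψ e)), -ρ (glueInl ψ e)) : glueSub ψ × K) := by
      refine (hθ ((0, 0), e)).trans ?_
      rw [hm]
      change (glueInl ψ e - s 0 - _, _) = _
      rw [map_zero, sub_zero]
    rw [h1, hg, map_sub, hBs z' (glueInl ψ e), hBs z' (glueInr ψ _), hBl, hBr, map_neg]
    have h2 := hρ (glueInl ψ e) (z'.1.2 - g₂)
    rw [hBl, LinearMap.sub_apply] at h2
    rw [← h2]
    ring
  -- The glued pair `z' + s (z'.1.2 - g₂)` has second component `g₂`, so `ψ` sends the class of its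
  -- first component to that of `g₂`. By `hres` this first component is the restriction to `E` of
  -- `g` composed with the isometry.
  have hcl : E.cl (z'.1.1 + (s (z'.1.2 - g₂)).1.1) = E.cl f₂ := by
    refine hbij.1 ?_
    have h1 := mem_glueSub.1 (z' + s (z'.1.2 - g₂)).2
    refine h1.trans (Eq.trans (congrArg K.cl ?_) hfg.symm)
    change z'.1.2 + (s (z'.1.2 - g₂)).1.2 = _
    rw [hs]
    change _ = g₂
    abel
  obtain ⟨w, hw⟩ := E.cl_eq_cl.1 hcl
  refine ⟨w, fun e => Eq.trans ?_ (hw e)⟩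
  change g (θ' (inr _ E e)) - f₂ e = _
  rw [hres]
  rfl

end EvenLattice

end

noncomputable section

namespace EvenLattice

open Module

/-! ### Isometries inducing a map of discriminant groups: formal properties -/

section Induces

variable {E K L M : EvenLattice} {ψ : E.Disc →+ K.Disc} {i : E →ₗ[ℤ] L} {j : K →ₗ[ℤ] M}

lemma Stable.trans {σ σ' : Iso L L} (h : Stable σ) (h' : Stable σ') : Stable (σ.trans σ') := by
  intro f
  have := ((h' f).comp_iso σ).add (h f)
  convert this using 1
  ext v
  simp

lemma Induces.trans_stable {φ : Iso L M} (h : Induces ψ i j φ) {σ : Iso M M} (hσ : Stable σ) :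
    Induces ψ i j (φ.trans σ) := by
  intro f g hfg
  have := ((hσ g).comp_iso φ).add (h f g hfg)
  convert this using 1
  ext v
  simp

lemma Induces.conj {L' M' : EvenLattice} {φ : Iso L M} (h : Induces ψ i j φ) (α : Iso L L')
    (β : Iso M M') {i' : E →ₗ[ℤ] L'} {j' : K →ₗ[ℤ] M'} (hi : ∀ x, α.e (i x) = i' x)
    (hj : ∀ x, β.e (j x) = j' x) : Induces ψ i' j' ((α.symm.trans φ).trans β) := by
  intro f g hfg
  have hi' : (f ∘ₗ α.e.toLinearMap) ∘ₗ i = f ∘ₗ i' := LinearMap.ext fun x => congrArg f (hi x)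
  have hj' : (g ∘ₗ β.e.toLinearMap) ∘ₗ j = g ∘ₗ j' := LinearMap.ext fun x => congrArg g (hj x)
  have := (h (f ∘ₗ α.e.toLinearMap) (g ∘ₗ β.e.toLinearMap) (by rw [hi', hj', hfg])).comp_iso α.symm
  convert this using 1
  ext v
  simp

lemma Stable.sumCongr {P : EvenLattice} (hP : P.Unimodular) {σ : Iso L L} (h : Stable σ) :
    Stable ((Iso.refl P).sumCongr σ) :=
  fun f => Repr.of_inr hP (h (f ∘ₗ inr P L))

lemma Induces.sumCongr {P : EvenLattice} (hP : P.Unimodular) {φ : Iso L M}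
    (h : Induces ψ i j φ) :
    Induces ψ (inr P L ∘ₗ i) (inr P M ∘ₗ j) ((Iso.refl P).sumCongr φ) :=
  fun f g hfg => Repr.of_inr hP (h (f ∘ₗ inr P L) (g ∘ₗ inr P M) hfg)

/-- An isometry of `P ⊕ L` and `P ⊕ M` fixing `P` restricts to the complements. -/
lemma exists_restrict {P : EvenLattice} (φ : Iso (P.sum L) (P.sum M))
    (h : ∀ u, φ.e (inl P L u) = inl P M u) :
    ∃ χ : Iso L M, (∀ x, φ.e (inr P L x) = inr P M (χ.e x)) ∧
      (Induces ψ (inr P L ∘ₗ i) (inr P M ∘ₗ j) φ → Induces ψ i j χ) := by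
  have hP : ∀ {Q : EvenLattice} (u : P) (z : P.sum Q),
      (P.sum Q).form (inl P Q u) z = P.form u (fst P Q z) := by
    intro Q u z
    change _ + Q.form 0 _ = _
    rw [map_zero]
    exact add_zero _
  -- The image of `L` is orthogonal to `P`, so its `P`-component vanishes.
  have h1 : ∀ x, φ.e (inr P L x) = inr P M (snd P M (φ.e (inr P L x))) := by
    intro x
    have : fst P M (φ.e (inr P L x)) = 0 := P.nondeg _ fun u => by
      rw [P.symm, ← hP, ← h, φ.map, hP]
      exact map_zero _
    conv_lhs => rw [← inl_fst_add_inr_snd P M (φ.e (inr P L x)), this, map_zero, zero_add]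
  have h2 : ∀ y, φ.symm.e (inr P M y) = inr P L (snd P L (φ.symm.e (inr P M y))) := by
    intro y
    have : fst P L (φ.symm.e (inr P M y)) = 0 := P.nondeg _ fun u => by
      rw [P.symm, ← hP, φ.map_symm, h, hP]
      exact map_zero _
    conv_lhs => rw [← inl_fst_add_inr_snd P L (φ.symm.e (inr P M y)), this, map_zero, zero_add]
  have hr : ∀ {Q : EvenLattice} (x y : Q), (P.sum Q).form (inr P Q x) (inr P Q y) = Q.form x y := by
    intro Q x y
    change P.form 0 0 + _ = _
    rw [map_zero]
    exact zero_add _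
  let χ : L →ₗ[ℤ] M := snd P M ∘ₗ φ.e.toLinearMap ∘ₗ inr P L
  have hχ : ∀ x, φ.e (inr P L x) = inr P M (χ x) := h1
  refine ⟨Iso.ofSurjective χ (fun x y => ?_) (fun y => ?_), hχ, fun hφ f g hfg => ?_⟩
  · rw [← hr, ← hχ, ← hχ, φ.map, hr]
  · refine ⟨snd P L (φ.symm.e (inr P M y)), ?_⟩
    have := hχ (snd P L (φ.symm.e (inr P M y)))
    rw [← h2, φ.e_symm_e] at this
    exact (congrArg (snd P M) this).symm
  · exact (hφ (f ∘ₗ snd P L) (g ∘ₗ snd P M) hfg).inr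

end Induces

/-! ### Coordinates on the hyperbolic plane -/

/-- The vector with given coordinates in the hyperbolic plane. -/
def mkU (a b : ℤ) : U := (![a, b] : Fin 2 → ℤ)

/-- The first coordinate on the hyperbolic plane. -/
def x₀ : U →ₗ[ℤ] ℤ := (LinearMap.proj 0 : (Fin 2 → ℤ) →ₗ[ℤ] ℤ)

/-- The second coordinate on the hyperbolic plane. -/
def x₁ : U →ₗ[ℤ] ℤ := (LinearMap.proj 1 : (Fin 2 → ℤ) →ₗ[ℤ] ℤ)

@[simp] lemma x₀_mkU (a b : ℤ) : x₀ (mkU a b) = a := rfl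

@[simp] lemma x₁_mkU (a b : ℤ) : x₁ (mkU a b) = b := rfl

lemma U_form_eq (u v : U) : U.form u v = x₀ u * x₁ v + x₁ u * x₀ v := U_form u v

lemma U_ext {u v : U} (h0 : x₀ u = x₀ v) (h1 : x₁ u = x₁ v) : u = v := by
  refine funext fun i => ?_
  fin_cases i
  · exact h0
  · exact h1

/-- An action of `SL₂(ℤ)` on two hyperbolic planes. -/
def mix (X : EvenLattice) (p q r s : ℤ) (h : p * s - q * r = 1) :
    Iso (U.sum (U.sum X)) (U.sum (U.sum X)) := by
  -- The matrix acts on the `x₀`-coordinates and its inverse transpose on the `x₁`-coordinates,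
  -- which preserves their pairing.
  let m : ∀ p q r s : ℤ, U × U × X →ₗ[ℤ] U × U × X := fun p q r s =>
    { toFun := fun z => (mkU (p * x₀ z.1 + q * x₀ z.2.1) (s * x₁ z.1 - r * x₁ z.2.1),
        mkU (r * x₀ z.1 + s * x₀ z.2.1) (-q * x₁ z.1 + p * x₁ z.2.1), z.2.2)
      map_add' := fun z w => Prod.ext (U_ext (by simp; ring) (by simp; ring))
        (Prod.ext (U_ext (by simp; ring) (by simp; ring)) rfl)
      map_smul' := fun c z => Prod.ext (U_ext (by simp; ring) (by simp; ring))
        (Prod.ext (U_ext (by simp; ring) (by simp; ring)) rfl) }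
  let m' : U.sum (U.sum X) →ₗ[ℤ] U.sum (U.sum X) := m p q r s
  refine Iso.ofSurjective m' (form_eq_of_norm m' fun (z : U × U × X) => ?_)
    fun (z : U × U × X) => ⟨m s (-q) (-r) p z, ?_⟩
  · change U.form (mkU _ _) (mkU _ _) + (U.form (mkU _ _) (mkU _ _) + X.form z.2.2 z.2.2) =
      U.form z.1 z.1 + (U.form z.2.1 z.2.1 + X.form z.2.2 z.2.2)
    simp only [U_form_eq, x₀_mkU, x₁_mkU]
    linear_combination (2 * x₀ z.1 * x₁ z.1 + 2 * x₀ z.2.1 * x₁ z.2.1) * h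
  · refine Prod.ext (U_ext ?_ ?_) (Prod.ext (U_ext ?_ ?_) rfl)
    · change p * (s * x₀ z.1 + -q * x₀ z.2.1) + q * (-r * x₀ z.1 + p * x₀ z.2.1) = _
      linear_combination x₀ z.1 * h
    · change s * (p * x₁ z.1 - -r * x₁ z.2.1) - r * (- -q * x₁ z.1 + s * x₁ z.2.1) = _
      linear_combination x₁ z.1 * h
    · change r * (s * x₀ z.1 + -q * x₀ z.2.1) + s * (-r * x₀ z.1 + p * x₀ z.2.1) = _
      linear_combination x₀ z.2.1 * h
    · change -q * (p * x₁ z.1 - -r * x₁ z.2.1) + p * (- -q * x₁ z.1 + s * x₁ z.2.1) = _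
      linear_combination x₁ z.2.1 * h

lemma mix_e (X : EvenLattice) (p q r s : ℤ) (h : p * s - q * r = 1) (z : U × U × X) :
    (mix X p q r s h).e z =
      ((mkU (p * x₀ z.1 + q * x₀ z.2.1) (s * x₁ z.1 - r * x₁ z.2.1),
        mkU (r * x₀ z.1 + s * x₀ z.2.1) (-q * x₁ z.1 + p * x₁ z.2.1), z.2.2) : U × U × X) := rfl

lemma stable_mix (X : EvenLattice) (p q r s : ℤ) (h : p * s - q * r = 1) :
    Stable (mix X p q r s h) := by
  intro f
  refine Repr.of_inr unimodular_U (Repr.of_inr unimodular_U ⟨0, fun v => ?_⟩)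
  rw [map_zero, LinearMap.zero_apply]
  change f ((mix X p q r s h).e ((0, 0, v) : U × U × X)) - f ((0, 0, v) : U × U × X) = 0
  rw [mix_e, sub_eq_zero]
  exact congrArg f (Prod.ext (U_ext (by simp) (by simp))
    (Prod.ext (U_ext (by simp) (by simp)) rfl))

/-- The exchange of the two isotropic basis vectors of a hyperbolic plane. -/
def flipU (Y : EvenLattice) : Iso (U.sum Y) (U.sum Y) := by
  let m : U × Y →ₗ[ℤ] U × Y :=
    { toFun := fun z => (mkU (x₁ z.1) (x₀ z.1), z.2)
      map_add' := fun z w => Prod.ext (U_ext (by simp) (by simp)) rfl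
      map_smul' := fun c z => Prod.ext (U_ext (by simp) (by simp)) rfl }
  let m' : U.sum Y →ₗ[ℤ] U.sum Y := m
  refine Iso.ofSurjective m' (form_eq_of_norm m' fun (z : U × Y) => ?_)
    fun (z : U × Y) => ⟨m z, Prod.ext (U_ext rfl rfl) rfl⟩
  change U.form (mkU _ _) (mkU _ _) + Y.form z.2 z.2 = U.form z.1 z.1 + Y.form z.2 z.2
  simp only [U_form_eq, x₀_mkU, x₁_mkU]
  ring

lemma flipU_e (Y : EvenLattice) (z : U × Y) :
    (flipU Y).e z = ((mkU (x₁ z.1) (x₀ z.1), z.2) : U × Y) := rfl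

lemma stable_flipU (Y : EvenLattice) : Stable (flipU Y) := by
  intro f
  refine Repr.of_inr unimodular_U ⟨0, fun v => ?_⟩
  rw [map_zero, LinearMap.zero_apply]
  change f ((flipU Y).e ((0, v) : U × Y)) - f ((0, v) : U × Y) = 0
  rw [flipU_e, sub_eq_zero]
  exact congrArg f (Prod.ext (U_ext (by simp) (by simp)) rfl)

/-! ### Eichler transvections and transitivity on hyperbolic pairs -/

/-- Eichler transvections: with `k = a² / 2`, the isometry
`(u, y) ↦ (u₀ - (a, y) - k u₁, u₁, y + u₁ a)`. -/
lemma exists_eichler (Y : EvenLattice) (a : Y) : ∃ σ : Iso (U.sum Y) (U.sum Y), Stable σ ∧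
    ∃ k : ℤ, Y.form a a = 2 * k ∧ ∀ z : U × Y, σ.e z =
      ((mkU (x₀ z.1 - Y.form a z.2 - k * x₁ z.1) (x₁ z.1), z.2 + x₁ z.1 • a) : U × Y) := by
  obtain ⟨k, hk⟩ := Y.even a
  rw [← two_mul] at hk
  let m : Y → U × Y →ₗ[ℤ] U × Y := fun a =>
    { toFun := fun z => (mkU (x₀ z.1 - Y.form a z.2 - k * x₁ z.1) (x₁ z.1), z.2 + x₁ z.1 • a)
      map_add' := fun z w => Prod.ext (U_ext (by simp; ring) (by simp)) (by
        simp only [Prod.fst_add, Prod.snd_add, map_add, add_smul]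
        abel)
      map_smul' := fun c z => Prod.ext (U_ext (by simp; ring) (by simp)) (by
        simp [mul_smul]) }
  let m' : U.sum Y →ₗ[ℤ] U.sum Y := m a
  refine ⟨Iso.ofSurjective m' (form_eq_of_norm m' fun (z : U × Y) => ?_)
    fun (z : U × Y) => ⟨m (-a) z, ?_⟩, fun f => ?_, k, hk, fun z => rfl⟩
  · change U.form (mkU _ _) (mkU _ _) + Y.form (z.2 + x₁ z.1 • a) (z.2 + x₁ z.1 • a) =
      U.form z.1 z.1 + Y.form z.2 z.2
    simp only [U_form_eq, x₀_mkU, x₁_mkU, map_add, map_smul, LinearMap.add_apply,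
      LinearMap.smul_apply, smul_eq_mul, Y.symm z.2 a, hk]
    ring
  · refine Prod.ext (U_ext ?_ rfl) ?_
    · change x₀ z.1 - Y.form (-a) z.2 - k * x₁ z.1 - Y.form a (z.2 + x₁ z.1 • (-a)) - k * x₁ z.1 = _
      simp only [map_add, map_smul, map_neg, LinearMap.neg_apply, smul_eq_mul, hk]
      ring
    · change z.2 + x₁ z.1 • (-a) + x₁ z.1 • a = z.2
      rw [smul_neg]
      abel
  -- On `Y` the transvection adds `-(a, v)` times the first isotropic basis vector, so `f` changes
  -- by a multiple of `(a, ·)`.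
  · refine Repr.of_inr unimodular_U ⟨-(f (inl U Y (mkU 1 0))) • a, fun v => ?_⟩
    change f (m a (0, v)) - f (inr U Y v) = _
    have h1 : m a (0, v) = -(Y.form a v) • inl U Y (mkU 1 0) + inr U Y v := by
      refine Prod.ext (U_ext ?_ ?_) ?_
      · change x₀ 0 - Y.form a v - k * x₁ 0 = -Y.form a v * 1 + 0
        simp
      · change x₁ 0 = -Y.form a v * 0 + 0
        simp
      · change v + x₁ 0 • a = -(Y.form a v) • 0 + v
        simp
    refine (congrArg (fun z => f z - f (inr U Y v)) h1).trans ?_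
    rw [map_add, map_smul, add_sub_cancel_right, map_smul, LinearMap.smul_apply, smul_eq_mul,
      smul_eq_mul]
    ring

lemma exists_kill (a b : ℤ) : ∃ p q r s : ℤ, p * s - q * r = 1 ∧ p * a + q * b = 0 := by
  by_cases h : Int.gcd a b = 0
  · obtain ⟨rfl, rfl⟩ := Int.gcd_eq_zero_iff.1 h
    exact ⟨1, 0, 0, 1, by norm_num, by norm_num⟩
  · obtain ⟨g, a', b', -, hc, ha, hb⟩ := Int.exists_gcd_one' (Nat.pos_of_ne_zero h)
    obtain ⟨x, y, hxy⟩ := Int.isCoprime_iff_gcd_eq_one.2 hc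
    refine ⟨b', -a', x, y, by linarith, ?_⟩
    rw [ha, hb]
    ring

/-- Three planes are needed. Mixing the first two kills `x₀` in the first; mixing the last two kills
`x₀` in the second; a second mixing of the first two then kills `x₁` in the first, while both `x₀`
stay zero. -/
lemma exists_stable_fst_eq_zero (X : EvenLattice) (z : U.sum (U.sum (U.sum X))) :
    ∃ σ : Iso (U.sum (U.sum (U.sum X))) (U.sum (U.sum (U.sum X))), Stable σ ∧
      fst U _ (σ.e z) = 0 := by
  let z' : U × U × U × X := z
  obtain ⟨p, q, r, s, h, h0⟩ := exists_kill (x₀ z'.1) (x₀ z'.2.1)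
  let z₁ : U × U × U × X := (mix (U.sum X) p q r s h).e z
  have h1 : x₀ z₁.1 = 0 := h0
  obtain ⟨p', q', r', s', h', h0'⟩ := exists_kill (x₀ z₁.2.1) (x₀ z₁.2.2.1)
  let z₂ : U × U × U × X := ((Iso.refl U).sumCongr (mix X p' q' r' s' h')).e z₁
  have h2 : x₀ z₂.1 = 0 := h1
  have h3 : x₀ z₂.2.1 = 0 := h0'
  obtain ⟨s'', r'', q'', p'', h'', h0''⟩ := exists_kill (x₁ z₂.1) (x₁ z₂.2.1)
  refine ⟨((mix (U.sum X) p q r s h).trans ((Iso.refl U).sumCongr (mix X p' q' r' s' h'))).trans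
    (mix (U.sum X) p'' (-q'') (-r'') s'' (by linarith)),
    ((stable_mix _ _ _ _ _ _).trans ((stable_mix _ _ _ _ _ _).sumCongr unimodular_U)).trans
      (stable_mix _ _ _ _ _ _), U_ext ?_ ?_⟩
  · change p'' * x₀ z₂.1 + (-q'') * x₀ z₂.2.1 = 0
    rw [h2, h3]
    ring
  · change s'' * x₁ z₂.1 - (-r'') * x₁ z₂.2.1 = 0
    linarith

/-- Hyperbolic pairs in `U ⊕ U ⊕ U ⊕ X` are equivalent under stable isometries. -/
lemma exists_stable_hyperbolic (X : EvenLattice) {e f : U.sum (U.sum (U.sum X))}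
    (he : (U.sum (U.sum (U.sum X))).form e e = 0) (hf : (U.sum (U.sum (U.sum X))).form f f = 0)
    (hef : (U.sum (U.sum (U.sum X))).form e f = 1) :
    ∃ σ : Iso (U.sum (U.sum (U.sum X))) (U.sum (U.sum (U.sum X))), Stable σ ∧
      σ.e e = inl U _ (mkU 1 0) ∧ σ.e f = inl U _ (mkU 0 1) := by
  obtain ⟨σ₁, hσ₁, h1⟩ := exists_stable_fst_eq_zero X e
  generalize hY : U.sum (U.sum X) = Y at *
  rw [← σ₁.map] at he hf hef
  let y : Y := snd U Y (σ₁.e e)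
  let w : Y := snd U Y (σ₁.e f)
  have he1 : σ₁.e e = ((0, y) : U × Y) := Prod.ext h1 rfl
  have hyw : Y.form y w = 1 := by
    rw [he1] at hef
    refine Eq.trans ?_ hef
    change _ = U.form 0 _ + Y.form y w
    rw [map_zero]
    exact (zero_add _).symm
  have hyy : Y.form y y = 0 := by
    rw [he1] at he
    refine Eq.trans ?_ he
    change _ = U.form 0 0 + Y.form y y
    rw [map_zero]
    exact (zero_add _).symm
  -- With `e` moved to `(0, y)` and `(y, w) = 1`, the transvection by `-w` creates `x₀ = 1`. After a
  -- flip this becomes `x₁ = 1`, and the transvection by `-y` removes the `Y`-component.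
  obtain ⟨σ₂, hσ₂, k, -, h2⟩ := exists_eichler Y (-w)
  obtain ⟨σ₃, hσ₃, k', hk', h3⟩ := exists_eichler Y (-y)
  have hk0 : k' = 0 := by
    simp [hyy] at hk'
    exact hk'
  let σ := ((σ₁.trans σ₂).trans (flipU Y)).trans (σ₃.trans (flipU Y))
  have hσ : Stable σ := ((hσ₁.trans hσ₂).trans (stable_flipU Y)).trans (hσ₃.trans (stable_flipU Y))
  have hσe : σ.e e = inl U Y (mkU 1 0) := by
    change (flipU Y).e (σ₃.e ((flipU Y).e (σ₂.e (σ₁.e e)))) = _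
    rw [he1, h2, flipU_e, h3, flipU_e, hk0]
    refine Prod.ext (U_ext ?_ ?_) ?_
    · change x₀ 0 - Y.form (-w) y - k * x₁ 0 = 1
      simp [Y.symm w y, hyw]
    · change x₁ 0 - Y.form (-y) (y + x₁ 0 • _) - 0 * _ = 0
      simp [hyy]
    · change y + x₁ 0 • _ + (x₀ 0 - Y.form (-w) y - k * x₁ 0) • (-y) = 0
      simp [Y.symm w y, hyw]
  rw [← σ₁.map_symm, σ₁.symm_e_e, ← σ.map, hσe] at hef
  rw [σ₁.map, ← σ.map] at hf
  let z : U × Y := σ.e f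
  have hz1 : x₁ z.1 = 1 := by
    refine Eq.trans ?_ hef
    change _ = U.form (mkU 1 0) z.1 + Y.form 0 _
    rw [U_form_eq]
    simp
  have hzz : 2 * x₀ z.1 + Y.form z.2 z.2 = 0 := by
    refine Eq.trans ?_ hf
    change _ = U.form z.1 z.1 + Y.form z.2 z.2
    rw [U_form_eq, hz1]
    ring
  -- Now `x₁ = 1` for the image of `f`, so the transvection by minus its `Y`-component removes that
  -- component and fixes the image of `e`. Isotropy forces `x₀ = 0`.
  obtain ⟨σ₄, hσ₄, k₄, hk₄, h4⟩ := exists_eichler Y (-z.2)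
  have hk₄' : Y.form z.2 z.2 = 2 * k₄ := by simpa using hk₄
  refine ⟨σ.trans σ₄, hσ.trans hσ₄, ?_, ?_⟩
  · rw [Iso.trans_e, hσe]
    refine (h4 _).trans (Prod.ext (U_ext ?_ rfl) ?_)
    · change 1 - Y.form (-z.2) 0 - k₄ * 0 = 1
      simp
    · change (0 : Y) + (0 : ℤ) • (-z.2) = 0
      simp
  · rw [Iso.trans_e]
    refine (h4 z).trans (Prod.ext (U_ext ?_ hz1) ?_)
    · change x₀ z.1 - Y.form (-z.2) z.2 - k₄ * x₁ z.1 = 0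
      rw [hz1]
      simp only [map_neg, LinearMap.neg_apply]
      linarith
    · change z.2 + x₁ z.1 • (-z.2) = 0
      rw [hz1]
      simp

/-! ### Cancelling planes and the prescribed isometry -/

/-- Cancellation of a hyperbolic plane. -/
lemma Induces.cancel {E K L X : EvenLattice} {ψ : E.Disc →+ K.Disc} {i : E →ₗ[ℤ] L}
    {j : K →ₗ[ℤ] U.sum (U.sum X)} {φ : Iso (U.sum L) (U.sum (U.sum (U.sum X)))}
    (h : Induces ψ (inr U L ∘ₗ i) (inr U _ ∘ₗ j) φ) :
    ∃ χ : Iso L (U.sum (U.sum X)), Induces ψ i j χ := by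
  have hf : ∀ u v, (U.sum L).form (inl U L u) (inl U L v) = U.form u v := by
    intro u v
    change _ + L.form 0 0 = _
    rw [map_zero]
    exact add_zero _
  obtain ⟨σ, hσ, h1, h2⟩ := exists_stable_hyperbolic X (e := φ.e (inl U L (mkU 1 0)))
    (f := φ.e (inl U L (mkU 0 1)))
    (by rw [φ.map, hf, U_form_eq]; simp) (by rw [φ.map, hf, U_form_eq]; simp)
    (by rw [φ.map, hf, U_form_eq]; simp)
  obtain ⟨χ, -, hχ⟩ := exists_restrict (ψ := ψ) (i := i) (j := j) (φ.trans σ) (fun u => by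
    have hu : u = x₀ u • mkU 1 0 + x₁ u • mkU 0 1 := U_ext (by simp) (by simp)
    rw [Iso.trans_e]
    conv_lhs => rw [hu]
    conv_rhs => rw [hu]
    simp only [map_add, map_smul, h1, h2])
  exact ⟨χ, hχ (h.trans_stable hσ)⟩

/-- Cancellation stops at two planes because each step uses three planes on the target side. -/
lemma Induces.cancel_addU {E K : EvenLattice} {ψ : E.Disc →+ K.Disc} (n : ℕ) :
    ∀ φ : Iso (addU (n + 2) E) (addU (n + 2) K),
      Induces ψ (inAddU (n + 2) E) (inAddU (n + 2) K) φ →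
      ∃ χ : Iso (addU 2 E) (addU 2 K), Induces ψ (inAddU 2 E) (inAddU 2 K) χ := by
  induction n with
  | zero => exact fun φ h => ⟨φ, h⟩
  | succ n ih =>
    intro φ h
    obtain ⟨χ, hχ⟩ := Induces.cancel (L := addU (n + 2) E) (X := addU n K)
      (i := inAddU (n + 2) E) (j := inAddU (n + 2) K) (φ := φ) h
    exact ih χ hχ

/-- Lattices with the same signature and isomorphic discriminant forms become isometric after
adding two hyperbolic planes, by an isometry inducing the given isomorphism. -/
theorem exists_iso_addU_two {E K : EvenLattice} (hp : E.sigPos = K.sigPos)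
    (hn : E.sigNeg = K.sigNeg) (ψ : E.Disc →+ K.Disc)
    (hψ : ∀ a, K.discForm (ψ a) = E.discForm a) (hbij : Function.Bijective ψ) :
    ∃ χ : Iso (addU 2 E) (addU 2 K), Induces ψ (inAddU 2 E) (inAddU 2 K) χ := by
  have hr : finrank ℤ E = finrank ℤ K := by
    rw [← sigPos_add_sigNeg, ← sigPos_add_sigNeg, hp, hn]
  obtain ⟨θ, hθ⟩ := exists_iso_double_glue ψ hψ hbij
  obtain ⟨m, hm, hE⟩ := K.unimodular_double.exists_iso_addU _ K.sigPos_double rfl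
  obtain ⟨m', hm', hK⟩ := (unimodular_glue hψ hbij.2).exists_iso_addU _
    (by rw [sigPos_glue, sigNeg_glue, hp, hn, add_comm]) rfl
  rw [finrank_double] at hm
  rw [finrank_glue] at hm'
  obtain rfl : m = m' := by omega
  obtain ⟨α, hα⟩ := hE E
  obtain ⟨β, hβ⟩ := hK K
  have h1 := hθ.conj α β hα hβ
  -- Two further planes are added first, so that removing `m` of them leaves exactly two.
  exact Induces.cancel_addU m _ ((h1.sumCongr unimodular_U).sumCongr unimodular_U)

end EvenLattice

end

noncomputable section

namespace EvenLattice

open Module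

/-! ### Real isometries are products of reflections -/

lemma realForm_symm (L : EvenLattice) (x y : ℝ ⊗[ℤ] L) : L.realForm x y = L.realForm y x := by
  have : L.realForm = L.realForm.flip := by
    ext x y
    simp [realForm, L.symm x y]
  conv_lhs => rw [this]
  rfl

lemma realForm_realMap (L : EvenLattice) (g : L.O) (x y : ℝ ⊗[ℤ] L) :
    L.realForm (L.realMap g x) (L.realMap g y) = L.realForm x y := by
  have : L.realForm.compl₁₂ (L.realMap g) (L.realMap g) = L.realForm := by
    ext x y
    simp [realForm, realMap, g.2 x y]
  exact LinearMap.congr_fun₂ this x y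

lemma reflection_apply (L : EvenLattice) (v x : ℝ ⊗[ℤ] L) :
    L.reflection v x = x - (2 / L.realForm v v * L.realForm v x) • v := by
  simp [reflection, mul_smul]

lemma realForm_reflection (L : EvenLattice) {v : ℝ ⊗[ℤ] L} (hv : L.realForm v v ≠ 0)
    (x y : ℝ ⊗[ℤ] L) : L.realForm (L.reflection v x) (L.reflection v y) = L.realForm x y := by
  simp only [reflection_apply, map_sub, LinearMap.sub_apply, map_smul, LinearMap.smul_apply,
    smul_eq_mul, L.realForm_symm x v]
  field_simp
  ring

lemma reflection_of_orthogonal (L : EvenLattice) {v x : ℝ ⊗[ℤ] L} (h : L.realForm v x = 0) :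
    L.reflection v x = x := by
  rw [reflection_apply, h, mul_zero, zero_smul, sub_zero]

lemma reflection_sub_apply (L : EvenLattice) {x y : ℝ ⊗[ℤ] L}
    (h : L.realForm x x = L.realForm y y) (h0 : L.realForm (x - y) (x - y) ≠ 0) :
    L.reflection (x - y) x = y := by
  have h1 : 2 / L.realForm (x - y) (x - y) * L.realForm (x - y) x = 1 := by
    rw [div_mul_eq_mul_div, div_eq_one_iff_eq h0]
    simp only [map_sub, LinearMap.sub_apply, L.realForm_symm y x, h]
    ring
  rw [reflection_apply, h1, one_smul, sub_sub_cancel]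

/-- Real isometries are products of reflections. -/
theorem exists_prod_reflection (L : EvenLattice) (g : Module.End ℝ (ℝ ⊗[ℤ] L))
    (hg : ∀ x y, L.realForm (g x) (g y) = L.realForm x y) :
    ∃ l : List (ℝ ⊗[ℤ] L), (∀ v ∈ l, L.realForm v v ≠ 0) ∧ g = (l.map L.reflection).prod := by
  obtain ⟨u, hu, hu'⟩ := L.exists_orthogonal
  obtain ⟨b, hb⟩ := L.exists_real_basis u hu hu' (by simp)
  have hbb : ∀ i, L.realForm (b i) (b i) ≠ 0 := by
    intro i
    rw [hb, realForm_tmul, one_mul, one_mul]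
    exact_mod_cast hu' i
  have hbo : ∀ i j, i ≠ j → L.realForm (b i) (b j) = 0 := by
    intro i j hij
    rw [hb, hb, realForm_tmul, hu i j hij]
    simp
  -- Basis vectors are fixed one at a time: `g` fixes the first `k`, and `m` remain.
  suffices H : ∀ m k : ℕ, k + m = finrank ℤ L → ∀ g : Module.End ℝ (ℝ ⊗[ℤ] L),
      (∀ x y, L.realForm (g x) (g y) = L.realForm x y) →
      (∀ i : Fin (finrank ℤ L), (i : ℕ) < k → g (b i) = b i) →
      ∃ l : List (ℝ ⊗[ℤ] L), (∀ v ∈ l, L.realForm v v ≠ 0) ∧ g = (l.map L.reflection).prod from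
    H _ 0 (zero_add _) g hg fun i hi => absurd hi (Nat.not_lt_zero _)
  intro m
  induction m with
  | zero =>
    intro k hk g _ hfix
    refine ⟨[], by simp, ?_⟩
    refine b.ext fun i => ?_
    rw [hfix i (by have := i.2; omega)]
    simp
  | succ m ih =>
    intro k hk g hg hfix
    let i₀ : Fin (finrank ℤ L) := ⟨k, by omega⟩
    have hnorm : L.realForm (g (b i₀)) (g (b i₀)) = L.realForm (b i₀) (b i₀) := hg _ _
    have horth : ∀ i : Fin (finrank ℤ L), (i : ℕ) < k →
        L.realForm (g (b i₀)) (b i) = 0 ∧ L.realForm (b i₀) (b i) = 0 := by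
      intro i hi
      have hne : i₀ ≠ i := by
        rintro rfl
        exact lt_irrefl _ hi
      have h1 := hg (b i₀) (b i)
      rw [hfix i hi, hbo _ _ hne] at h1
      exact ⟨h1, hbo _ _ hne⟩
    have step : ∀ (g : Module.End ℝ (ℝ ⊗[ℤ] L)) (v : ℝ ⊗[ℤ] L), L.realForm v v ≠ 0 →
        (∃ l : List (ℝ ⊗[ℤ] L), (∀ v ∈ l, L.realForm v v ≠ 0) ∧
          L.reflection v * g = (l.map L.reflection).prod) →
        ∃ l : List (ℝ ⊗[ℤ] L), (∀ v ∈ l, L.realForm v v ≠ 0) ∧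
          g = (l.map L.reflection).prod := by
      rintro g v hv ⟨l, hl, h⟩
      refine ⟨v :: l, ?_, ?_⟩
      · rintro w (_ | ⟨_, hw⟩)
        exacts [hv, hl w hw]
      · rw [List.map_cons, List.prod_cons, ← h, ← mul_assoc, L.reflection_mul_self hv, one_mul]
    have hlt : ∀ i : Fin (finrank ℤ L), (i : ℕ) < k + 1 → (i : ℕ) < k ∨ i = i₀ := by
      intro i hi
      rcases Nat.lt_succ_iff_lt_or_eq.1 hi with h | h
      exacts [Or.inl h, Or.inr (Fin.ext h)]
    -- The norms of `g b - b` and `g b + b` add up to four times that of `b`, so one of the two is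
    -- anisotropic. Reflecting in the first finishes; reflecting in the second gives `-b`, which
    -- reflection in `b` turns into `b`.
    by_cases h0 : L.realForm (g (b i₀) - b i₀) (g (b i₀) - b i₀) = 0
    · have h1 : L.realForm (g (b i₀) - -b i₀) (g (b i₀) - -b i₀) ≠ 0 := by
        intro h1
        apply hbb i₀
        simp only [map_sub, map_neg, LinearMap.sub_apply, LinearMap.neg_apply] at h0 h1
        linarith
      refine step _ _ h1 (step _ _ (hbb i₀) (ih (k + 1) (by omega) _ (fun x y => ?_) fun i hi => ?_))
      · simp only [Module.End.mul_apply]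
        rw [L.realForm_reflection (hbb i₀), L.realForm_reflection h1, hg]
      · simp only [Module.End.mul_apply]
        rcases hlt i hi with h | rfl
        · rw [hfix i h, L.reflection_of_orthogonal (x := b i), L.reflection_of_orthogonal]
          · exact (horth i h).2
          · simp [horth i h]
        · rw [L.reflection_sub_apply _ h1, map_neg, reflection_apply, div_mul_cancel₀ _ (hbb i₀),
            two_smul]
          · abel
          · simpa using hnorm
    · refine step _ _ h0 (ih (k + 1) (by omega) _ (fun x y => ?_) fun i hi => ?_)
      · simp only [Module.End.mul_apply]
        rw [L.realForm_reflection h0, hg]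
      · simp only [Module.End.mul_apply]
        rcases hlt i hi with h | rfl
        · rw [hfix i h, L.reflection_of_orthogonal]
          simp [horth i h]
        · exact L.reflection_sub_apply hnorm h0

/-! ### Action on functionals -/

/-- Precomposition with `g` on functionals is inverse to its action on discriminant classes. -/
lemma discMap_cl (L : EvenLattice) (g : L.O) (f : L.Dual) :
    L.discMap g (L.cl (f ∘ₗ g.1.toLinearMap)) = L.cl f := by
  refine congrArg QuotientAddGroup.mk (Subtype.ext (L.rep_unique fun v => ?_))
  change L.ratForm (L.ratMap g (L.rep (f ∘ₗ g.1.toLinearMap))) (1 ⊗ₜ v) =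
    L.ratForm (L.rep f) (1 ⊗ₜ v)
  obtain ⟨w, rfl⟩ := g.1.surjective v
  have h1 : L.ratMap g (1 ⊗ₜ w) = 1 ⊗ₜ g.1 w := by simp [ratMap]
  rw [← h1, ratForm_ratMap, h1, ratForm_rep, ratForm_rep]
  rfl

lemma mem_ker_τ (L : EvenLattice) {g : L.O} :
    g ∈ L.τ.ker ↔ ∀ f : L.Dual, L.Repr (f ∘ₗ g.1.toLinearMap - f) := by
  rw [MonoidHom.mem_ker]
  constructor
  · intro h f
    rw [← cl_eq_cl, ← L.discMap_cl g f]
    have : ∀ a, L.discMap g a = a := fun a =>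
      congrArg (fun t : L.ODisc => t.1 a) h
    rw [this]
  · intro h
    refine Subtype.ext (LinearEquiv.ext fun a => ?_)
    change L.discMap g a = a
    obtain ⟨f, rfl⟩ := L.cl_surjective a
    rw [← L.cl_eq_cl.2 (h f), discMap_cl, ← L.cl_eq_cl.2 (h f)]

/-- Minus the identity on a hyperbolic plane is a stable isometry with spinor norm `-1`. -/
theorem exists_neg_hyperbolic (L : EvenLattice) {e f : L} (he : L.form e e = 0)
    (hf : L.form f f = 0) (hef : L.form e f = 1) : ∃ δ ∈ L.τ.ker,
      (∀ x, δ.1 x = x - (2 * L.form f x) • e - (2 * L.form e x) • f) ∧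
      ∀ γ : L.O, γ ∉ L.OPlus → γ * δ ∈ L.OPlus := by
  let d : L →ₗ[ℤ] L := LinearMap.id - (2 • L.form f).smulRight e - (2 • L.form e).smulRight f
  have hd : ∀ x, d x = x - (2 * L.form f x) • e - (2 * L.form e x) • f := by
    intro x
    simp [d]
  have hfe : L.form f e = 1 := by rw [L.symm, hef]
  have hform : ∀ x y, L.form (d x) (d y) = L.form x y := by
    intro x y
    simp only [hd, map_sub, map_smul, LinearMap.sub_apply, LinearMap.smul_apply, smul_eq_mul,
      he, hf, hef, hfe, L.symm x e, L.symm x f]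
    ring
  have hdd : d ∘ₗ d = LinearMap.id := by
    refine LinearMap.ext fun x => ?_
    change d (d x) = x
    rw [hd (d x), hd x]
    simp only [map_sub, map_smul, smul_eq_mul, he, hf, hef, hfe]
    module
  let δ : L.O := ⟨LinearEquiv.ofLinearMap d d hdd hdd, hform⟩
  -- The reflecting vectors `e + f` and `e - f` are orthogonal of norms `2` and `-2`, contributing
  -- `-1` to the spinor norm.
  have hreal : L.realMap δ = L.reflection (1 ⊗ₜ (e + f)) * L.reflection (1 ⊗ₜ (e - f)) := by
    refine TensorProduct.AlgebraTensorModule.curry_injective (LinearMap.ext_ring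
      (LinearMap.ext fun x => ?_))
    change (1 : ℝ) ⊗ₜ[ℤ] d x = L.reflection (1 ⊗ₜ (e + f)) (L.reflection (1 ⊗ₜ (e - f)) (1 ⊗ₜ x))
    have h1 : L.form (e + f) (e + f) = 2 := by simp [he, hf, hef, hfe]
    have h2 : L.form (e - f) (e - f) = -2 := by simp [he, hf, hef, hfe]
    have h3 : L.form (e + f) (e - f) = 0 := by simp [he, hf, hef, hfe]
    have h4 : ∀ (n : ℤ) (y : L), (1 : ℝ) ⊗ₜ[ℤ] (n • y) = (n : ℝ) • ((1 : ℝ) ⊗ₜ[ℤ] y) := by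
      intro n y
      rw [TensorProduct.tmul_smul, Int.cast_smul_eq_zsmul]
    have h5 : ∀ p y : L, L.reflection (1 ⊗ₜ p) (1 ⊗ₜ y) =
        1 ⊗ₜ y - (2 / (L.form p p : ℝ) * L.form p y) • ((1 : ℝ) ⊗ₜ[ℤ] p) := by
      intro p y
      rw [reflection_apply, realForm_tmul, realForm_tmul, one_mul, one_mul, one_mul]
    rw [h5 (e - f) x, map_sub, map_smul, h5, h5, h1, h2, h3, hd]
    simp only [TensorProduct.tmul_sub, TensorProduct.tmul_add, h4, map_add, map_sub,
      LinearMap.add_apply, LinearMap.sub_apply]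
    push_cast
    module
  refine ⟨δ, L.mem_ker_τ.2 fun h => ⟨-(2 * h e) • f - (2 * h f) • e, fun x => ?_⟩, hd,
    fun γ hγ => ?_⟩
  · change h (d x) - h x = _
    rw [hd]
    simp only [map_sub, map_smul, LinearMap.sub_apply, LinearMap.smul_apply, smul_eq_mul]
    ring
  -- Any factorisation of `γ` into reflections has negative product here, and the two extra
  -- reflections make it positive. Independence of the spinor norm from the factorisation is not
  -- needed.
  · obtain ⟨l, hl, hp⟩ := L.exists_prod_reflection (L.realMap γ) (L.realForm_realMap γ)
    have hneg : (l.map fun v => -(L.realForm v v) / 2).prod < 0 := by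
      refine lt_of_le_of_ne (not_lt.1 fun h => hγ ⟨l, hl, hp, h⟩) ?_
      rw [Ne, List.prod_eq_zero_iff, List.mem_map]
      rintro ⟨v, hv, h0⟩
      exact hl v hv (by linarith)
    have h1 : L.realForm (1 ⊗ₜ (e + f)) (1 ⊗ₜ (e + f)) = 2 := by
      rw [realForm_tmul]
      simp [he, hf, hef, hfe]
    have h2 : L.realForm (1 ⊗ₜ (e - f)) (1 ⊗ₜ (e - f)) = -2 := by
      rw [realForm_tmul]
      simp [he, hf, hef, hfe]
    refine ⟨l ++ [1 ⊗ₜ (e + f), 1 ⊗ₜ (e - f)], ?_, ?_, ?_⟩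
    · intro v hv
      rcases List.mem_append.1 hv with hv | hv
      · exact hl v hv
      · rw [List.mem_pair] at hv
        rcases hv with rfl | rfl
        · rw [h1]; norm_num
        · rw [h2]; norm_num
    · rw [List.map_append, List.prod_append, ← hp]
      simp only [List.map_cons, List.map_nil, List.prod_cons, List.prod_nil, mul_one]
      rw [← hreal]
      exact LinearMap.baseChange_comp (δ.1 : L →ₗ[ℤ] L) (γ.1 : L →ₗ[ℤ] L)
    · rw [List.map_append, List.prod_append]
      simp only [List.map_cons, List.map_nil, List.prod_cons, List.prod_nil, mul_one, h1, h2]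
      linarith

end EvenLattice

end

noncomputable section

namespace EvenLattice

open Module

/-! ### Integrally maximal lattices -/

/-- Vectors `x / m` of the dual lattice with `(x / m)²` integral lie in the lattice. -/
def IntegrallyMaximal (L : EvenLattice) : Prop :=
  ∀ (x : L) (m : ℤ), m * m ∣ L.form x x → (∀ y, m ∣ L.form x y) → ∃ z, x = m • z

lemma Unimodular.exists_eq_smul {L : EvenLattice} (hL : L.Unimodular) {x : L} {m : ℤ}
    (h : ∀ y, m ∣ L.form x y) : ∃ z, x = m • z := by
  by_cases hm : m = 0
  · subst hm
    exact ⟨0, (L.nondeg x fun y => zero_dvd_iff.1 (h y)).trans (smul_zero _).symm⟩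
  choose c hc using h
  obtain ⟨z, hz⟩ := hL (AddMonoidHom.mk' c fun y y' => by
    refine mul_left_cancel₀ hm ?_
    rw [← hc, mul_add, ← hc, ← hc, map_add]).toIntLinearMap
  have hz : ∀ y, c y = L.form z y := hz
  refine ⟨z, sub_eq_zero.1 (L.nondeg _ fun y => ?_)⟩
  rw [map_sub, LinearMap.sub_apply, map_smul, LinearMap.smul_apply, hc, hz]
  simp

lemma IntegrallyMaximal.sum {P M : EvenLattice} (hP : P.Unimodular) (hM : M.IntegrallyMaximal) :
    (P.sum M).IntegrallyMaximal := by
  intro (x : P × M) m hxx hx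
  have hxx : m * m ∣ P.form x.1 x.1 + M.form x.2 x.2 := hxx
  have hx : ∀ y : P × M, m ∣ P.form x.1 y.1 + M.form x.2 y.2 := hx
  obtain ⟨p, hp⟩ := hP.exists_eq_smul (x := x.1) (m := m) fun y => by
    have := hx (y, 0)
    simpa using this
  have hpp : m * m ∣ P.form x.1 x.1 := by
    rw [hp]
    simp only [map_smul, LinearMap.smul_apply, smul_eq_mul, ← mul_assoc]
    exact dvd_mul_right _ _
  obtain ⟨z, hz⟩ := hM x.2 m ((dvd_add_right hpp).1 hxx) fun y => by
    have := hx (0, y)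
    simpa using this
  exact ⟨((p, z) : P × M), Prod.ext hp hz⟩

lemma IntegrallyMaximal.of_iso {L M : EvenLattice} (hL : L.IntegrallyMaximal) (φ : Iso L M) :
    M.IntegrallyMaximal := by
  intro x m hxx hx
  obtain ⟨z, hz⟩ := hL (φ.symm.e x) m (by rwa [φ.symm.map]) fun y => by
    rw [L.symm, φ.map_symm, M.symm]
    exact hx _
  refine ⟨φ.e z, ?_⟩
  rw [← map_smul, ← hz, φ.e_symm_e]

lemma IntegrallyMaximal.of_sum {P M : EvenLattice} (h : (P.sum M).IntegrallyMaximal) :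
    M.IntegrallyMaximal := by
  intro x m hxx hx
  obtain ⟨z, hz⟩ := h (inr P M x) m
    (by
      change m * m ∣ P.form 0 0 + M.form x x
      rwa [map_zero, zero_add])
    fun y => by
      change m ∣ P.form 0 _ + M.form x (snd P M y)
      rw [map_zero, LinearMap.zero_apply, zero_add]
      exact hx _
  exact ⟨snd P M z, congrArg (snd P M) hz⟩

/-- After dividing out the gcd, `m'` is coprime to `c'`, so `m'²` divides the square-free `d` and
`m'` is a unit. -/
lemma dvd_of_mul_self_dvd_mul {d m c : ℤ} (hd : Squarefree d) (h : m * m ∣ d * (c * c)) :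
    m ∣ c := by
  by_cases h0 : Int.gcd m c = 0
  · obtain ⟨rfl, rfl⟩ := Int.gcd_eq_zero_iff.1 h0
    exact dvd_rfl
  obtain ⟨g, m', c', hg, hc, hm, hc'⟩ := Int.exists_gcd_one' (Nat.pos_of_ne_zero h0)
  have hg0 : (g : ℤ) ≠ 0 := by exact_mod_cast hg.ne'
  have hco : IsCoprime m' c' := Int.isCoprime_iff_gcd_eq_one.2 hc
  have h1 : m' * m' ∣ d * (c' * c') := by
    refine Int.dvd_of_mul_dvd_mul_right (mul_ne_zero hg0 hg0) ?_
    convert h using 1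
    · rw [hm]; ring
    · rw [hc']; ring
  have h2 : IsUnit m' := hd m' ((hco.mul_left hco).mul_right (hco.mul_left hco) |>.dvd_of_dvd_mul_right h1)
  rw [hm, hc']
  exact mul_dvd_mul_right h2.dvd _

/-- The identity `-2(x, x) - (x₀ - 2x₁)² = d x₀²` turns the hypotheses into `m² ∣ d x₀²`.
Square-freeness gives `m ∣ x₀`, and pairing with the first basis vector then gives `m ∣ x₁`. -/
lemma integrallyMaximal_B (d : ℕ) (hsq : Squarefree d) (hd : d % 4 = 3) :
    (B d hd).IntegrallyMaximal := by
  intro (x : Fin 2 → ℤ) m hxx hx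
  obtain ⟨k, hk⟩ : ∃ k : ℕ, d = 4 * k + 3 := ⟨d / 4, by omega⟩
  have hk2 : ((d : ℤ) + 1) / 2 = 2 * k + 2 := by omega
  have hB : ∀ x y : Fin 2 → ℤ, (B d hd).form x y =
      -(2 * k + 2) * (x 0 * y 0) + x 0 * y 1 + x 1 * y 0 - 2 * (x 1 * y 1) := by
    intro x y
    change Matrix.toBilin' _ x y = _
    rw [Matrix.toBilin'_apply', hk2]
    simp [dotProduct, Matrix.mulVec, Fin.sum_univ_two]
    ring
  have h0 := hx (![1, 0] : Fin 2 → ℤ)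
  have h1 := hx (![0, 1] : Fin 2 → ℤ)
  replace h0 : m ∣ -(2 * k + 2) * x 0 + x 1 := by
    refine h0.trans (dvd_of_eq ((hB _ _).trans ?_))
    simp
  replace h1 : m ∣ x 0 - 2 * x 1 := by
    refine h1.trans (dvd_of_eq ((hB _ _).trans ?_))
    simp
  have hxx' : m * m ∣ -(2 * k + 2) * (x 0 * x 0) + x 0 * x 1 + x 1 * x 0 - 2 * (x 1 * x 1) :=
    hxx.trans (dvd_of_eq (hB x x))
  have h2 : m * m ∣ (d : ℤ) * (x 0 * x 0) := by
    have h3 := dvd_sub (hxx'.mul_left (-2)) (mul_dvd_mul h1 h1)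
    refine h3.trans (dvd_of_eq ?_)
    rw [hk]
    push_cast
    ring
  have h3 : m ∣ x 0 := dvd_of_mul_self_dvd_mul (Int.squarefree_natCast.2 hsq) h2
  have h4 : m ∣ x 1 := (dvd_add_right (h3.mul_left _)).1 h0
  obtain ⟨a, ha⟩ := h3
  obtain ⟨b, hb⟩ := h4
  refine ⟨(![a, b] : Fin 2 → ℤ), funext fun i => ?_⟩
  fin_cases i
  · exact ha
  · exact hb

lemma unimodular_ofGram {n : ℕ} (A : Matrix (Fin n) (Fin n) ℤ) (hA) (hdet : A.det ≠ 0)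
    (h : IsUnit A.det) : (ofGram A hA hdet).Unimodular := by
  intro f
  let f' : (Fin n → ℤ) →ₗ[ℤ] ℤ := f
  let b : Fin n → ℤ := fun j => f' (Pi.single j 1)
  refine ⟨Matrix.vecMul b A⁻¹, fun (v : Fin n → ℤ) => ?_⟩
  change f' v = Matrix.toBilin' A (Matrix.vecMul b A⁻¹) v
  rw [Matrix.toBilin'_apply', ← Matrix.dotProduct_mulVec, Matrix.mulVec_mulVec,
    Matrix.nonsing_inv_mul A h, Matrix.one_mulVec, LinearMap.pi_apply_eq_sum_univ f' v]
  simp only [dotProduct, smul_eq_mul, mul_comm (v _), b]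
  refine Finset.sum_congr rfl fun j _ => ?_
  congr 2
  ext i
  simp [Pi.single_apply, eq_comm]

lemma unimodular_E8 : Unimodular E8 :=
  unimodular_ofGram _ _ _ (by rw [Matrix.det_neg, CartanMatrix.E₈_det]; decide)

lemma integrallyMaximal_addU (d : ℕ) (hsq : Squarefree d) (hd : d % 4 = 3) :
    (addU 2 (E8E8B d hd)).IntegrallyMaximal :=
  IntegrallyMaximal.sum unimodular_U (IntegrallyMaximal.sum unimodular_U
    (IntegrallyMaximal.sum (unimodular_E8.sum unimodular_E8) (integrallyMaximal_B d hsq hd)))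

/-! ### The standard isotropic plane -/

/-- The vector of `addU 2 M` with given components. -/
def ofTriple {M : EvenLattice} (z : U × U × M) : addU 2 M := z

/-- The primitive isotropic plane spanned by the first vectors of the two hyperbolic planes. -/
def plane (M : EvenLattice) : Submodule ℤ (addU 2 M).carrier :=
  (LinearMap.ker (LinearMap.prod (x₁ ∘ₗ LinearMap.fst ℤ U (U × M))
    (LinearMap.prodMap x₁ LinearMap.id ∘ₗ LinearMap.snd ℤ U (U × M))) : Submodule ℤ (U × U × M))

lemma mem_plane {M : EvenLattice} {z : U × U × M} :
    ofTriple z ∈ plane M ↔ x₁ z.1 = 0 ∧ x₁ z.2.1 = 0 ∧ z.2.2 = 0 := by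
  change ((x₁ z.1, x₁ z.2.1, z.2.2) : ℤ × ℤ × M) = 0 ↔ _
  rw [Prod.ext_iff, Prod.ext_iff]
  rfl

/-- The first vector of the first hyperbolic plane. -/
def e₁ (M : EvenLattice) : addU 2 M := ((mkU 1 0, 0, 0) : U × U × M)

/-- The second vector of the first hyperbolic plane. -/
def f₁ (M : EvenLattice) : addU 2 M := ((mkU 0 1, 0, 0) : U × U × M)

/-- The first vector of the second hyperbolic plane. -/
def e₂ (M : EvenLattice) : addU 2 M := ((0, mkU 1 0, 0) : U × U × M)

/-- The second vector of the second hyperbolic plane. -/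
def f₂ (M : EvenLattice) : addU 2 M := ((0, mkU 0 1, 0) : U × U × M)

lemma addU_form {M : EvenLattice} (z w : U × U × M) : (addU 2 M).form z w =
    U.form z.1 w.1 + (U.form z.2.1 w.2.1 + M.form z.2.2 w.2.2) := rfl

lemma form_e₁ {M : EvenLattice} (z : U × U × M) : (addU 2 M).form (e₁ M) z = x₁ z.1 := by
  refine (addU_form _ z).trans ?_
  change U.form (mkU 1 0) z.1 + (U.form 0 _ + M.form 0 _) = _
  simp [U_form_eq]

lemma form_f₁ {M : EvenLattice} (z : U × U × M) : (addU 2 M).form (f₁ M) z = x₀ z.1 := by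
  refine (addU_form _ z).trans ?_
  change U.form (mkU 0 1) z.1 + (U.form 0 _ + M.form 0 _) = _
  simp [U_form_eq]

lemma form_e₂ {M : EvenLattice} (z : U × U × M) : (addU 2 M).form (e₂ M) z = x₁ z.2.1 := by
  refine (addU_form _ z).trans ?_
  change U.form 0 z.1 + (U.form (mkU 1 0) _ + M.form 0 _) = _
  simp [U_form_eq]

lemma form_f₂ {M : EvenLattice} (z : U × U × M) : (addU 2 M).form (f₂ M) z = x₀ z.2.1 := by
  refine (addU_form _ z).trans ?_
  change U.form 0 z.1 + (U.form (mkU 0 1) _ + M.form 0 _) = _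
  simp [U_form_eq]

lemma eq_add_add {M : EvenLattice} (z : U × U × M) (h1 : x₁ z.1 = 0) (h2 : x₁ z.2.1 = 0) :
    ofTriple z = x₀ z.1 • e₁ M + x₀ z.2.1 • e₂ M + inAddU 2 M z.2.2 := by
  refine Prod.ext (U_ext ?_ ?_) (Prod.ext (U_ext ?_ ?_) ?_)
  · change x₀ z.1 = x₀ z.1 * 1 + x₀ z.2.1 * 0 + 0
    ring
  · change x₁ z.1 = x₀ z.1 * 0 + x₀ z.2.1 * 0 + 0
    rw [h1]
    ring
  · change x₀ z.2.1 = x₀ z.1 * 0 + x₀ z.2.1 * 1 + 0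
    ring
  · change x₁ z.2.1 = x₀ z.1 * 0 + x₀ z.2.1 * 0 + 0
    rw [h2]
    ring
  · change z.2.2 = x₀ z.1 • 0 + x₀ z.2.1 • 0 + z.2.2
    simp

lemma plane_eq_span (M : EvenLattice) : plane M = Submodule.span ℤ {e₁ M, e₂ M} := by
  refine le_antisymm (fun (z : U × U × M) hz => ?_) (Submodule.span_le.2 ?_)
  · obtain ⟨h1, h2, h3⟩ := mem_plane.1 hz
    refine Submodule.mem_span_pair.2 ⟨x₀ z.1, x₀ z.2.1, ?_⟩
    refine Eq.trans ?_ (eq_add_add z h1 h2).symm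
    rw [h3, map_zero, add_zero]
  · rintro _ (rfl | rfl)
    · exact mem_plane.2 ⟨rfl, rfl, rfl⟩
    · exact mem_plane.2 ⟨rfl, rfl, rfl⟩

lemma finrank_addU_two (M : EvenLattice) : finrank ℤ (addU 2 M) = 4 + finrank ℤ M :=
  finrank_addU 2 M

/-- The standard plane as an element of `I₂`. -/
def planeI2 (M : EvenLattice) : (addU 2 M).I2 := by
  let κ : U × U × M →ₗ[ℤ] ℤ × ℤ × M := LinearMap.prod (x₁ ∘ₗ LinearMap.fst ℤ U (U × M))
    (LinearMap.prodMap x₁ LinearMap.id ∘ₗ LinearMap.snd ℤ U (U × M))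
  have hκ : Function.Surjective κ := fun z => ⟨(mkU 0 z.1, mkU 0 z.2.1, z.2.2), rfl⟩
  let ε : (addU 2 M ⧸ plane M) ≃ₗ[ℤ] ℤ × ℤ × M := κ.quotKerEquivOfSurjective hκ
  refine ⟨plane M, ?_, fun (x : U × U × M) hx (y : U × U × M) hy => ?_, Module.Free.of_equiv ε.symm⟩
  · have h1 := Submodule.finrank_quotient_add_finrank (plane M)
    rw [ε.finrank_eq, finrank_addU_two, finrank_prod, finrank_prod, finrank_self] at h1
    omega
  · obtain ⟨h1, h2, h3⟩ := mem_plane.1 hx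
    obtain ⟨h1', h2', h3'⟩ := mem_plane.1 hy
    rw [addU_form, U_form_eq, U_form_eq, h1, h2, h3, h1', h2', map_zero]
    simp

/-- Transport of primitive isotropic planes along isometries. -/
def I2.map {L M : EvenLattice} (φ : Iso L M) (S : L.I2) : M.I2 :=
  ⟨S.1.map φ.e.toLinearMap, by
    rw [← (φ.e.submoduleMap S.1).finrank_eq]
    exact S.2.1, by
    rintro _ ⟨x, hx, rfl⟩ _ ⟨y, hy, rfl⟩
    exact (φ.map x y).trans (S.2.2.1 x hx y hy), by
    have := S.2.2.2
    exact Module.Free.of_equiv (Submodule.Quotient.equiv S.1 _ φ.e rfl)⟩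

/-! ### Splitting a lattice along a primitive isotropic plane -/

/-- If `(e, L) = mℤ`, then `e/m` is a dual vector of norm `0`, hence in `L`; primitivity makes `m` a
unit. -/
lemma IntegrallyMaximal.exists_hyperbolic {L : EvenLattice} (hL : L.IntegrallyMaximal) {e : L}
    (he : L.form e e = 0) (hprim : ∀ (n : ℤ) (z : L), e = n • z → IsUnit n) :
    ∃ f, L.form f f = 0 ∧ L.form e f = 1 := by
  obtain ⟨m, hm⟩ := (IsPrincipalIdealRing.principal (LinearMap.range (L.form e))).principal
  have hdvd : ∀ y, m ∣ L.form e y := by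
    intro y
    have : L.form e y ∈ LinearMap.range (L.form e) := ⟨y, rfl⟩
    rw [hm] at this
    exact Ideal.mem_span_singleton.1 this
  obtain ⟨z, hz⟩ := hL e m (by rw [he]; exact dvd_zero _) hdvd
  have hu := hprim m z hz
  obtain ⟨y, hy⟩ : (1 : ℤ) ∈ LinearMap.range (L.form e) := by
    rw [hm]
    exact Ideal.mem_span_singleton.2 hu.dvd
  obtain ⟨k, hk, hk'⟩ := L.exists_hyperbolic_partner he hy
  exact ⟨_, hk, hk'⟩

/-- A hyperbolic plane splits off along the first basis vector of `S`. The second basis vector,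
modulo the first, is a primitive isotropic vector of the complement, which inherits maximality, so
the splitting can be repeated there. -/
theorem IntegrallyMaximal.exists_iso_addU {L : EvenLattice} (hL : L.IntegrallyMaximal)
    (S : L.I2) : ∃ (M : EvenLattice) (φ : Iso (addU 2 M) L), I2.map φ (planeI2 M) = S := by
  obtain ⟨S, hrank, hiso, hfree⟩ := S
  let b : Basis (Fin 2) ℤ S := finBasisOfFinrankEq ℤ S hrank
  have hsat : ∀ (n : ℤ) (z : L), n ≠ 0 → n • z ∈ S → z ∈ S := by
    intro n z hn hz
    rw [← Submodule.Quotient.mk_eq_zero] at hz ⊢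
    rw [Submodule.Quotient.mk_smul] at hz
    exact (smul_eq_zero.1 hz).resolve_left hn
  have hspan : ∀ x ∈ S, ∃ p q : ℤ, x = p • (b 0 : L) + q • (b 1 : L) := by
    intro x hx
    refine ⟨b.repr ⟨x, hx⟩ 0, b.repr ⟨x, hx⟩ 1, ?_⟩
    have := congrArg Subtype.val (b.sum_repr ⟨x, hx⟩)
    rw [Fin.sum_univ_two] at this
    exact this.symm
  have hind : ∀ p q p' q' : ℤ, p • (b 0 : L) + q • (b 1 : L) = p' • (b 0 : L) + q' • (b 1 : L) →
      p = p' ∧ q = q' := by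
    intro p q p' q' h
    have h1 : p • b 0 + q • b 1 = p' • b 0 + q' • b 1 := Subtype.ext h
    have h2 := congrArg (b.repr · 0) h1
    have h3 := congrArg (b.repr · 1) h1
    simp at h2 h3
    exact ⟨h2, h3⟩
  obtain ⟨f, hf, hef⟩ := hL.exists_hyperbolic (hiso _ (b 0).2 _ (b 0).2) fun n z h => by
    have hn : n ≠ 0 := by
      rintro rfl
      have := hind 1 0 0 0 (by rw [one_smul, h]; simp)
      omega
    obtain ⟨p, q, hz⟩ := hspan z (hsat n z hn (by rw [← h]; exact (b 0).2))
    have := hind 1 0 (n * p) (n * q) (by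
      rw [mul_smul, mul_smul, ← smul_add, ← hz, ← h, one_smul, zero_smul, add_zero])
    exact IsUnit.of_mul_eq_one p this.1.symm
  obtain ⟨L₁, φ, hφe, hφf⟩ := L.exists_split (hiso _ (b 0).2 _ (b 0).2) hf hef
  have hφe : φ.e (inl U L₁ (mkU 1 0)) = b 0 := hφe
  let z : U × L₁ := φ.symm.e (b 1)
  have hz1 : x₁ z.1 = 0 := by
    have h1 := hiso _ (b 0).2 _ (b 1).2
    rw [← hφe, ← φ.e_symm_e (b 1 : L), φ.map] at h1
    refine Eq.trans ?_ h1
    change _ = U.form (mkU 1 0) z.1 + L₁.form 0 z.2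
    rw [U_form_eq]
    simp
  have hz : φ.e (inr U L₁ z.2) = (b 1 : L) - x₀ z.1 • (b 0 : L) := by
    rw [← hφe, ← φ.e_symm_e (b 1 : L), ← map_smul, ← map_sub]
    refine congrArg φ.e (Prod.ext (U_ext ?_ ?_) ?_)
    · change (0 : ℤ) = x₀ z.1 - x₀ z.1 * 1
      ring
    · change (0 : ℤ) = x₁ z.1 - x₀ z.1 * 0
      rw [hz1]
      ring
    · change z.2 = z.2 - x₀ z.1 • 0
      simp
  have hzS : φ.e (inr U L₁ z.2) ∈ S := by
    rw [hz]
    exact S.sub_mem (b 1).2 (S.smul_mem _ (b 0).2)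
  have hzz : L₁.form z.2 z.2 = 0 := by
    have h1 := hiso _ hzS _ hzS
    rw [φ.map] at h1
    refine Eq.trans ?_ h1
    change _ = U.form 0 0 + L₁.form z.2 z.2
    rw [map_zero]
    exact (zero_add _).symm
  have hL₁ : L₁.IntegrallyMaximal := (hL.of_iso φ.symm).of_sum
  obtain ⟨f', hf', hef'⟩ := hL₁.exists_hyperbolic hzz fun n w h => by
    have h1 : (b 1 : L) - x₀ z.1 • (b 0 : L) = n • φ.e (inr U L₁ w) := by
      rw [← hz, h, map_smul, map_smul]
    have hn : n ≠ 0 := by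
      rintro rfl
      rw [zero_smul, sub_eq_zero] at h1
      have := hind 0 1 (x₀ z.1) 0 (by rw [one_smul, h1]; simp)
      omega
    obtain ⟨p, q, hw⟩ := hspan _ (hsat n _ hn (by
      rw [← h1]
      exact S.sub_mem (b 1).2 (S.smul_mem _ (b 0).2)))
    have := hind (-x₀ z.1) 1 (n * p) (n * q) (by
      rw [mul_smul, mul_smul, ← smul_add, ← hw, ← h1, one_smul, neg_smul]
      abel)
    exact IsUnit.of_mul_eq_one q this.2.symm
  obtain ⟨M, χ, hχe, hχf⟩ := L₁.exists_split hzz hf' hef'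
  let Θ : Iso (addU 2 M) L := ((Iso.refl U).sumCongr χ).trans φ
  have hΘ1 : Θ.e (e₁ M) = b 0 := by
    rw [← hφe]
    exact congrArg φ.e (Prod.ext rfl (map_zero χ.e))
  have hΘ2 : Θ.e (e₂ M) = (b 1 : L) - x₀ z.1 • (b 0 : L) := by
    rw [← hz]
    exact congrArg φ.e (Prod.ext rfl hχe)
  refine ⟨M, Θ, Subtype.ext ?_⟩
  change (plane M).map Θ.e.toLinearMap = S
  rw [plane_eq_span, Submodule.map_span, Set.image_pair]
  refine le_antisymm (Submodule.span_le.2 ?_) fun x hx => ?_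
  · rintro _ (rfl | rfl)
    · exact (congrArg (· ∈ S) hΘ1).mpr (b 0).2
    · exact (congrArg (· ∈ S) hΘ2).mpr (S.sub_mem (b 1).2 (S.smul_mem _ (b 0).2))
  · obtain ⟨p, q, rfl⟩ := hspan x hx
    -- The coefficient `q * x₀ z.1` compensates for the second generator being `b 1 - x₀ z.1 • b 0`.
    refine Submodule.mem_span_pair.2 ⟨p + q * x₀ z.1, q, ?_⟩
    change _ • Θ.e (e₁ M) + _ • Θ.e (e₂ M) = _
    rw [hΘ1, hΘ2]
    module

/-! ### Embeddings with unimodular complement -/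

/-- An embedding of lattices with unimodular orthogonal complement: a linear map with an adjoint
left inverse, such that every functional is determined up to a representable one by its
restriction. -/
structure UEmb (M L : EvenLattice) where
  i : M →ₗ[ℤ] L
  r : L →ₗ[ℤ] M
  adj : ∀ x y, L.form (i x) y = M.form x (r y)
  left_inv : ∀ x, r (i x) = x
  repr : ∀ f : L.Dual, L.Repr (f - (f ∘ₗ i) ∘ₗ r)

namespace UEmb

variable {P L M : EvenLattice}

/-- An isometry, as an embedding. -/
def ofIso (φ : Iso M L) : UEmb M L where
  i := φ.e.toLinearMap
  r := φ.symm.e.toLinearMap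
  adj x y := (φ.map_symm x y).symm
  left_inv := φ.symm_e_e
  repr f := ⟨0, fun v => by simp⟩

/-- The inclusion of an orthogonal summand with unimodular complement. -/
def inr (hP : P.Unimodular) (M : EvenLattice) : UEmb M (P.sum M) where
  i := EvenLattice.inr P M
  r := snd P M
  adj x y := by
    change P.form 0 _ + _ = _
    rw [map_zero]
    exact zero_add _
  left_inv _ := rfl
  repr f := Repr.of_inr hP ⟨0, fun v => by
    rw [map_zero]
    exact sub_self (f (EvenLattice.inr P M v))⟩

/-- Composition of embeddings. -/
def trans (α : UEmb P M) (β : UEmb M L) : UEmb P L where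
  i := β.i ∘ₗ α.i
  r := α.r ∘ₗ β.r
  adj x y := by rw [LinearMap.comp_apply, β.adj, α.adj]; rfl
  left_inv x := by
    rw [LinearMap.comp_apply, LinearMap.comp_apply, β.left_inv, α.left_inv]
  repr f := by
    obtain ⟨z, hz⟩ := α.repr (f ∘ₗ β.i)
    obtain ⟨w, hw⟩ := β.repr f
    refine ⟨β.i z + w, fun v => ?_⟩
    rw [map_add, LinearMap.add_apply, β.adj, ← hz, ← hw]
    simp

lemma repr_comp_i (α : UEmb M L) {f : L.Dual} (hf : L.Repr f) : M.Repr (f ∘ₗ α.i) := by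
  obtain ⟨z, hz⟩ := hf
  refine ⟨α.r z, fun v => ?_⟩
  rw [M.symm, ← α.adj, L.symm, ← hz]
  rfl

lemma repr_comp_r (α : UEmb M L) {g : M.Dual} (hg : M.Repr g) : L.Repr (g ∘ₗ α.r) := by
  obtain ⟨z, hz⟩ := hg
  exact ⟨α.i z, fun v => by rw [α.adj, ← hz]; rfl⟩

end UEmb

/-- Maps of functionals preserving representability descend to discriminant groups. -/
lemma exists_disc_hom {L M : EvenLattice} (R : L.Dual →+ M.Dual)
    (hR : ∀ f, L.Repr f → M.Repr (R f)) :
    ∃ ρ : L.Disc →+ M.Disc, ∀ f, ρ (L.cl f) = M.cl (R f) := by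
  refine ⟨L.cl.liftOfSurjective L.cl_surjective ⟨M.cl.comp R, fun f hf => ?_⟩, fun f => ?_⟩
  · exact M.cl_eq_zero.2 (hR f (L.cl_eq_zero.1 hf))
  · exact L.cl.liftOfRightInverse_comp_apply _ _ ⟨M.cl.comp R, _⟩ f

/-- Restriction along `i` and composition with the adjoint `r` are inverse on classes because the
complement is unimodular. The base change of `i` is a rational isometry matching the
representatives, so the forms agree. -/
lemma UEmb.exists_disc {M L : EvenLattice} (α : UEmb M L) : ∃ ρ : L.Disc ≃+ M.Disc,
    (∀ f, ρ (L.cl f) = M.cl (f ∘ₗ α.i)) ∧ ∀ a, M.discForm (ρ a) = L.discForm a := by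
  obtain ⟨ρ, hρ⟩ := exists_disc_hom (L := L) (M := M)
    (AddMonoidHom.mk' (fun f => f ∘ₗ α.i) fun f g => rfl) fun f hf => α.repr_comp_i hf
  obtain ⟨σ, hσ⟩ := exists_disc_hom (L := M) (M := L)
    (AddMonoidHom.mk' (fun f => f ∘ₗ α.r) fun f g => rfl) fun f hf => α.repr_comp_r hf
  have hρ : ∀ f, ρ (L.cl f) = M.cl (f ∘ₗ α.i) := hρ
  have hσ : ∀ g, σ (M.cl g) = L.cl (g ∘ₗ α.r) := hσ
  have h1 : ∀ a, σ (ρ a) = a := by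
    intro a
    obtain ⟨f, rfl⟩ := L.cl_surjective a
    rw [hρ, hσ, eq_comm, cl_eq_cl]
    exact α.repr f
  have h2 : ∀ a, ρ (σ a) = a := by
    intro a
    obtain ⟨g, rfl⟩ := M.cl_surjective a
    rw [hσ, hρ]
    congr 1
    exact LinearMap.ext fun x => congrArg g (α.left_inv x)
  refine ⟨{ ρ with invFun := σ, left_inv := h1, right_inv := h2 }, hρ, fun a => ?_⟩
  change M.discForm (ρ a) = _
  conv_rhs => rw [← h1 a]
  obtain ⟨g, hg⟩ := M.cl_surjective (ρ a)
  rw [← hg, hσ, discForm_cl, discForm_cl]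
  let j : ℚ ⊗[ℤ] M →ₗ[ℚ] ℚ ⊗[ℤ] L := α.i.baseChange ℚ
  have hj : ∀ (x : ℚ ⊗[ℤ] M) (v : L), L.ratForm (j x) (1 ⊗ₜ v) = M.ratForm x (1 ⊗ₜ α.r v) := by
    intro x v
    induction x with
    | zero => simp
    | add x y hx hy => rw [map_add, map_add, map_add, LinearMap.add_apply, LinearMap.add_apply, hx, hy]
    | tmul c m =>
      change L.ratForm (c ⊗ₜ α.i m) _ = _
      rw [ratForm_tmul, ratForm_tmul, α.adj]
  have hjj : ∀ x y, L.ratForm (j x) (j y) = M.ratForm x y := by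
    intro x y
    induction y with
    | zero => simp
    | add y z hy hz => rw [map_add, map_add, map_add, hy, hz]
    | tmul c m =>
      have e1 : c ⊗ₜ[ℤ] m = c • ((1 : ℚ) ⊗ₜ[ℤ] m) := by
        rw [TensorProduct.smul_tmul', smul_eq_mul, mul_one]
      rw [e1, map_smul, map_smul, map_smul]
      congr 1
      change L.ratForm (j x) (1 ⊗ₜ α.i m) = _
      rw [hj, α.left_inv]
  have hrep : L.rep (g ∘ₗ α.r) = j (M.rep g) := L.rep_unique fun v => by
    rw [hj, ratForm_rep, ratForm_rep]
    rfl
  rw [hrep, hjj]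

end EvenLattice

end

noncomputable section

namespace EvenLattice

open Module

/-! ### Labels of isometries -/

/-- The isomorphism of discriminant groups given by an embedding with unimodular complement. -/
def UEmb.disc {M L : EvenLattice} (α : UEmb M L) : L.Disc ≃+ M.Disc := α.exists_disc.choose

lemma UEmb.disc_cl {M L : EvenLattice} (α : UEmb M L) (f : L.Dual) :
    α.disc (L.cl f) = M.cl (f ∘ₗ α.i) := α.exists_disc.choose_spec.1 f

lemma UEmb.discForm_disc {M L : EvenLattice} (α : UEmb M L) (a : L.Disc) :
    M.discForm (α.disc a) = L.discForm a := α.exists_disc.choose_spec.2 a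

/-- The inclusion of `E` into a lattice isometric to `addU 2 E`. -/
def emb {E L : EvenLattice} (φ : Iso (addU 2 E) L) : UEmb E L :=
  ((UEmb.inr unimodular_U E).trans (UEmb.inr unimodular_U (U.sum E))).trans (UEmb.ofIso φ)

/-- An element of the orthogonal group as an isometry. -/
def O.iso {L : EvenLattice} (g : L.O) : Iso L L := ⟨g.1, g.2⟩

/-- The extension of an isometry of `E` to `addU 2 E`. -/
def extend {E : EvenLattice} (h : E.O) : Iso (addU 2 E) (addU 2 E) :=
  (Iso.refl U).sumCongr ((Iso.refl U).sumCongr (O.iso h))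

/-- The extension fixes the two vectors spanning the plane. This is why a plane determines its label
only modulo `Im τ`. -/
lemma I2.map_extend {E L : EvenLattice} (h : E.O) (φ : Iso (addU 2 E) L) :
    I2.map ((extend h).trans φ) (planeI2 E) = I2.map φ (planeI2 E) := by
  have h1 : (extend h).e (e₁ E) = e₁ E :=
    Prod.ext rfl (Prod.ext rfl (map_zero h.1))
  have h2 : (extend h).e (e₂ E) = e₂ E :=
    Prod.ext rfl (Prod.ext rfl (map_zero h.1))
  refine Subtype.ext ?_
  change (plane E).map ((extend h).trans φ).e.toLinearMap = (plane E).map φ.e.toLinearMap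
  rw [plane_eq_span, Submodule.map_span, Submodule.map_span, Set.image_pair, Set.image_pair]
  change Submodule.span ℤ {φ.e ((extend h).e (e₁ E)), φ.e ((extend h).e (e₂ E))} = _
  rw [h1, h2]
  rfl

section Label

variable {E K L : EvenLattice} (ψ : E.Disc ≃+ K.Disc) (hψ : ∀ a, K.discForm (ψ a) = E.discForm a)
  (κ : Iso (addU 2 K) L)

/-- The element of `O(A_E)` attached to an isometry `addU 2 E ≅ L`, relative to a fixed isometry
`addU 2 K ≅ L` and a fixed isomorphism of discriminant forms of `E` and `K`. -/
def label (φ : Iso (addU 2 E) L) : E.ODisc :=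
  ⟨((emb φ).disc.symm.trans ((emb κ).disc.trans ψ.symm)).toIntLinearEquiv, fun a => by
    change E.discForm (ψ.symm ((emb κ).disc ((emb φ).disc.symm a))) = _
    rw [← hψ, ψ.apply_symm_apply, UEmb.discForm_disc, ← UEmb.discForm_disc (emb φ),
      AddEquiv.apply_symm_apply]⟩

lemma label_apply (φ : Iso (addU 2 E) L) (a : L.Disc) :
    (label ψ hψ κ φ).1 ((emb φ).disc a) = ψ.symm ((emb κ).disc a) := by
  change ψ.symm ((emb κ).disc ((emb φ).disc.symm ((emb φ).disc a))) = _
  rw [AddEquiv.symm_apply_apply]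

/-- Labels are compared by restricting one functional on `L` to `E` and to `K`. -/
lemma label_eq_iff (φ : Iso (addU 2 E) L) (l : E.ODisc) :
    label ψ hψ κ φ = l ↔ ∀ f : L.Dual,
      l.1 (E.cl (f ∘ₗ (emb φ).i)) = ψ.symm (K.cl (f ∘ₗ (emb κ).i)) := by
  constructor
  · rintro rfl f
    rw [← UEmb.disc_cl, ← UEmb.disc_cl, label_apply]
  · intro h
    refine Subtype.ext (LinearEquiv.ext fun a => ?_)
    obtain ⟨b, rfl⟩ := (emb φ).disc.surjective a
    obtain ⟨f, rfl⟩ := L.cl_surjective b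
    rw [label_apply, UEmb.disc_cl, UEmb.disc_cl, h]

lemma label_extend (h : E.O) (φ : Iso (addU 2 E) L) :
    label ψ hψ κ ((extend h).trans φ) = label ψ hψ κ φ * E.τ h := by
  rw [label_eq_iff]
  intro f
  have h1 : f ∘ₗ (emb ((extend h).trans φ)).i = (f ∘ₗ (emb φ).i) ∘ₗ h.1.toLinearMap := rfl
  rw [h1]
  change (label ψ hψ κ φ).1 (E.discMap h (E.cl _)) = _
  rw [discMap_cl]
  exact (label_eq_iff ψ hψ κ φ _).1 rfl f

/-- Every element of `O(A_E)` is a label. -/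
lemma exists_label_eq (hp : E.sigPos = K.sigPos) (hn : E.sigNeg = K.sigNeg) (l : E.ODisc) :
    ∃ φ : Iso (addU 2 E) L, label ψ hψ κ φ = l := by
  let ψ' : E.Disc ≃+ K.Disc := l.1.toAddEquiv.trans ψ
  have hψ' : ∀ a, ψ' a = ψ (l.1 a) := fun a => rfl
  -- The isomorphism to be realised is `ψ ∘ l`; composing with `κ` then produces the label `l`.
  obtain ⟨χ, hχ⟩ := exists_iso_addU_two hp hn ψ'.toAddMonoidHom
    (fun a => (hψ _).trans (l.2 a)) ψ'.bijective
  refine ⟨χ.trans κ, (label_eq_iff ψ hψ κ _ _).2 fun f => ?_⟩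
  rw [AddEquiv.eq_symm_apply, ← hψ']
  let g : (addU 2 K).Dual := f ∘ₗ κ.e.toLinearMap
  obtain ⟨a, ha⟩ := ψ'.surjective (K.cl (g ∘ₗ inAddU 2 K))
  obtain ⟨b, rfl⟩ := (emb (Iso.refl (addU 2 E))).disc.surjective a
  obtain ⟨f', rfl⟩ := (addU 2 E).cl_surjective b
  rw [UEmb.disc_cl] at ha
  have h1 := hχ f' g ha
  have h2 := (emb (Iso.refl (addU 2 E))).repr_comp_i h1
  have h3 : E.cl (f ∘ₗ (emb (χ.trans κ)).i) = E.cl (f' ∘ₗ (emb (Iso.refl (addU 2 E))).i) :=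
    E.cl_eq_cl.2 h2
  rw [h3, ha]
  rfl

/-- Planes given by isometries with equal labels are equivalent under the stable group. -/
lemma exists_stableOPlus_of_label_eq {φ φ' : Iso (addU 2 E) L}
    (h : label ψ hψ κ φ = label ψ hψ κ φ') : ∃ γ ∈ L.stableOPlus,
      (I2.map φ (planeI2 E)).1.map (γ.1 : L →ₗ[ℤ] L) = (I2.map φ' (planeI2 E)).1 := by
  let χ := φ.symm.trans φ'
  let γ : L.O := ⟨χ.e, χ.map⟩
  have hγ : γ ∈ L.τ.ker := by
    refine L.mem_ker_τ.2 fun f => L.cl_eq_cl.1 ((emb φ).disc.injective ?_)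
    have h1 : (f ∘ₗ γ.1.toLinearMap) ∘ₗ (emb φ).i = f ∘ₗ (emb φ').i :=
      LinearMap.ext fun x => congrArg (fun z => f (φ'.e z)) (φ.symm_e_e (inAddU 2 E x))
    rw [UEmb.disc_cl, UEmb.disc_cl, h1]
    have h2 := (label_eq_iff ψ hψ κ φ' _).1 rfl f
    have h3 := (label_eq_iff ψ hψ κ φ _).1 rfl f
    rw [h, ← h2] at h3
    exact ((label ψ hψ κ φ').1.injective h3).symm
  have hmap : (I2.map φ (planeI2 E)).1.map (γ.1 : L →ₗ[ℤ] L) = (I2.map φ' (planeI2 E)).1 := by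
    change ((plane E).map φ.e.toLinearMap).map χ.e.toLinearMap = (plane E).map φ'.e.toLinearMap
    rw [← Submodule.map_comp]
    congr 1
    exact LinearMap.ext fun x => congrArg φ'.e (φ.symm_e_e x)
  by_cases hs : γ ∈ L.OPlus
  · exact ⟨γ, ⟨hγ, hs⟩, hmap⟩
  -- If the spinor norm is wrong, precompose with `-1` on the plane of `φ(e₁)` and `φ(f₁)`. This
  -- negates `φ(e₁)` and fixes `φ(e₂)`, so the isotropic plane is preserved.
  obtain ⟨δ, hδ, hδe, hδγ⟩ := L.exists_neg_hyperbolic (e := φ.e (e₁ E)) (f := φ.e (f₁ E))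
    (by rw [φ.map]; exact form_e₁ _) (by rw [φ.map]; exact form_f₁ _)
    (by rw [φ.map]; exact form_e₁ _)
  refine ⟨γ * δ, ⟨mul_mem hγ hδ, hδγ γ hs⟩, ?_⟩
  refine Eq.trans ?_ hmap
  have h1 : δ.1 (φ.e (e₁ E)) = -φ.e (e₁ E) := by
    have e1 : (addU 2 E).form (f₁ E) (e₁ E) = 1 := form_f₁ _
    have e2 : (addU 2 E).form (e₁ E) (e₁ E) = 0 := form_e₁ _
    rw [hδe, φ.map, φ.map, e1, e2]
    module
  have h2 : δ.1 (φ.e (e₂ E)) = φ.e (e₂ E) := by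
    have e1 : (addU 2 E).form (f₁ E) (e₂ E) = 0 := form_f₁ _
    have e2 : (addU 2 E).form (e₁ E) (e₂ E) = 0 := form_e₁ _
    rw [hδe, φ.map, φ.map, e1, e2]
    module
  have h3 : ((I2.map φ (planeI2 E)).1).map (δ.1 : L →ₗ[ℤ] L) = (I2.map φ (planeI2 E)).1 := by
    change ((plane E).map φ.e.toLinearMap).map (δ.1 : L →ₗ[ℤ] L) = (plane E).map φ.e.toLinearMap
    rw [plane_eq_span, Submodule.map_span, Submodule.map_span, Set.image_pair, Set.image_pair]
    change Submodule.span ℤ {δ.1 (φ.e (e₁ E)), δ.1 (φ.e (e₂ E))} =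
      Submodule.span ℤ {φ.e (e₁ E), φ.e (e₂ E)}
    rw [h1, h2, Submodule.span_insert, Submodule.span_insert]
    congr 1
    rw [← Set.neg_singleton, Submodule.span_neg]
  change (I2.map φ (planeI2 E)).1.map ((γ.1 : L →ₗ[ℤ] L) ∘ₗ (δ.1 : L →ₗ[ℤ] L)) = _
  rw [Submodule.map_comp, h3]

end Label

/-! ### Isometries preserving the standard plane -/

section Perp

variable {E E' L : EvenLattice}

/-- `E` is orthogonal to `plane E`, so its image is orthogonal to `e₁` and `e₂`, and pairing with
these reads off the `x₁`-coordinates. -/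
lemma apply_inAddU {χ : Iso (addU 2 E) (addU 2 E')}
    (h : (plane E).map χ.e.toLinearMap = plane E') (x : E) :
    x₁ (Prod.fst (show U × U × E' from χ.e (inAddU 2 E x))) = 0 ∧
      x₁ (Prod.fst (Prod.snd (show U × U × E' from χ.e (inAddU 2 E x)))) = 0 := by
  have key : ∀ z ∈ plane E', (addU 2 E').form z (χ.e (inAddU 2 E x)) = 0 := by
    intro z hz
    rw [← h] at hz
    obtain ⟨w, hw, rfl⟩ := hz
    refine (χ.map _ _).trans ?_
    obtain ⟨h1, h2, h3⟩ := mem_plane.1 hw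
    refine (addU_form w (inAddU 2 E x)).trans ?_
    change U.form _ 0 + (U.form _ 0 + E.form _ x) = 0
    rw [h3, map_zero, map_zero]
    simp
  constructor
  · rw [← form_e₁]
    exact key _ (mem_plane.2 ⟨rfl, rfl, rfl⟩)
  · rw [← form_e₂]
    exact key _ (mem_plane.2 ⟨rfl, rfl, rfl⟩)

/-- The projection onto the last summand. -/
def proj (E : EvenLattice) : addU 2 E →ₗ[ℤ] E := snd U E ∘ₗ snd U (U.sum E)

lemma exists_eq_add {χ : Iso (addU 2 E) (addU 2 E')}
    (h : (plane E).map χ.e.toLinearMap = plane E') (x : E) :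
    ∃ s ∈ plane E', χ.e (inAddU 2 E x) = s + inAddU 2 E' (proj E' (χ.e (inAddU 2 E x))) := by
  obtain ⟨h1, h2⟩ := apply_inAddU h x
  refine ⟨_, ?_, eq_add_add _ h1 h2⟩
  rw [plane_eq_span]
  exact Submodule.mem_span_pair.2 ⟨_, _, rfl⟩

lemma proj_plane {s : addU 2 E} (hs : s ∈ plane E) : proj E s = 0 := (mem_plane.1 hs).2.2

lemma proj_inAddU (x : E) : proj E (inAddU 2 E x) = x := rfl

lemma form_add_plane {s t : addU 2 E} (hs : s ∈ plane E) (ht : t ∈ plane E) (x y : E) :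
    (addU 2 E).form (s + inAddU 2 E x) (t + inAddU 2 E y) = E.form x y := by
  have h1 : (addU 2 E).form s t = 0 := (planeI2 E).2.2.1 s hs t ht
  have h2 : ∀ s ∈ plane E, ∀ y, (addU 2 E).form s (inAddU 2 E y) = 0 := by
    intro s hs y
    rw [plane_eq_span] at hs
    obtain ⟨a, b, rfl⟩ := Submodule.mem_span_pair.1 hs
    have e1 : (addU 2 E).form (e₁ E) (inAddU 2 E y) = 0 := form_e₁ _
    have e2 : (addU 2 E).form (e₂ E) (inAddU 2 E y) = 0 := form_e₂ _
    simp [e1, e2]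
  have h3 : (addU 2 E).form (inAddU 2 E x) (inAddU 2 E y) = E.form x y := by
    refine (addU_form _ _).trans ?_
    change U.form 0 0 + (U.form 0 0 + E.form x y) = _
    simp
  simp only [map_add, LinearMap.add_apply, h1, h2 s hs, (addU 2 E).symm (inAddU 2 E x) t, h2 t ht,
    h3]
  ring

/-- An isometry preserving the standard planes induces an isometry of the quotients of their
orthogonal complements. -/
lemma exists_iso_of_plane (χ : Iso (addU 2 E) (addU 2 E'))
    (h : (plane E).map χ.e.toLinearMap = plane E') :
    ∃ η : Iso E E', ∀ x, ∃ s ∈ plane E', χ.e (inAddU 2 E x) = s + inAddU 2 E' (η.e x) := by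
  have h' : (plane E').map χ.symm.e.toLinearMap = plane E := by
    rw [← h, ← Submodule.map_comp]
    convert Submodule.map_id _
    exact LinearMap.ext fun x => χ.symm_e_e x
  refine ⟨Iso.ofSurjective (proj E' ∘ₗ χ.e.toLinearMap ∘ₗ inAddU 2 E) (fun x y => ?_) (fun y => ?_),
    exists_eq_add h⟩
  · obtain ⟨s, hs, hx⟩ := exists_eq_add h x
    obtain ⟨t, ht, hy⟩ := exists_eq_add h y
    change E'.form (proj E' (χ.e (inAddU 2 E x))) (proj E' (χ.e (inAddU 2 E y))) = _
    rw [← form_add_plane hs ht, ← hx, ← hy, χ.map]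
    have := form_add_plane (E := E) (zero_mem _) (zero_mem _) x y
    rwa [zero_add, zero_add] at this
  · obtain ⟨s, hs, hy⟩ := exists_eq_add h' y
    refine ⟨proj E (χ.symm.e (inAddU 2 E' y)), ?_⟩
    change proj E' (χ.e (inAddU 2 E (proj E (χ.symm.e (inAddU 2 E' y))))) = y
    have h1 : χ.e s ∈ plane E' := by
      rw [← h]
      exact ⟨s, hs, rfl⟩
    have h2 := congrArg (fun z => proj E' (χ.e z)) hy
    simp only [map_add, χ.e_symm_e, proj_plane h1, zero_add] at h2
    exact h2.symm

/-- The plane component of `χ x` has coefficients equal to its pairings with `f₁` and `f₂`, which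
are representable functionals of `x`. Hence `χ` and `η` act compatibly on discriminant classes. -/
lemma repr_comp_of_plane {χ : Iso (addU 2 E) (addU 2 E)} {η : Iso E E}
    (hη : ∀ x, ∃ s ∈ plane E, χ.e (inAddU 2 E x) = s + inAddU 2 E (η.e x)) (f : (addU 2 E).Dual) :
    E.Repr (f ∘ₗ χ.e.toLinearMap ∘ₗ inAddU 2 E - (f ∘ₗ inAddU 2 E) ∘ₗ η.e.toLinearMap) := by
  have hr : ∀ w : addU 2 E, E.Repr ((addU 2 E).form w ∘ₗ χ.e.toLinearMap ∘ₗ inAddU 2 E) := by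
    intro w
    refine (emb χ).repr_comp_i (f := (addU 2 E).form w) ⟨w, fun v => rfl⟩
  obtain ⟨a, ha⟩ := hr (f₁ E)
  obtain ⟨b, hb⟩ := hr (f₂ E)
  have ha : ∀ x, (addU 2 E).form (f₁ E) (χ.e (inAddU 2 E x)) = E.form a x := ha
  have hb : ∀ x, (addU 2 E).form (f₂ E) (χ.e (inAddU 2 E x)) = E.form b x := hb
  refine ⟨f (e₁ E) • a + f (e₂ E) • b, fun x => ?_⟩
  obtain ⟨s, hs, hx⟩ := hη x
  rw [plane_eq_span] at hs
  obtain ⟨p, q, rfl⟩ := Submodule.mem_span_pair.1 hs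
  have e11 : (addU 2 E).form (f₁ E) (e₁ E) = 1 := form_f₁ _
  have e12 : (addU 2 E).form (f₁ E) (e₂ E) = 0 := form_f₁ _
  have e21 : (addU 2 E).form (f₂ E) (e₁ E) = 0 := form_f₂ _
  have e22 : (addU 2 E).form (f₂ E) (e₂ E) = 1 := form_f₂ _
  have e1 : (addU 2 E).form (f₁ E) (inAddU 2 E (η.e x)) = 0 := form_f₁ _
  have e2 : (addU 2 E).form (f₂ E) (inAddU 2 E (η.e x)) = 0 := form_f₂ _
  have hp : p = E.form a x := by
    rw [← ha, hx]
    simp [e11, e12, e1]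
  have hq : q = E.form b x := by
    rw [← hb, hx]
    simp [e21, e22, e2]
  change f (χ.e (inAddU 2 E x)) - f (inAddU 2 E (η.e x)) = _
  rw [hx]
  simp only [map_add, map_smul, LinearMap.add_apply, LinearMap.smul_apply, smul_eq_mul, ← hp, ← hq]
  ring

/-- `S^⊥ / S` for a plane given by an isometry with `addU 2 E`. -/
lemma perpQuotientIsometric (φ : Iso (addU 2 E) L) :
    (I2.map φ (planeI2 E)).PerpQuotientIsometric E := by
  let S : Submodule ℤ L := (plane E).map φ.e.toLinearMap
  let T : Submodule ℤ L := L.form.orthogonal S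
  have hT : ∀ x ∈ T, ∃ s ∈ plane E, φ.symm.e x = s + inAddU 2 E (proj E (φ.symm.e x)) := by
    intro x hx
    have h1 : ∀ w ∈ plane E, (addU 2 E).form w (φ.symm.e x) = 0 := by
      intro w hw
      rw [φ.map_symm]
      exact hx _ ⟨w, hw, rfl⟩
    refine ⟨_, ?_, eq_add_add (φ.symm.e x)
      ((form_e₁ _).symm.trans (h1 _ (mem_plane.2 ⟨rfl, rfl, rfl⟩)))
      ((form_e₂ _).symm.trans (h1 _ (mem_plane.2 ⟨rfl, rfl, rfl⟩)))⟩
    rw [plane_eq_span]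
    exact Submodule.mem_span_pair.2 ⟨_, _, rfl⟩
  have hin : ∀ (s) (_ : s ∈ plane E) (y : E), φ.e (s + inAddU 2 E y) ∈ T := by
    rintro s hs y _ ⟨w, hw, rfl⟩
    refine (φ.map _ _).trans ?_
    have := form_add_plane hw hs 0 y
    rwa [map_zero, add_zero, map_zero, LinearMap.zero_apply] at this
  let p : T →ₗ[ℤ] E := proj E ∘ₗ φ.symm.e.toLinearMap ∘ₗ T.subtype
  have hp : ∀ x : T, p x = proj E (φ.symm.e x) := fun _ => rfl
  have hsurj : Function.Surjective p := by
    intro y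
    refine ⟨⟨φ.e (0 + inAddU 2 E y), hin 0 (zero_mem _) y⟩, ?_⟩
    rw [hp, φ.symm_e_e, zero_add, proj_inAddU]
  have hker : S.submoduleOf T = LinearMap.ker p := by
    ext x
    rw [Submodule.submoduleOf, Submodule.mem_comap, LinearMap.mem_ker, hp]
    constructor
    · rintro ⟨s, hs, hx⟩
      have hx : φ.e s = x := hx
      rw [← hx, φ.symm_e_e, proj_plane hs]
    · intro h0
      obtain ⟨s, hs, hx⟩ := hT x x.2
      rw [h0, map_zero, add_zero] at hx
      exact ⟨s, hs, (congrArg φ.e hx).symm.trans (φ.e_symm_e _)⟩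
  refine ⟨(Submodule.quotEquivOfEq _ _ hker).trans (p.quotKerEquivOfSurjective hsurj), fun x y => ?_⟩
  change E.form (proj E (φ.symm.e x)) (proj E (φ.symm.e y)) = L.form x y
  obtain ⟨s, hs, hx⟩ := hT x x.2
  obtain ⟨t, ht, hy⟩ := hT y y.2
  rw [← form_add_plane hs ht, ← hx, ← hy, φ.symm.map]

end Perp

/-! ### Orbits of planes -/

section Orbits

variable {K L : EvenLattice} {ι : Type*} {E : ι → EvenLattice}

/-- The quotient of `S^⊥` by `S` belongs to the genus. -/
lemma sameGenus_of_iso {M : EvenLattice} (φ : Iso (addU 2 M) L) (κ : Iso (addU 2 K) L) :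
    SameGenus M K := by
  have h1 : (U.sum (U.sum M)).sigPos = (U.sum (U.sum K)).sigPos :=
    φ.sigPos_eq.trans κ.sigPos_eq.symm
  have h2 : (U.sum (U.sum M)).sigNeg = (U.sum (U.sum K)).sigNeg :=
    φ.sigNeg_eq.trans κ.sigNeg_eq.symm
  rw [sigPos_sum, sigPos_sum, sigPos_sum, sigPos_sum] at h1
  rw [sigNeg_sum, sigNeg_sum, sigNeg_sum, sigNeg_sum] at h2
  refine ⟨by omega, by omega, (emb φ).disc.symm.trans (emb κ).disc, fun a => ?_⟩
  rw [AddEquiv.trans_apply, UEmb.discForm_disc, ← UEmb.discForm_disc (emb φ),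
    AddEquiv.apply_symm_apply]

/-- The complement `M` split off by `S` is in the genus of `K`, so it can be exchanged for a
representative without changing the plane. -/
lemma exists_index (hL : L.IntegrallyMaximal) (κ : Iso (addU 2 K) L) (hE : K.IsGenusSystem E)
    (S : L.I2) : ∃ (i : ι) (φ : Iso (addU 2 (E i)) L), I2.map φ (planeI2 (E i)) = S := by
  obtain ⟨M, φ, hφ⟩ := hL.exists_iso_addU S
  obtain ⟨i, e, he⟩ := hE.2.2 M (sameGenus_of_iso φ κ)
  let ε : Iso M (E i) := ⟨e, he⟩
  let α : Iso (addU 2 (E i)) (addU 2 M) := (Iso.refl U).sumCongr ((Iso.refl U).sumCongr ε.symm)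
  refine ⟨i, α.trans φ, ?_⟩
  rw [← hφ]
  refine Subtype.ext ?_
  have h1 : α.e (e₁ (E i)) = e₁ M := Prod.ext rfl (Prod.ext rfl (map_zero ε.symm.e))
  have h2 : α.e (e₂ (E i)) = e₂ M := Prod.ext rfl (Prod.ext rfl (map_zero ε.symm.e))
  change (plane (E i)).map (α.trans φ).e.toLinearMap = (plane M).map φ.e.toLinearMap
  rw [plane_eq_span, plane_eq_span, Submodule.map_span, Submodule.map_span, Set.image_pair,
    Set.image_pair]
  change Submodule.span ℤ {φ.e (α.e (e₁ (E i))), φ.e (α.e (e₂ (E i)))} = _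
  rw [h1, h2]
  rfl

variable (ψ : ∀ i, (E i).Disc ≃+ K.Disc) (hψ : ∀ i a, K.discForm (ψ i a) = (E i).discForm a)

/-- Equivalent planes have the same index and the same label modulo isometries. -/
lemma index_eq (κ : Iso (addU 2 K) L) (hE : K.IsGenusSystem E) {i j : ι}
    (φ : Iso (addU 2 (E i)) L) (φ' : Iso (addU 2 (E j)) L) {γ : L.O} (hγ : γ ∈ L.stableOPlus)
    (h : (I2.map φ (planeI2 (E i))).1.map (γ.1 : L →ₗ[ℤ] L) = (I2.map φ' (planeI2 (E j))).1) :
    (⟨i, QuotientGroup.mk (label (ψ i) (hψ i) κ φ)⟩ : Σ i, (E i).ODisc ⧸ (E i).τ.range) =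
      ⟨j, QuotientGroup.mk (label (ψ j) (hψ j) κ φ')⟩ := by
  let χ := (φ.trans (O.iso γ)).trans φ'.symm
  have hχ : (plane (E i)).map χ.e.toLinearMap = plane (E j) := by
    have h : ((plane (E i)).map φ.e.toLinearMap).map (γ.1 : L →ₗ[ℤ] L) =
      (plane (E j)).map φ'.e.toLinearMap := h
    have h1 := congrArg (Submodule.map φ'.symm.e.toLinearMap) h
    rw [← Submodule.map_comp, ← Submodule.map_comp, ← Submodule.map_comp] at h1
    refine Eq.trans h1 ?_
    convert Submodule.map_id _
    exact LinearMap.ext fun x => φ'.symm_e_e x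
  -- `χ` matches the standard planes, so the quotients `S^⊥/S` are isometric and the absence of
  -- repetition gives `i = j`.
  obtain ⟨η, hη⟩ := exists_iso_of_plane χ hχ
  obtain rfl := hE.2.1 i j ⟨η.e, η.map⟩
  congr 1
  let g : (E i).O := ⟨η.e, η.map⟩
  refine (QuotientGroup.eq.2 ?_).symm
  refine ⟨g, ?_⟩
  -- What remains is that the label of `φ` is that of `φ'` times `τ(η)`; triviality of `γ` on the
  -- discriminant group of `L` makes the two restrictions comparable.
  rw [eq_inv_mul_iff_mul_eq, eq_comm, label_eq_iff]
  intro f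
  have h1 : L.cl (f ∘ₗ γ.1.toLinearMap) = L.cl f := L.cl_eq_cl.2 (L.mem_ker_τ.1 hγ.1 f)
  have h2 : (E i).cl (f ∘ₗ (emb φ).i) = (E i).cl ((f ∘ₗ (emb φ').i) ∘ₗ g.1.toLinearMap) := by
    rw [← UEmb.disc_cl, ← h1, UEmb.disc_cl, cl_eq_cl]
    refine Eq.mp (congrArg (E i).Repr (LinearMap.ext fun x => ?_))
      (repr_comp_of_plane hη (f ∘ₗ φ'.e.toLinearMap))
    exact congrArg (fun z => f z - f (φ'.e (inAddU 2 (E i) (η.e x))))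
      (φ'.e_symm_e (γ.1 (φ.e (inAddU 2 (E i) x))))
  rw [h2]
  change (label (ψ i) (hψ i) κ φ').1 ((E i).discMap g ((E i).cl _)) = _
  rw [discMap_cl]
  exact (label_eq_iff (ψ i) (hψ i) κ φ' _).1 rfl f

/-- The orbits of primitive isotropic planes in `U² ⊕ K` under the stable group, when `U² ⊕ K` is
integrally maximal. -/
theorem exists_orbits_equiv (hL : L.IntegrallyMaximal) (κ : Iso (addU 2 K) L)
    (hE : K.IsGenusSystem E) :
    ∃ Φ : I2.Orbits L L.stableOPlus ≃ (Σ i : ι, (E i).ODisc ⧸ (E i).τ.range),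
      ∀ S : L.I2, S.PerpQuotientIsometric (E (Φ (Quotient.mk _ S)).1) := by
  choose hp hn ψ hψ using hE.1
  choose i φ hφ using exists_index hL κ hE
  let F : L.I2 → (Σ i : ι, (E i).ODisc ⧸ (E i).τ.range) := fun S =>
    ⟨i S, QuotientGroup.mk (label (ψ _) (hψ _) κ (φ S))⟩
  have hF : ∀ S T : L.I2, (I2.orbitRel L L.stableOPlus) S T → F S = F T := by
    rintro S T ⟨γ, hγ, h⟩
    refine index_eq ψ hψ κ hE (φ S) (φ T) hγ ?_
    rw [hφ, hφ, h]
  let Φ : I2.Orbits L L.stableOPlus → (Σ i : ι, (E i).ODisc ⧸ (E i).τ.range) := Quotient.lift F hF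
  have hinj : Function.Injective Φ := by
    intro s t
    induction s using Quotient.inductionOn with | _ S
    induction t using Quotient.inductionOn with | _ T
    intro h
    have h : F S = F T := h
    refine Quotient.sound ?_
    -- When the cosets agree, adjusting `α` by an isometry of `E i` makes the labels equal without
    -- moving the plane.
    have key : ∀ (i j : ι) (α : Iso (addU 2 (E i)) L) (β : Iso (addU 2 (E j)) L),
        (⟨i, QuotientGroup.mk (label (ψ i) (hψ i) κ α)⟩ : Σ i, (E i).ODisc ⧸ (E i).τ.range) =
          ⟨j, QuotientGroup.mk (label (ψ j) (hψ j) κ β)⟩ →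
        (I2.orbitRel L L.stableOPlus) (I2.map α (planeI2 (E i))) (I2.map β (planeI2 (E j))) := by
      intro i j α β hij
      obtain rfl : i = j := congrArg Sigma.fst hij
      have h1 := eq_of_heq (Sigma.mk.inj hij).2
      obtain ⟨g, hg⟩ := QuotientGroup.eq.1 h1
      rw [eq_inv_mul_iff_mul_eq, ← label_extend] at hg
      rw [← I2.map_extend g α]
      exact exists_stableOPlus_of_label_eq _ _ _ hg
    have := key _ _ _ _ h
    rwa [hφ, hφ] at this
  have hsurj : Function.Surjective Φ := by
    rintro ⟨j, q⟩
    obtain ⟨l, rfl⟩ := QuotientGroup.mk_surjective q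
    obtain ⟨β, rfl⟩ := exists_label_eq (ψ j) (hψ j) κ (hp j) (hn j) l
    refine ⟨Quotient.mk _ (I2.map β (planeI2 (E j))), ?_⟩
    -- The isometry chosen for this plane may differ from `β`; `index_eq` with `γ = 1` shows that
    -- the pair does not depend on the choice.
    refine index_eq ψ hψ κ hE _ β (one_mem _) ?_
    rw [hφ]
    exact Submodule.map_id _
  refine ⟨Equiv.ofBijective Φ ⟨hinj, hsurj⟩, fun S => ?_⟩
  have h1 := perpQuotientIsometric (φ S)
  rw [hφ] at h1
  exact h1

end Orbits

end EvenLattice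

end

theorem mainTheorem9 (d : ℕ) (hsq : Squarefree d) (hd : d % 4 = 3)
    {ι : Type*} (E : ι → EvenLattice) (hE : (EvenLattice.E8E8B d hd).IsGenusSystem E) :
    ∃ Φ : EvenLattice.I2.Orbits (EvenLattice.N d hd) (EvenLattice.N d hd).stableOPlus ≃
        (Σ i : ι, (E i).ODisc ⧸ (E i).τ.range),
      ∀ S : (EvenLattice.N d hd).I2, S.PerpQuotientIsometric (E (Φ (Quotient.mk _ S)).1) := by
  have κ : EvenLattice.Iso (EvenLattice.addU 2 (EvenLattice.E8E8B d hd)) (EvenLattice.N d hd) :=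
    (EvenLattice.sumAssoc EvenLattice.U EvenLattice.U (EvenLattice.E8E8B d hd)).symm
  exact EvenLattice.exists_orbits_equiv
    ((EvenLattice.integrallyMaximal_addU d hsq hd).of_iso κ) κ hE
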